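/- **Setting.** Let $X_1,X_2,\dots$ be independent, not necessarily identically distributed observations; $X_i$ has density $p_i(\cdot,\theta^*)$ with respect to a $\sigma$-finite measure $\nu_i$ (Lebesgue measure for a pdf, counting measure for a pmf), where $\{p_i(\cdot,\theta):\theta\in\Theta\}$ is a family of probability densities and $\Theta\subset\mathbb R^p$. Put $l_i(x,\theta)=-\log p_i(x,\theta)$ and $l(\theta)=\sum_{i=1}^n l_i(X_i,\theta)$. Let $\hat\theta_n$ be a maximum likelihood estimator: a measurable maximizer over $\Theta$ of $\prod_{i=1}^n p_i(X_i,\theta)$. Let $$\bar H_n(\theta)=\frac1n\frac{\partial^2 l(\theta)}{\partial\theta\,\partial\theta^T},\qquad \bar F_n(\theta)=E_\theta[\bar H_n(\theta)],\qquad V_n=n\,\mathrm{cov}(\hat\theta_n)$$ be the observed and the expected Fisher information matrix (FIM) and the normalized covariance of the MLE. **Regularity conditions.** 1. $\Theta$ is compact and $\theta^*$ lies in its interior. 2. There is an open set $W\supseteq\Theta$ such that $p_i(\cdot,\theta)$ is measurable for all $i$ and all $\theta\in W$, and for $\nu_i$-almost every $x$ the function $\theta\mapsto p_i(x,\theta)$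 is positive and four times continuously differentiable on $W$. 3. There are $\delta>0$, $C<\infty$ and functions $M_i,b_i$ ($M_i$ measurable) with $(1+M_i^4)b_i$ $\nu_i$-integrable and $\int(1+M_i^4)\,b_i\,d\nu_i\le C$ for all $i$, such that for $\nu_i$-almost every $x$: $l_i(x,\cdot)$ is Lipschitz on $\Theta$ with constant $M_i(x)$; and for $\|\theta-\theta^*\|<\delta$, $p_i(x,\theta)\le b_i(x)$ and the derivatives of $l_i(x,\cdot)$ of orders $1,\dots,4$ at $\theta$ have norm at most $M_i(x)$. 4. For every $\varepsilon>0$ there is $\eta>0$ such that for all large $n$ and all $\theta\in\Theta$ with $\|\theta-\theta^*\|\ge\varepsilon$ one has $\frac1n\sum_{i=1}^nE[l_i(X_i,\theta)-l_i(X_i,\theta^*)]\ge\eta$. 5. $\bar F_n(\theta^*)$ converges, as $n\to\infty$, to a positive definite matrix. **Confidence levels.** Fix a component $j$ and $\alpha_j\in(0,1)$. Let $\Phi$ be the standard normal distribution function, $z_{1-\alpha_j/2}$ its $(1-\alpha_j/2)$-quantile, and $$\pi_j(x)=2\Phi\Bigl(z_{1-\alpha_j/2}\sqrt{x/V_n(j,j)}\Bigr)-1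 .$$ The confidence level of the nominal $1-\alpha_j$ interval for the $j$-th component is approximated by plugging in the observed or the expected FIM at the MLE, with mean squared errors $$\mathrm{MSE}_{H_{jj}}=E\bigl[(1-\alpha_j)-\pi_j\bigl(\bar H_n(\hat\theta_n)^{-1}(j,j)\bigr)\bigr]^2,\qquad \mathrm{MSE}_{F_{jj}}=E\bigl[(1-\alpha_j)-\pi_j\bigl(\bar F_n(\hat\theta_n)^{-1}(j,j)\bigr)\bigr]^2$$ (conventions on the exceptional set: $\sqrt x=0$ for $x<0$, the inverse of a singular matrix is $0$, and $x/V_n(j,j)=0$ if $V_n(j,j)=0$). **Condition (5).** Let $U^i_{w}$ and $U^i_{tu}$ be the first and second partial derivatives of $l_i(X_i,\cdot)$ at $\theta^*$, $U_w=\sum_{i\le n}U_w^i$, $U_{tu}=\sum_{i\le n}U_{tu}^i$, $\bar\kappa^i_{tu}=E\,U^i_{tu}$, $\bar\kappa_{tu,v}=n^{-1}\mathrm{cov}(U_{tu},U_v)$, and $\bar\kappa^{r,s}=\bar F_n(\theta^*)^{-1}(r,s)$. Condition (5) for the component $j$ is $$\liminf_{n\to\infty}\frac1n\sum_{i=1}^n\mathrm{var}\Bigl[\sum_{t,u}\bar\kappa^{j,t}\bar\kappa^{j,u}\Bigl(U^i_{tu}-\bar\kappa^i_{tu}-\sum_{v,w}\bar\kappa_{tu,v}\bar\kappa^{v,w}U^i_w\Bigr)\Bigr]>0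 .$$ **Theorem 1.** Under the regularity conditions 1–5, for every $j=1,\dots,p$ and every $\alpha_j\in(0,1)$: (a) $\displaystyle\liminf_{n\to\infty}\,n\,\bigl(\mathrm{MSE}_{H_{jj}}-\mathrm{MSE}_{F_{jj}}\bigr)\ge0$; (b) if $\displaystyle\liminf_{n\to\infty}\,n\,\mathrm{MSE}_{H_{jj}}>0$, then $\displaystyle\liminf_{n\to\infty}\frac{\mathrm{MSE}_{H_{jj}}}{\mathrm{MSE}_{F_{jj}}}\ge1$; (c) if condition (5) holds for $j$, then $\displaystyle\liminf_{n\to\infty}\frac{\mathrm{MSE}_{H_{jj}}}{\mathrm{MSE}_{F_{jj}}}>1$. Here a quotient with denominator $0$ and positive numerator is $+\infty$. -/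

import Mathlib

open MeasureTheory ProbabilityTheory Filter Topology
open scoped ENNReal BigOperators

noncomputable section

/-- Parameter vectors `θ = (t_1, …, t_p)`. -/
abbrev Param (p : ℕ) : Type := EuclideanSpace ℝ (Fin p)

/-- Partial derivative `∂g/∂t_r`. -/
def partialD {p : ℕ} (r : Fin p) (g : Param p → ℝ) (θ : Param p) : ℝ :=
  fderiv ℝ g θ (EuclideanSpace.single r 1)

variable {p : ℕ} {𝒳 Ω : Type*} [MeasurableSpace 𝒳] [MeasurableSpace Ω]

/-- Law of the `i`-th observation at the parameter `θ`: density `f i · θ` with respect to the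
dominating measure `ν i` (Lebesgue measure for a pdf, counting measure for a pmf). -/
def obsLaw (ν : ℕ → Measure 𝒳) (f : ℕ → 𝒳 → Param p → ℝ) (i : ℕ) (θ : Param p) : Measure 𝒳 :=
  (ν i).withDensity (fun x => ENNReal.ofReal (f i x θ))

/-- Negative log-likelihood `l_i` of a single observation `x` with index `i`. -/
def negLogLikOne (f : ℕ → 𝒳 → Param p → ℝ) (i : ℕ) (x : 𝒳) (θ : Param p) : ℝ :=
  -Real.log (f i x θ)

/-- Negative log-likelihood `l = ∑ l_i` of the first `n` observations of `x`. -/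
def negLogLik (f : ℕ → 𝒳 → Param p → ℝ) (n : ℕ) (x : ℕ → 𝒳) (θ : Param p) : ℝ :=
  ∑ i ∈ Finset.range n, negLogLikOne f i (x i) θ

/-- Observed Fisher information `n⁻¹ ∂²l/∂θ∂θᵀ`. -/
def observedFIM (f : ℕ → 𝒳 → Param p → ℝ) (n : ℕ) (x : ℕ → 𝒳) (θ : Param p) :
    Matrix (Fin p) (Fin p) ℝ :=
  Matrix.of fun r s => (n : ℝ)⁻¹ * partialD r (partialD s (negLogLik f n x)) θ

/-- Expected Fisher information: the expectation of the observed Fisher information at `θ` when the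
data are generated under the same `θ`. -/
def expectedFIM (ν : ℕ → Measure 𝒳) (f : ℕ → 𝒳 → Param p → ℝ) (n : ℕ) (θ : Param p) :
    Matrix (Fin p) (Fin p) ℝ :=
  Matrix.of fun r s => (n : ℝ)⁻¹ * ∑ i ∈ Finset.range n,
    ∫ x, partialD r (partialD s (negLogLikOne f i x)) θ ∂(obsLaw ν f i θ)

/-- Regularity conditions on a family of models for independent, not necessarily identically
distributed observations, with parameter set `Θ` and true parameter `θ₀`. -/
structure RegularModel (ν : ℕ → Measure 𝒳) (f : ℕ → 𝒳 → Param p → ℝ)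
    (Θ : Set (Param p)) (θ₀ : Param p) : Prop where
  sigmaFinite : ∀ i, SigmaFinite (ν i)
  isCompact : IsCompact Θ
  mem_interior : θ₀ ∈ interior Θ
  isProbabilityMeasure : ∀ i, ∀ θ ∈ Θ, IsProbabilityMeasure (obsLaw ν f i θ)
  /-- Positive densities on a common support, measurable in the observation and four times
  continuously differentiable in the parameter on an open set containing `Θ`. -/
  smooth : ∃ W : Set (Param p), IsOpen W ∧ Θ ⊆ W ∧
    (∀ i, ∀ θ ∈ W, Measurable fun x => f i x θ) ∧
    ∀ i, ∀ᵐ x ∂(ν i), (∀ θ ∈ W, 0 < f i x θ) ∧ ContDiffOn ℝ 4 (f i x) W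
  /-- Domination: `M i` is a Lipschitz constant of the log-likelihood on `Θ` and bounds its
  derivatives of orders one to four near `θ₀`; `b i` bounds the density near `θ₀`; and
  `∫ (1 + (M i)⁴) b i` is bounded uniformly in `i`. -/
  dominated : ∃ (δ C : ℝ) (M b : ℕ → 𝒳 → ℝ), 0 < δ ∧ (∀ i, Measurable (M i)) ∧
    (∀ i, ∀ᵐ x ∂(ν i), ∀ θ ∈ Θ, ∀ θ' ∈ Θ,
      |negLogLikOne f i x θ - negLogLikOne f i x θ'| ≤ M i x * ‖θ - θ'‖) ∧
    (∀ i, ∀ᵐ x ∂(ν i), ∀ θ ∈ Metric.ball θ₀ δ, f i x θ ≤ b i x ∧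
      ∀ k ∈ Finset.Icc 1 4, ‖iteratedFDeriv ℝ k (negLogLikOne f i x) θ‖ ≤ M i x) ∧
    ∀ i, Integrable (fun x => (1 + M i x ^ 4) * b i x) (ν i) ∧
      ∫ x, (1 + M i x ^ 4) * b i x ∂(ν i) ≤ C
  /-- Identifiability of `θ₀`: away from `θ₀` the average Kullback–Leibler divergence from the true
  model stays bounded away from zero. -/
  identifiable : ∀ ε > 0, ∃ η > 0, ∀ᶠ n : ℕ in atTop, ∀ θ ∈ Θ, ε ≤ ‖θ - θ₀‖ →
    η ≤ (n : ℝ)⁻¹ * ∑ i ∈ Finset.range n,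
      ∫ x, (negLogLikOne f i x θ - negLogLikOne f i x θ₀) ∂(obsLaw ν f i θ₀)
  /-- The expected Fisher information at `θ₀` has a positive definite limit. -/
  fim_limit : ∃ F : Matrix (Fin p) (Fin p) ℝ, F.PosDef ∧
    Tendsto (fun n => expectedFIM ν f n θ₀) atTop (𝓝 F)

/-- `θhat n` is a (measurable) maximum likelihood estimator over `Θ` based on the first `n`
observations. -/
def IsMLE (P : Measure Ω) (f : ℕ → 𝒳 → Param p → ℝ) (Θ : Set (Param p)) (X : ℕ → Ω → 𝒳)
    (θhat : ℕ → Ω → Param p) : Prop :=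
  ∀ n, Measurable (θhat n) ∧ ∀ᵐ ω ∂P, θhat n ω ∈ Θ ∧
    IsMaxOn (fun θ => ∏ i ∈ Finset.range n, f i (X i ω) θ) Θ (θhat n ω)

/-- The normalized covariance matrix `V_n = n cov(θhat_n)`. -/
def normCov (P : Measure Ω) (θhat : ℕ → Ω → Param p) (n : ℕ) : Matrix (Fin p) (Fin p) ℝ :=
  Matrix.of fun r s => (n : ℝ) * cov[fun ω => θhat n ω r, fun ω => θhat n ω s; P]

/-- Standard normal distribution function. -/
def stdNormalCDF (x : ℝ) : ℝ := cdf (gaussianReal 0 1) x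

/-- Standard normal quantile `z_u`, for `0 < u < 1`. -/
def stdNormalQuantile (u : ℝ) : ℝ := sInf {x : ℝ | u ≤ stdNormalCDF x}

/-- Confidence level `2 Φ(z_{1-α/2} √(x / v)) - 1` of the nominal `1 - α` interval built with the
variance `x` in place of the variance `v`. -/
def confLevel (α v x : ℝ) : ℝ :=
  2 * stdNormalCDF (stdNormalQuantile (1 - α / 2) * Real.sqrt (x / v)) - 1

/-- Mean squared error of the confidence level for the `j`-th component with the observed Fisher
information at the MLE. -/
def mseObserved (P : Measure Ω) (f : ℕ → 𝒳 → Param p → ℝ) (X : ℕ → Ω → 𝒳)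
    (θhat : ℕ → Ω → Param p) (α : ℝ) (j : Fin p) (n : ℕ) : ℝ≥0∞ :=
  ∫⁻ ω, ENNReal.ofReal (((1 - α) - confLevel α (normCov P θhat n j j)
    ((observedFIM f n (fun i => X i ω) (θhat n ω))⁻¹ j j)) ^ 2) ∂P

/-- Mean squared error of the confidence level for the `j`-th component with the expected Fisher
information at the MLE. -/
def mseExpected (P : Measure Ω) (ν : ℕ → Measure 𝒳) (f : ℕ → 𝒳 → Param p → ℝ)
    (θhat : ℕ → Ω → Param p) (α : ℝ) (j : Fin p) (n : ℕ) : ℝ≥0∞ :=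
  ∫⁻ ω, ENNReal.ofReal (((1 - α) - confLevel α (normCov P θhat n j j)
    ((expectedFIM ν f n (θhat n ω))⁻¹ j j)) ^ 2) ∂P

/-- `κ_{rs,t} = n⁻¹ cov(U_{rs}, U_t)`, for the derivatives `U_{rs}`, `U_t` at `θ₀` of the negative
log-likelihood of the first `n` observations. -/
def nullCov (P : Measure Ω) (f : ℕ → 𝒳 → Param p → ℝ) (X : ℕ → Ω → 𝒳) (θ₀ : Param p)
    (n : ℕ) (r s t : Fin p) : ℝ :=
  (n : ℝ)⁻¹ * cov[fun ω => partialD r (partialD s (negLogLik f n fun i => X i ω)) θ₀,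
    fun ω => partialD t (negLogLik f n fun i => X i ω) θ₀; P]

/-- The random variable
`∑_{t,u} κ^{j,t} κ^{j,u} (U^i_{tu} - κ^i_{tu} - ∑_{v,w} κ_{tu,v} κ^{v,w} U^i_w)`,
where `U^i_{tu}`, `U^i_w` are derivatives at `θ₀` of the negative log-likelihood of the `i`-th
observation, `κ^i_{tu}` is the mean of `U^i_{tu}`, and `κ^{r,s}` are the entries of the inverse of
the expected Fisher information of the first `n` observations at `θ₀`. -/
def curvatureTerm (P : Measure Ω) (ν : ℕ → Measure 𝒳) (f : ℕ → 𝒳 → Param p → ℝ)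
    (X : ℕ → Ω → 𝒳) (θ₀ : Param p) (j : Fin p) (n i : ℕ) (ω : Ω) : ℝ :=
  ∑ t, ∑ u, (expectedFIM ν f n θ₀)⁻¹ j t * (expectedFIM ν f n θ₀)⁻¹ j u *
    (partialD t (partialD u (negLogLikOne f i (X i ω))) θ₀
      - (∫ ω', partialD t (partialD u (negLogLikOne f i (X i ω'))) θ₀ ∂P)
      - ∑ v, ∑ w, nullCov P f X θ₀ n t u v * (expectedFIM ν f n θ₀)⁻¹ v w *
          partialD w (negLogLikOne f i (X i ω)) θ₀)

/-- Nondegeneracy of the difference of the two inverse informations in the entry `(j, j)`: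
`liminf n⁻¹ ∑_{i<n} var(curvatureTerm) > 0`. -/
def NondegenerateCurvature (P : Measure Ω) (ν : ℕ → Measure 𝒳) (f : ℕ → 𝒳 → Param p → ℝ)
    (X : ℕ → Ω → 𝒳) (θ₀ : Param p) (j : Fin p) : Prop :=
  0 < liminf (fun n : ℕ => (((n : ℝ)⁻¹ * ∑ i ∈ Finset.range n,
    Var[curvatureTerm P ν f X θ₀ j n i; P] : ℝ) : EReal)) atTop

end

noncomputable section

set_option linter.unusedSectionVars false

variable {p : ℕ} {𝒳 Ω : Type*} [MeasurableSpace 𝒳] [MeasurableSpace Ω]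

/-! ### The standard normal distribution function -/

/-! Write `v` for `V_n(j,j)` and `a` for the `(j,j)` entry of the inverse expected information at
`θ₀`. With `x` plugged in for the variance, the squared error of the level depends smoothly on `x /
v` near `1` and vanishes to second order there: it equals `c * (x / v - 1) ^ 2` up to a cubic error,
with `c > 0` depending only on `α` (`exists_abs_sq_sub_confLevel_sub_le`). So the comparison, at
scale `1 / n`, reduces to second moments of `x - v`.

To first order, `θhat - θ₀` is minus the inverse information applied to the average score, and the
two plug-in variances are `a - leadObserved` and `a - leadExpected` (`exists_expansion`). The term
`leadExpected` is linear in the average score, because the expected information feels the data only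
through `θhat`. The observed information also fluctuates at fixed parameter, and `leadObserved =
leadResidual + leadExpected`, where `leadResidual` is the average Hessian fluctuation with its
projection on the score removed. The information identity makes this projection explicit and the two
summands orthogonal. Hence the second moment of `leadObserved` exceeds that of `leadExpected` by
exactly `τ n / n`, where `τ n` is the average variance in the nondegeneracy condition
(`integral_leadObserved_sq`). Both leading terms are centred, so the deterministic offset `a - v`
enters both errors through the same square and drops out of the difference. What remains is `n *
(MSE_H - MSE_F) ≥ c' * τ n - K / √n` and `n * MSE_F ≤ K` (`exists_mse_bounds`), from which the three
claims follow (`liminf_comparison`).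

Expansions in probability would not suffice, since means of squares are compared. All errors are
therefore measured by one variable `Z n`, the sum of `n^(-1/2)` and finitely many absolute centred
averages, with fourth moment `O(n⁻²)`. Where `Z n` is below a fixed `η`, compactness and
identifiability force `θhat` close to `θ₀`, and deterministic expansions hold with error `K * Z n ^
2` (`exists_mle_expansion`). Where `Z n ≥ η`, the squared level error and the compact parameter set
give bounded quantities, and `1 ≤ (Z n / η) ^ k` turns a constant into a moment of `Z n`. No
separate estimate of tail probabilities is needed. -/

theorem contDiff_gaussianPDFReal (μ : ℝ) (v : NNReal) {n : WithTop ℕ∞} :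
    ContDiff ℝ n (gaussianPDFReal μ v) := by
  unfold gaussianPDFReal
  fun_prop

theorem stdNormalCDF_eq_integral (x : ℝ) :
    stdNormalCDF x = ∫ t in Set.Iic x, gaussianPDFReal 0 1 t := by
  rw [stdNormalCDF, cdf_eq_real, measureReal_def,
    gaussianReal_apply_eq_integral 0 one_ne_zero, ENNReal.toReal_ofReal]
  exact integral_nonneg fun t => gaussianPDFReal_nonneg 0 1 t

theorem hasDerivAt_stdNormalCDF (x : ℝ) :
    HasDerivAt stdNormalCDF (gaussianPDFReal 0 1 x) x := by
  have hc : Continuous (gaussianPDFReal 0 1) :=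
    (contDiff_gaussianPDFReal 0 1 (n := 0)).continuous
  have hi : Integrable (gaussianPDFReal 0 1) := integrable_gaussianPDFReal 0 1
  have h : stdNormalCDF = fun x => stdNormalCDF 0 + ∫ t in (0 : ℝ)..x, gaussianPDFReal 0 1 t := by
    funext y
    rw [← intervalIntegral.integral_Iic_sub_Iic hi.integrableOn hi.integrableOn,
      ← stdNormalCDF_eq_integral, ← stdNormalCDF_eq_integral]
    ring
  rw [h]
  exact (intervalIntegral.integral_hasDerivAt_right (hc.intervalIntegrable _ _)
    hc.stronglyMeasurable.stronglyMeasurableAtFilter hc.continuousAt).const_add _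

theorem continuous_stdNormalCDF : Continuous stdNormalCDF :=
  continuous_iff_continuousAt.2 fun x => (hasDerivAt_stdNormalCDF x).continuousAt

theorem monotone_stdNormalCDF : Monotone stdNormalCDF := monotone_cdf _

/-- Invariance under negation gives the two closed half-lines equal mass, and the absence of an atom
at `0` makes them complementary up to a null set. -/
theorem stdNormalCDF_zero : stdNormalCDF 0 = 1 / 2 := by
  have hsymm : (gaussianReal 0 1) (Set.Iic 0) = (gaussianReal 0 1) (Set.Ici 0) := by
    have h := gaussianReal_map_neg (μ := 0) (v := 1)
    rw [neg_zero] at h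
    conv_lhs => rw [← h]
    rw [Measure.map_apply measurable_neg measurableSet_Iic]
    congr 1
    ext x
    simp
  have : NullSingletonClass (gaussianReal 0 1) := nullSingletonClass_gaussianReal one_ne_zero
  have hatom : (gaussianReal 0 1) (Set.Ici 0) = (gaussianReal 0 1) (Set.Ioi 0) :=
    measure_congr Ioi_ae_eq_Ici.symm
  have hsum := prob_add_prob_compl (μ := gaussianReal 0 1) (s := Set.Iic 0) measurableSet_Iic
  rw [Set.compl_Iic, ← hatom, ← hsymm] at hsum
  have hr : (gaussianReal 0 1).real (Set.Iic 0) + (gaussianReal 0 1).real (Set.Iic 0) = 1 := by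
    rw [measureReal_def, ← ENNReal.toReal_add (measure_ne_top _ _) (measure_ne_top _ _), hsum]
    simp
  rw [stdNormalCDF, cdf_eq_real]
  linarith

/-- Continuity is used twice: the superlevel set is closed, so its infimum belongs to it, and the
values just to the left, all below `u`, converge to the value at the infimum. -/
theorem stdNormalCDF_stdNormalQuantile {u : ℝ} (hu : 0 < u) (hu' : u < 1) :
    stdNormalCDF (stdNormalQuantile u) = u := by
  set S := {x : ℝ | u ≤ stdNormalCDF x} with hS
  have hne : S.Nonempty := by
    have h1 : Tendsto stdNormalCDF atTop (𝓝 1) := tendsto_cdf_atTop _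
    obtain ⟨x, hx⟩ := (h1.eventually (lt_mem_nhds hu')).exists
    exact ⟨x, hx.le⟩
  have hbdd : BddBelow S := by
    have h1 : Tendsto stdNormalCDF atBot (𝓝 0) := tendsto_cdf_atBot _
    obtain ⟨y, hy⟩ := (h1.eventually (gt_mem_nhds hu)).exists
    refine ⟨y, fun x hx => ?_⟩
    by_contra hxy
    have := monotone_stdNormalCDF (not_le.1 hxy).le
    have hx' : u ≤ stdNormalCDF x := hx
    linarith
  have hclosed : IsClosed S := isClosed_le continuous_const continuous_stdNormalCDF
  have hmem : u ≤ stdNormalCDF (stdNormalQuantile u) := hclosed.csInf_mem hne hbdd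
  refine le_antisymm ?_ hmem
  have htend : Tendsto stdNormalCDF (𝓝[<] (stdNormalQuantile u))
      (𝓝 (stdNormalCDF (stdNormalQuantile u))) :=
    continuous_stdNormalCDF.continuousAt.tendsto.mono_left nhdsWithin_le_nhds
  refine le_of_tendsto htend ?_
  filter_upwards [self_mem_nhdsWithin] with x hx
  by_contra hxu
  exact (not_le.2 hx) (csInf_le hbdd (not_le.1 hxu).le)

/-- Positivity of the quantile makes the derivative of the level at ratio `1` nonzero, hence the
quadratic coefficient `c` positive. -/
theorem stdNormalQuantile_pos {u : ℝ} (hu : 1 / 2 < u) (hu' : u < 1) :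
    0 < stdNormalQuantile u := by
  by_contra h
  have h1 := monotone_stdNormalCDF (not_lt.1 h)
  rw [stdNormalCDF_stdNormalQuantile (by linarith) hu', stdNormalCDF_zero] at h1
  linarith

/-- This needs nothing about `v` and `x`, so it also covers the conventions for singular matrices
and negative ratios; it is what makes local expansions global. -/
theorem abs_sub_confLevel_le_two {α v x : ℝ} (hα : 0 < α) (hα' : α < 1) :
    |(1 - α) - confLevel α v x| ≤ 2 := by
  have h0 : 0 ≤ stdNormalCDF (stdNormalQuantile (1 - α / 2) * Real.sqrt (x / v)) := cdf_nonneg _ _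
  have h1 : stdNormalCDF (stdNormalQuantile (1 - α / 2) * Real.sqrt (x / v)) ≤ 1 := cdf_le_one _ _
  rw [confLevel, abs_le]
  constructor <;> linarith

/-- Quadratic behaviour of the squared error of the confidence level in the ratio of the
variances. -/
theorem exists_abs_sq_sub_confLevel_sub_le {α : ℝ} (hα : 0 < α) (hα' : α < 1) :
    ∃ c K : ℝ, 0 < c ∧ 0 ≤ K ∧ ∀ v x : ℝ,
      |((1 - α) - confLevel α v x) ^ 2 - c * (x / v - 1) ^ 2| ≤ K * |x / v - 1| ^ 3 := by
  set z := stdNormalQuantile (1 - α / 2) with hz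
  have hzpos : 0 < z := stdNormalQuantile_pos (by linarith) (by linarith)
  have hΦz : stdNormalCDF z = 1 - α / 2 :=
    stdNormalCDF_stdNormalQuantile (by linarith) (by linarith)
  -- In terms of `s = x / v` the level is `ψ s - 1`, and the nominal level is `ψ 1 - 1`.
  set ψ : ℝ → ℝ := fun s => 2 * stdNormalCDF (z * Real.sqrt s) with hψ
  set ψ' : ℝ → ℝ := fun s => gaussianPDFReal 0 1 (z * Real.sqrt s) * (z / Real.sqrt s) with hψ'
  have hderiv : ∀ s : ℝ, 0 < s → HasDerivAt ψ (ψ' s) s := by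
    intro s hs
    have h := ((hasDerivAt_stdNormalCDF (z * Real.sqrt s)).comp s
      ((Real.hasDerivAt_sqrt hs.ne').const_mul z)).const_mul 2
    have hs' : Real.sqrt s ≠ 0 := (Real.sqrt_pos.2 hs).ne'
    refine h.congr_deriv ?_
    simp only [hψ']
    field_simp
  have hsm : ContDiffAt ℝ 1 ψ' 1 := by
    have hsq : ContDiffAt ℝ 1 Real.sqrt 1 := Real.contDiffAt_sqrt one_ne_zero
    refine ContDiffAt.mul ?_ (contDiffAt_const.div hsq (by simp))
    exact (contDiff_gaussianPDFReal 0 1).contDiffAt.comp _ (contDiffAt_const.mul hsq)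
  -- A Lipschitz bound for `ψ'` near `1` gives the quadratic Taylor remainder of `ψ`; the radius `r
  -- ≤ 1 / 2` keeps `s` away from the singularity of the square root.
  obtain ⟨L, t, ht, hL⟩ := hsm.exists_lipschitzOnWith
  obtain ⟨ρ, hρ, hρt⟩ := Metric.mem_nhds_iff.1 ht
  set r := min (ρ / 2) (1 / 2) with hr
  have hrpos : 0 < r := by positivity
  have hrρ : r < ρ := lt_of_le_of_lt (min_le_left _ _) (by linarith)
  have hr1 : r ≤ 1 / 2 := min_le_right _ _
  have htay : ∀ s : ℝ, |s - 1| ≤ r → |ψ s - ψ 1 - ψ' 1 * (s - 1)| ≤ L * |s - 1| ^ 2 := by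
    intro s hs
    have hsub : ∀ y ∈ Metric.closedBall (1 : ℝ) |s - 1|, y ∈ t ∧ 0 < y := by
      intro y hy
      rw [Metric.mem_closedBall, Real.dist_eq] at hy
      refine ⟨hρt ?_, ?_⟩
      · rw [Metric.mem_ball, Real.dist_eq]; linarith
      · have := (abs_le.1 (hy.trans hs)).1; linarith
    have h1t : (1 : ℝ) ∈ t := hρt (Metric.mem_ball_self hρ)
    have h := Convex.norm_image_sub_le_of_norm_hasFDerivWithin_le'
      (f := ψ) (f' := fun y => ContinuousLinearMap.toSpanSingleton ℝ (ψ' y))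
      (φ := ContinuousLinearMap.toSpanSingleton ℝ (ψ' 1)) (C := L * |s - 1|)
      (s := Metric.closedBall (1 : ℝ) |s - 1|) (x := 1) (y := s)
      (fun y hy => (hderiv y (hsub y hy).2).hasFDerivAt.hasFDerivWithinAt) ?_
      (convex_closedBall _ _) (Metric.mem_closedBall_self (abs_nonneg _))
      (by rw [Metric.mem_closedBall, Real.dist_eq])
    · rw [Real.norm_eq_abs, Real.norm_eq_abs] at h
      simp only [ContinuousLinearMap.toSpanSingleton_apply, smul_eq_mul] at h
      rw [mul_comm (ψ' 1)]
      nlinarith [h]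
    · intro y hy
      have hsub' : ContinuousLinearMap.toSpanSingleton ℝ (ψ' y) -
          ContinuousLinearMap.toSpanSingleton ℝ (ψ' 1) =
          ContinuousLinearMap.toSpanSingleton ℝ (ψ' y - ψ' 1) := by
        ext
        simp
      rw [hsub', ContinuousLinearMap.norm_toSpanSingleton]
      refine (hL.norm_sub_le (hsub y hy).1 h1t).trans ?_
      rw [Metric.mem_closedBall, Real.dist_eq] at hy
      exact mul_le_mul_of_nonneg_left hy L.2
  have hψ'1 : 0 < ψ' 1 := by
    simp only [hψ', Real.sqrt_one, mul_one, div_one]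
    exact mul_pos (gaussianPDFReal_pos 0 1 _ one_ne_zero) hzpos
  set a := ψ' 1 with ha
  -- The first part of the constant serves `|s - 1| ≤ r`, by factoring the difference of squares
  -- into a quadratic and a linear factor. The second serves `|s - 1| > r`, where the error is at
  -- most `4 + a ^ 2 * |s - 1| ^ 2` and both terms are dominated by `|s - 1| ^ 3 / r ^ 3`.
  refine ⟨a ^ 2, (L * (L + 2 * a)) + (4 + a ^ 2) / r ^ 3, by positivity, by positivity, ?_⟩
  intro v x
  set s := x / v with hs
  have hG : (1 - α) - confLevel α v x = -(ψ s - ψ 1) := by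
    simp only [confLevel, hψ, Real.sqrt_one, mul_one, hΦz, ← hz, ← hs]
    ring
  have hG2 := abs_sub_confLevel_le_two (v := v) (x := x) hα hα'
  rw [hG] at hG2 ⊢
  rw [abs_neg] at hG2
  rw [neg_sq]
  rcases le_or_gt |s - 1| r with hsr | hsr
  · have h := htay s hsr
    set D := ψ s - ψ 1 with hD
    have e0 : 0 ≤ |s - 1| := abs_nonneg _
    have e1 : |D + a * (s - 1)| ≤ L * |s - 1| ^ 2 + 2 * a * |s - 1| := by
      have : D + a * (s - 1) = (D - a * (s - 1)) + 2 * a * (s - 1) := by ring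
      rw [this]
      refine (abs_add_le _ _).trans (add_le_add h (le_of_eq ?_))
      rw [abs_mul, abs_of_pos (by positivity : 0 < 2 * a)]
    have e2 : D ^ 2 - a ^ 2 * (s - 1) ^ 2 = (D - a * (s - 1)) * (D + a * (s - 1)) := by ring
    rw [e2, abs_mul]
    have hL0 : (0 : ℝ) ≤ L := L.2
    calc |D - a * (s - 1)| * |D + a * (s - 1)|
        ≤ (L * |s - 1| ^ 2) * (L * |s - 1| ^ 2 + 2 * a * |s - 1|) := by gcongr
      _ = L * (L * |s - 1| + 2 * a) * |s - 1| ^ 3 := by ring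
      _ ≤ L * (L * 1 + 2 * a) * |s - 1| ^ 3 := by gcongr; linarith
      _ ≤ (L * (L + 2 * a) + (4 + a ^ 2) / r ^ 3) * |s - 1| ^ 3 := by
        rw [mul_one]
        gcongr
        exact le_add_of_nonneg_right (by positivity)
  · have e0 : 0 ≤ |s - 1| := abs_nonneg _
    have e3 : r ^ 3 ≤ |s - 1| ^ 3 := by gcongr
    have e4 : |s - 1| ^ 2 * r ^ 3 ≤ |s - 1| ^ 3 := by
      have hr2 : r ^ 2 ≤ 1 := by nlinarith
      have : r ^ 3 ≤ |s - 1| := by nlinarith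
      nlinarith [sq_nonneg |s - 1|]
    have e5 : |(ψ s - ψ 1) ^ 2 - a ^ 2 * (s - 1) ^ 2| ≤ 4 + a ^ 2 * |s - 1| ^ 2 := by
      have : (ψ s - ψ 1) ^ 2 ≤ 4 := by
        rw [← sq_abs]; nlinarith [abs_nonneg (ψ s - ψ 1)]
      rw [sq_abs, abs_le]
      constructor <;> nlinarith [sq_nonneg (ψ s - ψ 1), sq_nonneg (a * (s - 1))]
    have hL0 : (0 : ℝ) ≤ L := L.2
    calc |(ψ s - ψ 1) ^ 2 - a ^ 2 * (s - 1) ^ 2| ≤ 4 + a ^ 2 * |s - 1| ^ 2 := e5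
      _ = (4 * r ^ 3 + a ^ 2 * (|s - 1| ^ 2 * r ^ 3)) / r ^ 3 := by field_simp
      _ ≤ (4 * |s - 1| ^ 3 + a ^ 2 * |s - 1| ^ 3) / r ^ 3 := by gcongr
      _ = (4 + a ^ 2) / r ^ 3 * |s - 1| ^ 3 := by ring
      _ ≤ (L * (L + 2 * a) + (4 + a ^ 2) / r ^ 3) * |s - 1| ^ 3 := by
        gcongr
        exact le_add_of_nonneg_left (by positivity)

/-! ### Fourth moments of centred averages -/

theorem memLp_four_iff_integrable_pow {P : Measure Ω} {Y : Ω → ℝ} (hY : AEStronglyMeasurable Y P) :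
    MemLp Y 4 P ↔ Integrable (fun ω => Y ω ^ 4) P := by
  rw [← integrable_norm_rpow_iff hY (by norm_num) (by norm_num)]
  refine integrable_congr (Eventually.of_forall fun ω => ?_)
  simp only [Real.norm_eq_abs, ENNReal.toReal_ofNat]
  rw [show (4 : ℝ) = ((4 : ℕ) : ℝ) by norm_num, Real.rpow_natCast, Even.pow_abs (by decide)]

theorem abs_pow_le_one_add_pow_four (x : ℝ) {k : ℕ} (hk : k ≤ 4) : |x| ^ k ≤ 1 + x ^ 4 := by
  have h4 : x ^ 4 = |x| ^ 4 := by rw [Even.pow_abs (by decide)]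
  rw [h4]
  rcases le_total |x| 1 with h | h
  · have := pow_le_one₀ (n := k) (abs_nonneg x) h
    have : 0 ≤ |x| ^ 4 := by positivity
    linarith
  · have := pow_le_pow_right₀ h hk
    linarith

namespace MeasureTheory.MemLp

variable {P : Measure Ω} [IsProbabilityMeasure P] {Y Y' : Ω → ℝ}

theorem integrable_pow_of_four (hY : MemLp Y 4 P) {k : ℕ} (hk : k ≤ 4) :
    Integrable (fun ω => Y ω ^ k) P := by
  have h4 := (memLp_four_iff_integrable_pow hY.1).1 hY
  refine ((integrable_const (1 : ℝ)).add h4).mono' (hY.1.pow k) (Eventually.of_forall fun ω => ?_)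
  rw [norm_pow, Real.norm_eq_abs]
  exact abs_pow_le_one_add_pow_four _ hk

theorem integrable_abs_pow_of_four (hY : MemLp Y 4 P) {k : ℕ} (hk : k ≤ 4) :
    Integrable (fun ω => |Y ω| ^ k) P := by
  refine (hY.integrable_pow_of_four hk).norm.congr (Eventually.of_forall fun ω => ?_)
  simp

theorem two_of_four (hY : MemLp Y 4 P) : MemLp Y 2 P := hY.mono_exponent (by norm_num)

theorem integrable_of_four (hY : MemLp Y 4 P) : Integrable Y P := hY.integrable (by norm_num)

end MeasureTheory.MemLp

theorem add_pow_four_le (x y : ℝ) : (x + y) ^ 4 ≤ 8 * (x ^ 4 + y ^ 4) := by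
  nlinarith [sq_nonneg (x - y), sq_nonneg (x + y), sq_nonneg (x ^ 2 - y ^ 2),
    sq_nonneg (x * y), mul_nonneg (sq_nonneg (x - y)) (sq_nonneg (x - y)),
    mul_nonneg (sq_nonneg (x - y)) (sq_nonneg (x + y)), mul_nonneg (sq_nonneg (x - y)) (sq_nonneg x),
    mul_nonneg (sq_nonneg (x - y)) (sq_nonneg y)]

/-- Centred average of the first `n` terms of a sequence of random variables. -/
def fluct (P : Measure Ω) (Y : ℕ → Ω → ℝ) (n : ℕ) (ω : Ω) : ℝ :=
  (n : ℝ)⁻¹ * ∑ i ∈ Finset.range n, (Y i ω - ∫ ω', Y i ω' ∂P)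

theorem fluct_eq (P : Measure Ω) (Y : ℕ → Ω → ℝ) (n : ℕ) (ω : Ω) :
    fluct P Y n ω = (n : ℝ)⁻¹ * ∑ i ∈ Finset.range n, Y i ω
      - (n : ℝ)⁻¹ * ∑ i ∈ Finset.range n, ∫ ω', Y i ω' ∂P := by
  rw [fluct, Finset.sum_sub_distrib, mul_sub]

/-- Nonnegative random sequences whose fourth moments are `O(n⁻²)`. -/
structure FourthMomentSmall (P : Measure Ω) (Z : ℕ → Ω → ℝ) : Prop where
  nonneg : ∀ n ω, 0 ≤ Z n ω
  memLp : ∀ n, MemLp (Z n) 4 P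
  bound : ∃ K : ℝ, 0 ≤ K ∧ ∀ n : ℕ, 0 < n → ∫ ω, Z n ω ^ 4 ∂P ≤ K / (n : ℝ) ^ 2

section Moments

variable {P : Measure Ω} [IsProbabilityMeasure P]

theorem integral_pow_le_of_four {Y : Ω → ℝ} {C : ℝ} (hY : MemLp Y 4 P) (hC : ∫ ω, Y ω ^ 4 ∂P ≤ C)
    {k : ℕ} (hk : k ≤ 4) : ∫ ω, |Y ω| ^ k ∂P ≤ 1 + C := by
  have h4 := hY.integrable_pow_of_four le_rfl
  calc ∫ ω, |Y ω| ^ k ∂P ≤ ∫ ω, (1 + Y ω ^ 4) ∂P :=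
        integral_mono (hY.integrable_abs_pow_of_four hk) ((integrable_const _).add h4)
          fun ω => abs_pow_le_one_add_pow_four _ hk
    _ = 1 + ∫ ω, Y ω ^ 4 ∂P := by rw [integral_add (integrable_const _) h4]; simp
    _ ≤ 1 + C := by linarith

theorem integral_add_sq_of_indep {S W : Ω → ℝ} (hS : MemLp S 4 P) (hW : MemLp W 4 P)
    (hSW : IndepFun S W P) (hW0 : ∫ ω, W ω ∂P = 0) :
    ∫ ω, (S ω + W ω) ^ 2 ∂P = ∫ ω, S ω ^ 2 ∂P + ∫ ω, W ω ^ 2 ∂P := by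
  have i1 := hSW.integrable_mul hS.integrable_of_four hW.integrable_of_four
  have e1 := hSW.integral_fun_mul_eq_mul_integral hS.1 hW.1
  have s2 := hS.integrable_pow_of_four (k := 2) (by norm_num)
  have w2 := hW.integrable_pow_of_four (k := 2) (by norm_num)
  have : ∀ ω, (S ω + W ω) ^ 2 = (S ω ^ 2 + W ω ^ 2) + 2 * (S ω * W ω) := fun ω => by ring
  simp_rw [this]
  have i2 : Integrable (fun ω => 2 * (S ω * W ω)) P := i1.const_mul 2
  rw [integral_add (s2.fun_add w2) i2, integral_add s2 w2, integral_const_mul, e1, hW0]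
  ring

/-- The mixed terms of odd degree in one variable factor by independence and each contains a
vanishing mean. -/
theorem integral_add_pow_four_of_indep {S W : Ω → ℝ} (hS : MemLp S 4 P) (hW : MemLp W 4 P)
    (hSW : IndepFun S W P) (hS0 : ∫ ω, S ω ∂P = 0) (hW0 : ∫ ω, W ω ∂P = 0) :
    ∫ ω, (S ω + W ω) ^ 4 ∂P = ∫ ω, S ω ^ 4 ∂P + 6 * ((∫ ω, S ω ^ 2 ∂P) * ∫ ω, W ω ^ 2 ∂P)
      + ∫ ω, W ω ^ 4 ∂P := by
  have hpow : ∀ k l : ℕ, IndepFun (fun ω => S ω ^ k) (fun ω => W ω ^ l) P := fun k l =>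
    hSW.comp (measurable_id.pow_const k) (measurable_id.pow_const l)
  have is : ∀ k : ℕ, k ≤ 4 → Integrable (fun ω => S ω ^ k) P := fun k hk =>
    hS.integrable_pow_of_four hk
  have iw : ∀ k : ℕ, k ≤ 4 → Integrable (fun ω => W ω ^ k) P := fun k hk =>
    hW.integrable_pow_of_four hk
  have i : ∀ k l : ℕ, k ≤ 4 → l ≤ 4 → Integrable (fun ω => S ω ^ k * W ω ^ l) P :=
    fun k l hk hl => (hpow k l).integrable_mul (is k hk) (iw l hl)
  have e : ∀ k l : ℕ, ∫ ω, S ω ^ k * W ω ^ l ∂P = (∫ ω, S ω ^ k ∂P) * ∫ ω, W ω ^ l ∂P :=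
    fun k l => (hpow k l).integral_fun_mul_eq_mul_integral (hS.1.pow k) (hW.1.pow l)
  have : ∀ ω, (S ω + W ω) ^ 4 = S ω ^ 4 + 4 * (S ω ^ 3 * W ω ^ 1) + 6 * (S ω ^ 2 * W ω ^ 2)
      + 4 * (S ω ^ 1 * W ω ^ 3) + W ω ^ 4 := fun ω => by ring
  simp_rw [this]
  have j1 := (i 3 1 (by norm_num) (by norm_num)).const_mul 4
  have j2 := (i 2 2 (by norm_num) (by norm_num)).const_mul 6
  have j3 := (i 1 3 (by norm_num) (by norm_num)).const_mul 4
  have s4 := is 4 le_rfl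
  rw [integral_add (((s4.fun_add j1).fun_add j2).fun_add j3) (iw 4 le_rfl),
    integral_add ((s4.fun_add j1).fun_add j2) j3, integral_add (s4.fun_add j1) j2, integral_add s4 j1,
    integral_const_mul, integral_const_mul, integral_const_mul, e, e, e]
  simp only [pow_one, hS0, hW0]
  ring

/-- Fourth moments of sums of independent centred variables grow at most quadratically. -/
theorem integral_sum_pow_four_le {W : ℕ → Ω → ℝ} {D : ℝ} (hD : 1 ≤ D) (hW : ∀ i, MemLp (W i) 4 P)
    (hind : iIndepFun W P) (h0 : ∀ i, ∫ ω, W i ω ∂P = 0)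
    (h2 : ∀ i, ∫ ω, W i ω ^ 2 ∂P ≤ D) (h4 : ∀ i, ∫ ω, W i ω ^ 4 ∂P ≤ D) (n : ℕ) :
    ∫ ω, (∑ i ∈ Finset.range n, W i ω) ^ 2 ∂P ≤ D * n ∧
    ∫ ω, (∑ i ∈ Finset.range n, W i ω) ^ 4 ∂P ≤ 3 * D ^ 2 * n ^ 2 := by
  induction n with
  | zero => simp
  | succ n ih =>
    have hS : MemLp (fun ω => ∑ i ∈ Finset.range n, W i ω) 4 P :=
      memLp_finsetSum _ fun i _ => hW i
    have hS0 : ∫ ω, ∑ i ∈ Finset.range n, W i ω ∂P = 0 := by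
      rw [integral_finsetSum _ fun i _ => (hW i).integrable_of_four]
      simp [h0]
    have hSW : IndepFun (fun ω => ∑ i ∈ Finset.range n, W i ω) (W n) P := by
      have := hind.indepFun_finsetSum_of_notMem₀ (fun i => (hW i).1.aemeasurable)
        (s := Finset.range n) (i := n) (by simp)
      convert this using 1
      ext ω
      simp
    simp_rw [Finset.sum_range_succ]
    rw [integral_add_sq_of_indep hS (hW n) hSW (h0 n),
      integral_add_pow_four_of_indep hS (hW n) hSW hS0 (h0 n)]
    have hn : (0 : ℝ) ≤ n := Nat.cast_nonneg n
    have hs2 : 0 ≤ ∫ ω, (∑ i ∈ Finset.range n, W i ω) ^ 2 ∂P :=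
      integral_nonneg fun ω => sq_nonneg _
    have hw2 : 0 ≤ ∫ ω, W n ω ^ 2 ∂P := integral_nonneg fun ω => sq_nonneg _
    have hprod : (∫ ω, (∑ i ∈ Finset.range n, W i ω) ^ 2 ∂P) * ∫ ω, W n ω ^ 2 ∂P ≤ D * n * D :=
      mul_le_mul ih.1 (h2 n) hw2 (by positivity)
    push_cast
    constructor
    · nlinarith [ih.1, h2 n]
    -- The cross term `6 * (D * n) * D` is the middle term of `3 * D ^ 2 * (n + 1) ^ 2`, and `1 ≤ D`
    -- absorbs the last `D` into `3 * D ^ 2`.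
    · nlinarith [ih.2, h4 n, hprod]

theorem memLp_fluct {Y : ℕ → Ω → ℝ} (hY : ∀ i, MemLp (Y i) 4 P) (n : ℕ) :
    MemLp (fluct P Y n) 4 P :=
  (memLp_finsetSum _ fun i _ => (hY i).sub (memLp_const _)).const_mul _

theorem integral_fluct {Y : ℕ → Ω → ℝ} (hY : ∀ i, MemLp (Y i) 4 P) (n : ℕ) :
    ∫ ω, fluct P Y n ω ∂P = 0 := by
  unfold fluct
  have hi : ∀ i, Integrable (fun ω => Y i ω - ∫ ω', Y i ω' ∂P) P := fun i =>
    (hY i).integrable_of_four.sub (integrable_const _)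
  rw [integral_const_mul, integral_finsetSum _ fun i _ => hi i]
  rw [Finset.sum_eq_zero, mul_zero]
  intro i _
  rw [integral_sub (hY i).integrable_of_four (integrable_const _)]
  simp

/-- The fourth moment of a sum of `n` independent centred terms is `O(n²)`, and averaging divides it
by `n⁴`. -/
theorem fourthMomentSmall_abs_fluct {Y : ℕ → Ω → ℝ} {C : ℝ} (hY : ∀ i, MemLp (Y i) 4 P)
    (hind : iIndepFun Y P) (hC : ∀ i, ∫ ω, Y i ω ^ 4 ∂P ≤ C) :
    FourthMomentSmall P fun n ω => |fluct P Y n ω| := by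
  have hC0 : 0 ≤ C := (integral_nonneg fun ω => by positivity).trans (hC 0)
  set W : ℕ → Ω → ℝ := fun i ω => Y i ω - ∫ ω', Y i ω' ∂P with hWdef
  have hW : ∀ i, MemLp (W i) 4 P := fun i => (hY i).sub (memLp_const _)
  have hWind : iIndepFun W P :=
    hind.comp (fun i y => y - ∫ ω', Y i ω' ∂P) fun i => measurable_id.sub_const _
  have hW0 : ∀ i, ∫ ω, W i ω ∂P = 0 := fun i => by
    simp only [hWdef]
    rw [integral_sub (hY i).integrable_of_four (integrable_const _)]
    simp
  have hmean : ∀ i, |∫ ω, Y i ω ∂P| ≤ 1 + C := fun i =>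
    (abs_integral_le_integral_abs).trans
      (by simpa using integral_pow_le_of_four (hY i) (hC i) (k := 1) (by norm_num))
  -- The second summand bounds the centred fourth moments, since the means are at most `1 + C` in
  -- absolute value; the leading `1` gives `1 ≤ D` and also covers second moments through `y ^ 2 ≤ 1
  -- + y ^ 4`.
  set D : ℝ := 1 + 8 * (C + (1 + C) ^ 4) with hD
  have hD1 : 1 ≤ D := by rw [hD]; linarith [show 0 ≤ 8 * (C + (1 + C) ^ 4) by positivity]
  have hW4 : ∀ i, ∫ ω, W i ω ^ 4 ∂P ≤ 8 * (C + (1 + C) ^ 4) := fun i => by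
    have h4 := (hY i).integrable_pow_of_four le_rfl
    calc ∫ ω, W i ω ^ 4 ∂P ≤ ∫ ω, 8 * (Y i ω ^ 4 + (1 + C) ^ 4) ∂P := by
          refine integral_mono ((hW i).integrable_pow_of_four le_rfl)
            ((h4.add (integrable_const _)).const_mul 8) fun ω => ?_
          have h1 := add_pow_four_le (Y i ω) (-∫ ω', Y i ω' ∂P)
          have h2 : (-∫ ω', Y i ω' ∂P) ^ 4 ≤ (1 + C) ^ 4 := by
            rw [← Even.pow_abs (by decide : Even 4), abs_neg]
            exact pow_le_pow_left₀ (abs_nonneg _) (hmean i) 4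
          simp only [hWdef, sub_eq_add_neg]
          linarith
      _ = 8 * (∫ ω, Y i ω ^ 4 ∂P + (1 + C) ^ 4) := by
          rw [integral_const_mul, integral_add h4 (integrable_const _)]; simp
      _ ≤ 8 * (C + (1 + C) ^ 4) := by linarith [hC i]
  have hW2 : ∀ i, ∫ ω, W i ω ^ 2 ∂P ≤ D := fun i => by
    simpa using integral_pow_le_of_four (hW i) (hW4 i) (k := 2) (by norm_num)
  refine ⟨fun n ω => abs_nonneg _, fun n => (memLp_fluct hY n).abs, 3 * D ^ 2, by positivity, ?_⟩
  intro n hn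
  have hn' : (0 : ℝ) < n := Nat.cast_pos.2 hn
  have h := (integral_sum_pow_four_le hD1 hW hWind hW0 hW2
    (fun i => (hW4 i).trans (by linarith)) n).2
  have e : ∀ ω, |fluct P Y n ω| ^ 4 = ((n : ℝ)⁻¹) ^ 4 * (∑ i ∈ Finset.range n, W i ω) ^ 4 := by
    intro ω
    rw [Even.pow_abs (by decide), fluct, mul_pow]
  simp_rw [e]
  rw [integral_const_mul]
  calc ((n : ℝ)⁻¹) ^ 4 * ∫ ω, (∑ i ∈ Finset.range n, W i ω) ^ 4 ∂P
      ≤ ((n : ℝ)⁻¹) ^ 4 * (3 * D ^ 2 * n ^ 2) := by gcongr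
    _ = 3 * D ^ 2 / (n : ℝ) ^ 2 := by field_simp

/-! ### Closure under sums, and the lower moments. -/

namespace FourthMomentSmall

theorem add {Z Z' : ℕ → Ω → ℝ} (h : FourthMomentSmall P Z) (h' : FourthMomentSmall P Z') :
    FourthMomentSmall P fun n ω => Z n ω + Z' n ω := by
  obtain ⟨K, hK, hb⟩ := h.bound
  obtain ⟨K', hK', hb'⟩ := h'.bound
  refine ⟨fun n ω => add_nonneg (h.nonneg n ω) (h'.nonneg n ω), fun n => (h.memLp n).add (h'.memLp n),
    8 * (K + K'), by positivity, fun n hn => ?_⟩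
  have i1 := (h.memLp n).integrable_pow_of_four le_rfl
  have i2 := (h'.memLp n).integrable_pow_of_four le_rfl
  calc ∫ ω, (Z n ω + Z' n ω) ^ 4 ∂P ≤ ∫ ω, 8 * (Z n ω ^ 4 + Z' n ω ^ 4) ∂P :=
        integral_mono (((h.memLp n).add (h'.memLp n)).integrable_pow_of_four le_rfl)
          ((i1.add i2).const_mul 8) fun ω => add_pow_four_le _ _
    _ = 8 * (∫ ω, Z n ω ^ 4 ∂P + ∫ ω, Z' n ω ^ 4 ∂P) := by
        rw [integral_const_mul, integral_add i1 i2]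
    _ ≤ 8 * (K / (n : ℝ) ^ 2 + K' / (n : ℝ) ^ 2) := by linarith [hb n hn, hb' n hn]
    _ = 8 * (K + K') / (n : ℝ) ^ 2 := by ring

theorem sum {ι : Type*} (s : Finset ι) {Z : ι → ℕ → Ω → ℝ}
    (h : ∀ k ∈ s, FourthMomentSmall P (Z k)) :
    FourthMomentSmall P fun n ω => ∑ k ∈ s, Z k n ω := by
  classical
  induction s using Finset.induction_on with
  | empty =>
    exact ⟨by simp, fun n => by simp, 0, le_rfl, by simp⟩
  | insert a s ha ih =>
    simp_rw [Finset.sum_insert ha]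
    exact (h a (Finset.mem_insert_self a s)).add
      (ih fun k hk => h k (Finset.mem_insert_of_mem hk))

/-- Adding this deterministic term to `Z` lets errors of order `n^(-1/2)`, such as the offset
between the normalized variance and the inverse information, be absorbed into multiples of `Z`. -/
theorem inv_sqrt : FourthMomentSmall P fun n _ => (Real.sqrt n)⁻¹ := by
  refine ⟨fun n _ => by positivity, fun n => memLp_const _, 1, zero_le_one, fun n hn => ?_⟩
  have e : (Real.sqrt n)⁻¹ ^ 4 = 1 / (n : ℝ) ^ 2 := by
    rw [inv_pow, show (4 : ℕ) = 2 * 2 by norm_num, pow_mul, Real.sq_sqrt (Nat.cast_nonneg n),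
      one_div]
  simp [e]

/-- Bounds on the second, third and fourth moments. -/
theorem exists_moment_bounds {Z : ℕ → Ω → ℝ} (h : FourthMomentSmall P Z) :
    ∃ K : ℝ, 0 ≤ K ∧ ∀ n : ℕ, 0 < n →
      ∫ ω, Z n ω ^ 2 ∂P ≤ K / n ∧ ∫ ω, Z n ω ^ 3 ∂P ≤ K / n * (Real.sqrt n)⁻¹ ∧
      ∫ ω, Z n ω ^ 4 ∂P ≤ K / (n : ℝ) ^ 2 := by
  obtain ⟨K, hK, hb⟩ := h.bound
  refine ⟨1 + K, by positivity, fun n hn => ?_⟩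
  have hn' : (0 : ℝ) < n := Nat.cast_pos.2 hn
  have i2 := (h.memLp n).integrable_pow_of_four (k := 2) (by norm_num)
  have i3 := (h.memLp n).integrable_pow_of_four (k := 3) (by norm_num)
  have i4 := (h.memLp n).integrable_pow_of_four (k := 4) (by norm_num)
  have h4 := hb n hn
  -- The inequality of arithmetic and geometric means with weight `n` balances both terms at order
  -- `1 / n`; below, weight `√n` interpolates the third moment between the second and the fourth.
  have h2 : ∫ ω, Z n ω ^ 2 ∂P ≤ (1 / 2) * ((n : ℝ) * (K / (n : ℝ) ^ 2) + 1 / n) := by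
    calc ∫ ω, Z n ω ^ 2 ∂P ≤ ∫ ω, (1 / 2) * ((n : ℝ) * Z n ω ^ 4 + 1 / n) ∂P := by
          refine integral_mono i2 (((i4.const_mul _).add (integrable_const _)).const_mul _)
            fun ω => ?_
          have h1 : 0 ≤ (n * Z n ω ^ 2 - 1) ^ 2 / n := by positivity
          have h2 : (n * Z n ω ^ 2 - 1) ^ 2 / n = n * Z n ω ^ 4 + 1 / n - 2 * Z n ω ^ 2 := by
            field_simp; ring
          simp only
          linarith
      _ = (1 / 2) * ((n : ℝ) * ∫ ω, Z n ω ^ 4 ∂P + 1 / n) := by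
          rw [integral_const_mul, integral_add (i4.const_mul _) (integrable_const _),
            integral_const_mul]
          simp
      _ ≤ _ := by gcongr
  have h2' : ∫ ω, Z n ω ^ 2 ∂P ≤ (1 + K) / n := by
    refine h2.trans ?_
    have : (1 / 2 : ℝ) * ((n : ℝ) * (K / (n : ℝ) ^ 2) + 1 / n) = (1 + K) / n / 2 := by
      field_simp; ring
    rw [this]
    have : 0 ≤ (1 + K) / n := by positivity
    linarith
  refine ⟨h2', ?_, h4.trans (by gcongr; linarith)⟩
  have hs : (0 : ℝ) < Real.sqrt n := Real.sqrt_pos.2 hn'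
  have hss : Real.sqrt n * Real.sqrt n = n := Real.mul_self_sqrt hn'.le
  calc ∫ ω, Z n ω ^ 3 ∂P
      ≤ ∫ ω, (1 / 2) * (Real.sqrt n * Z n ω ^ 4 + (Real.sqrt n)⁻¹ * Z n ω ^ 2) ∂P := by
        refine integral_mono i3 (((i4.const_mul _).add (i2.const_mul _)).const_mul _) fun ω => ?_
        have h1 : 0 ≤ (Real.sqrt n * Z n ω - 1) ^ 2 * Z n ω ^ 2 / Real.sqrt n := by positivity
        have h2 : (Real.sqrt n * Z n ω - 1) ^ 2 * Z n ω ^ 2 / Real.sqrt n =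
            Real.sqrt n * Z n ω ^ 4 + (Real.sqrt n)⁻¹ * Z n ω ^ 2 - 2 * Z n ω ^ 3 := by
          field_simp; ring
        simp only
        linarith
    _ = (1 / 2) * (Real.sqrt n * ∫ ω, Z n ω ^ 4 ∂P + (Real.sqrt n)⁻¹ * ∫ ω, Z n ω ^ 2 ∂P) := by
        rw [integral_const_mul, integral_add (i4.const_mul _) (i2.const_mul _),
          integral_const_mul, integral_const_mul]
    _ ≤ (1 / 2) * (Real.sqrt n * ((1 + K) / (n : ℝ) ^ 2) + (Real.sqrt n)⁻¹ * ((1 + K) / n)) := by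
        have : K / (n : ℝ) ^ 2 ≤ (1 + K) / (n : ℝ) ^ 2 := by gcongr; linarith
        gcongr
        exact h4.trans this
    _ = (1 + K) / n * (Real.sqrt n)⁻¹ := by
        have : Real.sqrt n * ((1 + K) / (n : ℝ) ^ 2) = (Real.sqrt n)⁻¹ * ((1 + K) / n) := by
          rw [eq_inv_mul_iff_mul_eq₀ hs.ne', ← mul_assoc, hss]
          field_simp
        rw [this]; ring

end FourthMomentSmall

/-- Covariance of sums when only terms with equal indices are dependent. -/
theorem covariance_sum_of_indep {Y Y' : ℕ → Ω → ℝ} (hY : ∀ i, MemLp (Y i) 2 P)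
    (hY' : ∀ i, MemLp (Y' i) 2 P) (hind : ∀ i k, i ≠ k → IndepFun (Y i) (Y' k) P) (n : ℕ) :
    cov[fun ω => ∑ i ∈ Finset.range n, Y i ω, fun ω => ∑ i ∈ Finset.range n, Y' i ω; P] =
      ∑ i ∈ Finset.range n, cov[Y i, Y' i; P] := by
  rw [covariance_fun_sum_fun_sum' (fun i _ => hY i) fun i _ => hY' i]
  refine Finset.sum_congr rfl fun i hi => ?_
  rw [Finset.sum_eq_single_of_mem i hi]
  intro k _ hk
  exact (hind i k hk.symm).covariance_eq_zero (hY i) (hY' k)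

/-- Only the diagonal survives. Independence is required at distinct indices alone, because both
families will be functions of the same observations. -/
theorem integral_fluct_mul_fluct {Y Y' : ℕ → Ω → ℝ} (hY : ∀ i, MemLp (Y i) 4 P)
    (hY' : ∀ i, MemLp (Y' i) 4 P) (hind : ∀ i k, i ≠ k → IndepFun (Y i) (Y' k) P) (n : ℕ) :
    ∫ ω, fluct P Y n ω * fluct P Y' n ω ∂P =
      (n : ℝ)⁻¹ * ((n : ℝ)⁻¹ * ∑ i ∈ Finset.range n, cov[Y i, Y' i; P]) := by
  have h2 := fun i => (hY i).two_of_four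
  have h2' := fun i => (hY' i).two_of_four
  have hsum : MemLp (fun ω => (n : ℝ)⁻¹ * ∑ i ∈ Finset.range n, Y i ω) 2 P :=
    (memLp_finsetSum _ fun i _ => h2 i).const_mul _
  have hsum' : MemLp (fun ω => (n : ℝ)⁻¹ * ∑ i ∈ Finset.range n, Y' i ω) 2 P :=
    (memLp_finsetSum _ fun i _ => h2' i).const_mul _
  have hcov : cov[fluct P Y n, fluct P Y' n; P] = ∫ ω, fluct P Y n ω * fluct P Y' n ω ∂P := by
    rw [covariance_eq_sub (memLp_fluct hY n).two_of_four (memLp_fluct hY' n).two_of_four,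
      integral_fluct hY n]
    simp
  rw [← hcov, funext (fluct_eq P Y n), funext (fluct_eq P Y' n),
    covariance_sub_const_left (hsum.integrable (by norm_num)),
    covariance_sub_const_right (hsum'.integrable (by norm_num)),
    covariance_const_mul_left, covariance_const_mul_right,
    covariance_sum_of_indep h2 h2' hind n]

end Moments

/-! ### Partial derivatives and Taylor expansions -/

theorem ContDiffOn.partialD {g : Param p → ℝ} {U : Set (Param p)} {m n : WithTop ℕ∞}
    (h : ContDiffOn ℝ n g U) (hU : IsOpen U) (hmn : m + 1 ≤ n) (r : Fin p) :
    ContDiffOn ℝ m (partialD r g) U :=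
  (h.fderiv_of_isOpen hU hmn).clm_apply contDiffOn_const

theorem ContDiffOn.differentiableAt_of_isOpen {g : Param p → ℝ} {U : Set (Param p)}
    {n : WithTop ℕ∞} (h : ContDiffOn ℝ n g U) (hU : IsOpen U) (hn : n ≠ 0) {θ : Param p}
    (hθ : θ ∈ U) : DifferentiableAt ℝ g θ :=
  (h.contDiffAt (hU.mem_nhds hθ)).differentiableAt hn

theorem fderiv_apply_eq_sum_partialD (g : Param p → ℝ) (θ v : Param p) :
    fderiv ℝ g θ v = ∑ r, v r * partialD r g θ := by
  have hv : v = ∑ r, v r • EuclideanSpace.single r (1 : ℝ) := by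
    have := (EuclideanSpace.basisFun (Fin p) ℝ).sum_repr v
    simpa using this.symm
  conv_lhs => rw [hv]
  simp [map_sum, partialD]

theorem partialD_congr {g g' : Param p → ℝ} {θ : Param p} (h : g =ᶠ[𝓝 θ] g') (r : Fin p) :
    partialD r g θ = partialD r g' θ := by
  rw [partialD, partialD, h.fderiv_eq]

theorem partialD_congr_of_eqOn {g g' : Param p → ℝ} {U : Set (Param p)} (hU : IsOpen U)
    (h : Set.EqOn g g' U) (r : Fin p) : Set.EqOn (partialD r g) (partialD r g') U := fun _ hθ =>
  partialD_congr (h.eventuallyEq_of_mem (hU.mem_nhds hθ)) r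

theorem partialD_finsetSum {ι : Type*} {s : Finset ι} {g : ι → Param p → ℝ} {θ : Param p}
    (h : ∀ i ∈ s, DifferentiableAt ℝ (g i) θ) (r : Fin p) :
    partialD r (fun θ => ∑ i ∈ s, g i θ) θ = ∑ i ∈ s, partialD r (g i) θ := by
  simp only [partialD]
  rw [fderiv_fun_sum h]
  simp

/-- Partial derivatives are values of the iterated Fréchet derivative on unit vectors. -/
theorem exists_foldr_partialD_eq_iteratedFDeriv {g : Param p → ℝ} {U : Set (Param p)}
    (hU : IsOpen U) {n : ℕ} (h : ContDiffOn ℝ n g U) (l : List (Fin p)) (hl : l.length ≤ n) :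
    ∃ v : Fin l.length → Param p, (∀ i, ‖v i‖ ≤ 1) ∧ ∀ θ ∈ U,
      l.foldr partialD g θ = iteratedFDeriv ℝ l.length g θ v := by
  induction l with
  | nil => exact ⟨fun i => 0, by simp, fun θ _ => by simp⟩
  | cons r l ih =>
    obtain ⟨v, hv, hvl⟩ := ih ((Nat.le_succ _).trans hl)
    refine ⟨Fin.cons (EuclideanSpace.single r 1) v, ?_, fun θ hθ => ?_⟩
    · intro i
      refine Fin.cases ?_ (fun i => ?_) i
      · simp
      · simpa using hv i
    · have hd : DifferentiableAt ℝ (iteratedFDeriv ℝ l.length g) θ :=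
        (h.contDiffAt (hU.mem_nhds hθ)).differentiableAt_iteratedFDeriv
          (by exact_mod_cast (Nat.lt_of_succ_le hl))
      have he : l.foldr partialD g =ᶠ[𝓝 θ] fun y => iteratedFDeriv ℝ l.length g y v := by
        filter_upwards [hU.mem_nhds hθ] with y hy using hvl y hy
      rw [List.foldr_cons, partialD_congr he]
      change _ = iteratedFDeriv ℝ (l.length + 1) g θ _
      rw [iteratedFDeriv_succ_apply_left]
      simp only [Fin.cons_zero, Fin.tail_cons]
      rw [partialD, fderiv_continuousMultilinear_apply_const_apply hd]

/-- It passes from the norm bounds of the regularity conditions to bounds on iterated partial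
derivatives, the form used from here on. -/
theorem abs_foldr_partialD_le {g : Param p → ℝ} {U : Set (Param p)}
    (hU : IsOpen U) {n : ℕ} (h : ContDiffOn ℝ n g U) (l : List (Fin p)) (hl : l.length ≤ n)
    {θ : Param p} (hθ : θ ∈ U) : |l.foldr partialD g θ| ≤ ‖iteratedFDeriv ℝ l.length g θ‖ := by
  obtain ⟨v, hv, hvl⟩ := exists_foldr_partialD_eq_iteratedFDeriv hU h l hl
  rw [hvl θ hθ, ← Real.norm_eq_abs]
  refine (ContinuousMultilinearMap.le_opNorm _ _).trans ?_
  have : ∏ i, ‖v i‖ ≤ 1 := Finset.prod_le_one (fun i _ => norm_nonneg _) fun i _ => hv i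
  exact mul_le_of_le_one_right (norm_nonneg _) this

theorem abs_apply_le_norm (v : Param p) (r : Fin p) : |v r| ≤ ‖v‖ := by
  simpa using PiLp.norm_apply_le v r

theorem norm_clm_le_of_partialD {L : Param p →L[ℝ] ℝ} {B : ℝ} (hB : 0 ≤ B)
    (h : ∀ r, |L (EuclideanSpace.single r 1)| ≤ B) : ‖L‖ ≤ p * B := by
  refine ContinuousLinearMap.opNorm_le_bound _ (by positivity) fun v => ?_
  have hv : v = ∑ r, v r • EuclideanSpace.single r (1 : ℝ) := by
    have := (EuclideanSpace.basisFun (Fin p) ℝ).sum_repr v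
    simpa using this.symm
  conv_lhs => rw [hv]
  rw [map_sum]
  calc ‖∑ r, L (v r • EuclideanSpace.single r (1 : ℝ))‖
      ≤ ∑ r : Fin p, B * ‖v‖ := by
        refine norm_sum_le_of_le _ fun r _ => ?_
        rw [map_smul, norm_smul, mul_comm]
        exact mul_le_mul (h r) (abs_apply_le_norm v r) (norm_nonneg _) hB
    _ = p * B * ‖v‖ := by simp; ring

/-- First order Taylor bound in terms of partial derivatives. -/
theorem abs_sub_le_of_partialD_le {g : Param p → ℝ} {U : Set (Param p)} (hU : IsOpen U)
    (hUc : Convex ℝ U) (hg : ContDiffOn ℝ 1 g U) {B : ℝ} (hB : 0 ≤ B)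
    (h : ∀ θ ∈ U, ∀ r, |partialD r g θ| ≤ B) {θ θ₁ : Param p} (hθ : θ ∈ U) (hθ₁ : θ₁ ∈ U) :
    |g θ - g θ₁| ≤ p * B * ‖θ - θ₁‖ :=
  hUc.norm_image_sub_le_of_norm_hasFDerivWithin_le (𝕜 := ℝ)
    (fun _ hy => ((hg.differentiableAt_of_isOpen hU one_ne_zero hy).hasFDerivAt).hasFDerivWithinAt)
    (fun y hy => norm_clm_le_of_partialD hB (h y hy)) hθ₁ hθ

/-- Second order Taylor bound in terms of partial derivatives. -/
theorem abs_sub_sub_sum_partialD_le {g : Param p → ℝ} {U : Set (Param p)} (hU : IsOpen U)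
    (hUc : Convex ℝ U) (hg : ContDiffOn ℝ 2 g U) {B : ℝ} (hB : 0 ≤ B)
    (h : ∀ θ ∈ U, ∀ r s, |partialD r (partialD s g) θ| ≤ B) {θ θ₁ : Param p}
    (hθ : θ ∈ U) (hθ₁ : θ₁ ∈ U) :
    |g θ - g θ₁ - ∑ r, (θ r - θ₁ r) * partialD r g θ₁| ≤ p ^ 2 * B * ‖θ - θ₁‖ ^ 2 := by
  -- On the part of `U` within distance `‖θ - θ₁‖` of `θ₁`, the derivative differs from its value at
  -- `θ₁` by a multiple of that distance, so the mean value inequality yields a quadratic bound.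
  set V := U ∩ Metric.closedBall θ₁ ‖θ - θ₁‖ with hV
  have hVc : Convex ℝ V := hUc.inter (convex_closedBall _ _)
  have h1 : θ₁ ∈ V := ⟨hθ₁, Metric.mem_closedBall_self (norm_nonneg _)⟩
  have h2 : θ ∈ V := ⟨hθ, by rw [Metric.mem_closedBall, dist_eq_norm]⟩
  have hmain := hVc.norm_image_sub_le_of_norm_hasFDerivWithin_le' (𝕜 := ℝ) (f := g)
    (f' := fderiv ℝ g) (φ := fderiv ℝ g θ₁) (C := p * (p * B * ‖θ - θ₁‖))
    (fun y hy =>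
      ((hg.differentiableAt_of_isOpen hU two_ne_zero hy.1).hasFDerivAt).hasFDerivWithinAt)
    (fun y hy => ?_) h1 h2
  · rw [fderiv_apply_eq_sum_partialD, Real.norm_eq_abs] at hmain
    refine hmain.trans (le_of_eq ?_)
    ring
  · refine norm_clm_le_of_partialD (by positivity) fun s => ?_
    have hy2 : ‖y - θ₁‖ ≤ ‖θ - θ₁‖ := by
      have := hy.2
      rwa [Metric.mem_closedBall, dist_eq_norm] at this
    have := abs_sub_le_of_partialD_le hU hUc (hg.partialD hU (m := 1) (by norm_num) s) hB
      (fun y hy r => h y hy r s) hy.1 hθ₁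
    refine this.trans ?_
    gcongr

/-- Partial derivative of a product with `exp (-ℓ)`. -/
theorem partialD_mul_exp_neg {g ℓ f : Param p → ℝ} {U : Set (Param p)} (hU : IsOpen U)
    (hf : ∀ θ ∈ U, f θ = Real.exp (-ℓ θ)) {θ : Param p} (hθ : θ ∈ U)
    (hg : DifferentiableAt ℝ g θ) (hℓ : DifferentiableAt ℝ ℓ θ) (r : Fin p) :
    partialD r (fun y => g y * f y) θ = (partialD r g θ - g θ * partialD r ℓ θ) * f θ := by
  have he : (fun y => g y * f y) =ᶠ[𝓝 θ] fun y => g y * Real.exp (-ℓ y) := by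
    filter_upwards [hU.mem_nhds hθ] with y hy
    rw [hf y hy]
  rw [partialD_congr he, hf θ hθ]
  have h := hg.hasFDerivAt.mul (hℓ.hasFDerivAt.neg.exp)
  rw [partialD, show (fun y => g y * Real.exp (-ℓ y)) = g * fun y => Real.exp ((-ℓ) y) from rfl,
    h.fderiv]
  simp [partialD]
  ring

theorem partialD_mul {g g' : Param p → ℝ} {θ : Param p} (hg : DifferentiableAt ℝ g θ)
    (hg' : DifferentiableAt ℝ g' θ) (r : Fin p) :
    partialD r (fun y => g y * g' y) θ = partialD r g θ * g' θ + g θ * partialD r g' θ := by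
  simp only [partialD]
  rw [fderiv_fun_mul hg hg']
  simp
  ring

theorem partialD_sub {g g' : Param p → ℝ} {θ : Param p} (hg : DifferentiableAt ℝ g θ)
    (hg' : DifferentiableAt ℝ g' θ) (r : Fin p) :
    partialD r (fun y => g y - g' y) θ = partialD r g θ - partialD r g' θ := by
  simp only [partialD]
  rw [fderiv_fun_sub hg hg']
  simp

/-- A positive four times continuously differentiable function `f` on `U`, bounded by `b`, such that
the partial derivatives of `-log f` of orders one to four are bounded by `m`. -/
structure SmoothDensity (U : Set (Param p)) (f : Param p → ℝ) (m b : ℝ) : Prop where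
  pos : ∀ θ ∈ U, 0 < f θ
  smooth : ContDiffOn ℝ 4 f U
  le : ∀ θ ∈ U, f θ ≤ b
  bound : ∀ l : List (Fin p), 1 ≤ l.length → l.length ≤ 4 → ∀ θ ∈ U,
    |l.foldr partialD (fun θ => -Real.log (f θ)) θ| ≤ m

namespace SmoothDensity

variable {U : Set (Param p)} {f : Param p → ℝ} {m b : ℝ}

theorem contDiffOn_neg_log (h : SmoothDensity U f m b) :
    ContDiffOn ℝ 4 (fun θ => -Real.log (f θ)) U :=
  (h.smooth.log fun θ hθ => (h.pos θ hθ).ne').neg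

theorem eq_exp (h : SmoothDensity U f m b) {θ : Param p} (hθ : θ ∈ U) :
    f θ = Real.exp (-(-Real.log (f θ))) := by
  rw [neg_neg, Real.exp_log (h.pos θ hθ)]

/-- Taylor expansion of `g * f` for a function `g` with bounded derivatives. -/
theorem abs_mul_sub_le (h : SmoothDensity U f m b) (hU : IsOpen U) (hUc : Convex ℝ U)
    {g : Param p → ℝ} (hg : ContDiffOn ℝ 2 g U) (hm : 0 ≤ m) (h0 : ∀ θ ∈ U, |g θ| ≤ 1 + m)
    (h1 : ∀ θ ∈ U, ∀ r, |partialD r g θ| ≤ 1 + m)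
    (h2 : ∀ θ ∈ U, ∀ r s, |partialD r (partialD s g) θ| ≤ 1 + m) {θ θ₁ : Param p}
    (hθ : θ ∈ U) (hθ₁ : θ₁ ∈ U) :
    |g θ * f θ - g θ₁ * f θ₁ - ∑ r, (θ r - θ₁ r) *
      ((partialD r g θ₁ - g θ₁ * partialD r (fun θ => -Real.log (f θ)) θ₁) * f θ₁)| ≤
      p ^ 2 * (10 * ((1 + m ^ 4) * b)) * ‖θ - θ₁‖ ^ 2 := by
  set ℓ : Param p → ℝ := fun θ => -Real.log (f θ) with hℓ
  have hℓs : ContDiffOn ℝ 4 ℓ U := h.contDiffOn_neg_log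
  have hℓd : ∀ y ∈ U, DifferentiableAt ℝ ℓ y := fun y hy =>
    hℓs.differentiableAt_of_isOpen hU (by norm_num) hy
  have hgd : ∀ y ∈ U, DifferentiableAt ℝ g y := fun y hy =>
    hg.differentiableAt_of_isOpen hU (by norm_num) hy
  have hℓd1 : ∀ s, ∀ y ∈ U, DifferentiableAt ℝ (partialD s ℓ) y := fun s y hy =>
    (hℓs.partialD hU (m := 3) (by norm_num) s).differentiableAt_of_isOpen hU (by norm_num) hy
  have hgd1 : ∀ s, ∀ y ∈ U, DifferentiableAt ℝ (partialD s g) y := fun s y hy =>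
    (hg.partialD hU (m := 1) (by norm_num) s).differentiableAt_of_isOpen hU (by norm_num) hy
  have hexp : ∀ y ∈ U, f y = Real.exp (-ℓ y) := fun y hy => h.eq_exp hy
  have hfirst : ∀ y ∈ U, ∀ s, partialD s (fun y => g y * f y) y =
      (partialD s g y - g y * partialD s ℓ y) * f y := fun y hy s =>
    partialD_mul_exp_neg hU hexp hy (hgd y hy) (hℓd y hy) s
  have hb : 0 ≤ b := (h.pos θ hθ).le.trans (h.le θ hθ)
  have hprod : ContDiffOn ℝ 2 (fun y => g y * f y) U :=
    hg.mul (h.smooth.of_le (by norm_num))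
  -- Since `f = exp (-ℓ)`, differentiating `g * f` only produces polynomials in derivatives of `g`
  -- and `ℓ`, times `f`. Thus `b`, which bounds `f` itself, suffices for domination.
  have hsecond : ∀ y ∈ U, ∀ r s, |partialD r (partialD s (fun y => g y * f y)) y| ≤
      10 * ((1 + m ^ 4) * b) := by
    intro y hy r s
    rw [partialD_congr_of_eqOn hU (fun y hy => hfirst y hy s) r hy,
      partialD_mul_exp_neg (g := fun y => partialD s g y - g y * partialD s ℓ y) hU hexp hy
        ((hgd1 s y hy).fun_sub ((hgd y hy).fun_mul (hℓd1 s y hy))) (hℓd y hy) r, partialD_sub (hgd1 s y hy) ((hgd y hy).fun_mul (hℓd1 s y hy)),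
      partialD_mul (hgd y hy) (hℓd1 s y hy)]
    have a0 := h0 y hy
    have a1 := h1 y hy r
    have a1' := h1 y hy s
    have a2 := h2 y hy r s
    have b1 : |partialD r ℓ y| ≤ m := h.bound [r] (by simp) (by simp) y hy
    have b1' : |partialD s ℓ y| ≤ m := h.bound [s] (by simp) (by simp) y hy
    have b2 : |partialD r (partialD s ℓ) y| ≤ m := h.bound [r, s] (by simp) (by simp) y hy
    have hm1 : 0 ≤ 1 + m := by linarith
    rw [abs_mul, abs_of_pos (h.pos y hy), ← mul_assoc]
    refine mul_le_mul ?_ (h.le y hy) (h.pos y hy).le (by positivity)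
    have c1 : |partialD r g y * partialD s ℓ y| ≤ (1 + m) * m := by
      rw [abs_mul]; exact mul_le_mul a1 b1' (abs_nonneg _) hm1
    have c2 : |g y * partialD r (partialD s ℓ) y| ≤ (1 + m) * m := by
      rw [abs_mul]; exact mul_le_mul a0 b2 (abs_nonneg _) hm1
    have c3 : |partialD s g y * partialD r ℓ y| ≤ (1 + m) * m := by
      rw [abs_mul]; exact mul_le_mul a1' b1 (abs_nonneg _) hm1
    have c4 : |g y * partialD s ℓ y * partialD r ℓ y| ≤ (1 + m) * m * m := by
      rw [abs_mul, abs_mul]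
      exact mul_le_mul (mul_le_mul a0 b1' (abs_nonneg _) hm1) b1 (abs_nonneg _) (by positivity)
    have habs : |partialD r (partialD s g) y - (partialD r g y * partialD s ℓ y +
        g y * partialD r (partialD s ℓ) y) -
        (partialD s g y - g y * partialD s ℓ y) * partialD r ℓ y| ≤
        (1 + m) + (1 + m) * m + (1 + m) * m + (1 + m) * m + (1 + m) * m * m := by
      rw [abs_le] at *
      constructor <;> nlinarith
    -- The bound is `1 + 4m + 4m² + m³`; each power of `m` is at most `1 + m⁴`, and the coefficients
    -- add up to `10`.
    refine habs.trans ?_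
    have q1 : m ≤ 1 + m ^ 4 := by
      have := abs_pow_le_one_add_pow_four m (k := 1) (by norm_num)
      rwa [abs_of_nonneg hm, pow_one] at this
    have q2 : m ^ 2 ≤ 1 + m ^ 4 := by
      have := abs_pow_le_one_add_pow_four m (k := 2) (by norm_num)
      rwa [abs_of_nonneg hm] at this
    have q3 : m ^ 3 ≤ 1 + m ^ 4 := by
      have := abs_pow_le_one_add_pow_four m (k := 3) (by norm_num)
      rwa [abs_of_nonneg hm] at this
    have q4 : 0 ≤ m ^ 4 := by positivity
    nlinarith
  have := abs_sub_sub_sum_partialD_le hU hUc hprod (by positivity) hsecond hθ hθ₁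
  simp_rw [hfirst θ₁ hθ₁] at this
  exact this

end SmoothDensity

/-! ### A single observation near the true parameter -/

theorem contDiffOn_foldr_partialD {g : Param p → ℝ} {U : Set (Param p)} (hU : IsOpen U)
    {n : ℕ} (h : ContDiffOn ℝ n g U) (l : List (Fin p)) {m : ℕ} (hm : l.length + m ≤ n) :
    ContDiffOn ℝ m (l.foldr partialD g) U := by
  induction l generalizing m with
  | nil =>
    refine h.of_le ?_
    have : m ≤ n := by simpa using hm
    exact_mod_cast this
  | cons r l ih =>
    have hm' : l.length + (m + 1) ≤ n := by
      rw [List.length_cons] at hm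
      omega
    exact (ih hm').partialD hU (by push_cast; exact le_rfl) r

/-- Measurability in the observation is available only at fixed parameters; the derivative inherits
it as an almost everywhere limit of difference quotients with steps `1 / n`. The shift by `N` keeps
the displaced points in `U`. -/
theorem aemeasurable_partialD {ν : Measure 𝒳} {g : 𝒳 → Param p → ℝ} {U : Set (Param p)}
    (hU : IsOpen U) (hm : ∀ θ ∈ U, AEMeasurable (fun x => g x θ) ν)
    (hd : ∀ᵐ x ∂ν, ∀ θ ∈ U, DifferentiableAt ℝ (g x) θ) (r : Fin p) {θ : Param p} (hθ : θ ∈ U) :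
    AEMeasurable (fun x => partialD r (g x) θ) ν := by
  set e : Param p := EuclideanSpace.single r 1 with he
  have htend : Tendsto (fun n : ℕ => θ + ((n : ℝ))⁻¹ • e) atTop (𝓝 θ) := by
    have h1 : Tendsto (fun n : ℕ => ((n : ℝ))⁻¹) atTop (𝓝 0) := tendsto_inv_atTop_nhds_zero_nat
    simpa using (h1.smul_const e).const_add θ
  obtain ⟨N, hN⟩ := eventually_atTop.1 (htend.eventually (hU.mem_nhds hθ))
  refine aemeasurable_of_tendsto_metrizable_ae atTop
    (f := fun n x => ((n + N : ℕ) : ℝ) * (g x (θ + (((n + N : ℕ) : ℝ))⁻¹ • e) - g x θ))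
    (fun n => ((hm _ (hN (n + N) (Nat.le_add_left _ _))).sub (hm θ hθ)).const_mul _) ?_
  filter_upwards [hd] with x hx
  have hc : Tendsto (fun n : ℕ => ‖((n + N : ℕ) : ℝ)‖) atTop atTop := by
    simp only [Real.norm_natCast]
    exact tendsto_natCast_atTop_atTop.comp (tendsto_add_atTop_nat N)
  exact (hx θ hθ).hasFDerivAt.lim e hc

/-- A family of densities on `U` with uniform derivative bounds `M`, dominated by `b`. -/
structure LocalModel (ν : Measure 𝒳) (q : 𝒳 → Param p → ℝ) (U : Set (Param p)) (M b : 𝒳 → ℝ)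
    (C : ℝ) : Prop where
  isOpen : IsOpen U
  convex : Convex ℝ U
  meas : ∀ θ ∈ U, Measurable fun x => q x θ
  integral_eq_one : ∀ θ ∈ U, ∫ x, q x θ ∂ν = 1
  measM : Measurable M
  nonneg : ∀ᵐ x ∂ν, 0 ≤ M x
  density : ∀ᵐ x ∂ν, SmoothDensity U (q x) (M x) (b x)
  integrable : Integrable (fun x => (1 + M x ^ 4) * b x) ν
  integral_le : ∫ x, (1 + M x ^ 4) * b x ∂ν ≤ C

/-- Families of functions whose derivatives up to order two on `U` are bounded by `1 + M`. -/
structure BoundedFamily (ν : Measure 𝒳) (U : Set (Param p)) (M : 𝒳 → ℝ) (g : 𝒳 → Param p → ℝ) :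
    Prop where
  meas : ∀ θ ∈ U, AEMeasurable (fun x => g x θ) ν
  smooth : ∀ᵐ x ∂ν, ContDiffOn ℝ 2 (g x) U
  bound : ∀ᵐ x ∂ν, ∀ l : List (Fin p), l.length ≤ 2 → ∀ θ ∈ U, |l.foldr partialD (g x) θ| ≤ 1 + M x

/-- Iterated partial derivatives of the negative log-density. -/
def nllDeriv (q : 𝒳 → Param p → ℝ) (l : List (Fin p)) (x : 𝒳) : Param p → ℝ :=
  l.foldr partialD fun θ => -Real.log (q x θ)

/-! ### Integrals against the density: expansion in the parameter, mean of the score, information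
identity. -/

namespace LocalModel

variable {ν : Measure 𝒳} {q : 𝒳 → Param p → ℝ} {U : Set (Param p)} {M b : 𝒳 → ℝ} {C : ℝ}

theorem aemeasurable_nllDeriv (h : LocalModel ν q U M b C) (l : List (Fin p)) (hl : l.length ≤ 4)
    {θ : Param p} (hθ : θ ∈ U) : AEMeasurable (fun x => nllDeriv q l x θ) ν := by
  induction l generalizing θ with
  | nil => exact ((Real.measurable_log.comp (h.meas θ hθ)).neg).aemeasurable
  | cons r l ih =>
    have hl' : l.length + 1 ≤ 4 := hl
    refine aemeasurable_partialD (g := nllDeriv q l) h.isOpen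
      (fun θ hθ => ih ((Nat.le_succ _).trans hl) hθ) ?_ r hθ
    filter_upwards [h.density] with x hx θ hθ
    have hc : ContDiffOn ℝ (1 : ℕ) (nllDeriv q l x) U :=
      contDiffOn_foldr_partialD h.isOpen (n := 4) hx.contDiffOn_neg_log l hl'
    exact hc.differentiableAt_of_isOpen h.isOpen (by norm_num) hθ

/-- The four derivatives are spent here: up to two in the family itself, two more in its second
order Taylor bound. -/
theorem boundedFamily_nllDeriv (h : LocalModel ν q U M b C) (l : List (Fin p)) (hl1 : 1 ≤ l.length)
    (hl : l.length ≤ 2) : BoundedFamily ν U M (nllDeriv q l) where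
  meas θ hθ := h.aemeasurable_nllDeriv l (by omega) hθ
  smooth := by
    filter_upwards [h.density] with x hx
    exact contDiffOn_foldr_partialD h.isOpen (n := 4) hx.contDiffOn_neg_log l (m := 2) (by omega)
  bound := by
    filter_upwards [h.density] with x hx l' hl' θ hθ
    rw [nllDeriv, ← List.foldr_append]
    have := hx.bound (l' ++ l) (by simp; omega) (by simp; omega) θ hθ
    linarith

/-- The constant family turns the normalization of the densities into the mean-zero property of the
score. -/
theorem boundedFamily_one (h : LocalModel ν q U M b C) :
    BoundedFamily ν U M (fun _ _ => (1 : ℝ)) where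
  meas θ hθ := aemeasurable_const
  smooth := Eventually.of_forall fun x => contDiffOn_const
  bound := by
    filter_upwards [h.nonneg] with x hx l hl θ hθ
    have : l.foldr partialD (fun _ : Param p => (1 : ℝ)) = fun _ =>
        if l = [] then 1 else 0 := by
      clear hl
      induction l with
      | nil => simp
      | cons r l ih =>
        funext y
        rw [List.foldr_cons, ih]
        simp [partialD]
    rw [this]
    split_ifs <;> simp <;> linarith

theorem integrable_mul (h : LocalModel ν q U M b C) {y : 𝒳 → ℝ} {K : ℝ} (hy : AEMeasurable y ν)
    (hK : ∀ᵐ x ∂ν, |y x| ≤ K * (1 + M x ^ 4)) {θ : Param p} (hθ : θ ∈ U) :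
    Integrable (fun x => y x * q x θ) ν := by
  refine (h.integrable.const_mul K).mono' (hy.mul (h.meas θ hθ).aemeasurable).aestronglyMeasurable ?_
  filter_upwards [hK, h.density] with x hx hd
  have hq := hd.pos θ hθ
  rw [Real.norm_eq_abs, abs_mul, abs_of_pos hq, ← mul_assoc]
  exact mul_le_mul hx (hd.le θ hθ) hq.le ((abs_nonneg _).trans hx)

theorem integrable_mul_of_le (h : LocalModel ν q U M b C) {y : 𝒳 → ℝ} (hy : AEMeasurable y ν)
    (hK : ∀ᵐ x ∂ν, |y x| ≤ (1 + M x) * (1 + M x)) {θ : Param p} (hθ : θ ∈ U) :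
    Integrable (fun x => y x * q x θ) ν := by
  refine h.integrable_mul (K := 4) hy ?_ hθ
  filter_upwards [hK] with x hx
  have h1 := abs_pow_le_one_add_pow_four (M x) (k := 1) (by norm_num)
  have h2 := abs_pow_le_one_add_pow_four (M x) (k := 2) (by norm_num)
  rw [pow_one] at h1
  rw [sq_abs] at h2
  have h3 : 0 ≤ M x ^ 4 := by positivity
  nlinarith [le_abs_self (M x)]

/-- The derivative of `g * q` in the `r`-th direction, divided by `q`. -/
theorem aemeasurable_twisted (h : LocalModel ν q U M b C) {g : 𝒳 → Param p → ℝ}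
    (hg : BoundedFamily ν U M g) (r : Fin p) {θ : Param p} (hθ : θ ∈ U) :
    AEMeasurable (fun x => partialD r (g x) θ - g x θ * nllDeriv q [r] x θ) ν := by
  have hd : ∀ᵐ x ∂ν, ∀ θ ∈ U, DifferentiableAt ℝ (g x) θ := by
    filter_upwards [hg.smooth] with x hx θ hθ
    exact hx.differentiableAt_of_isOpen h.isOpen (by norm_num) hθ
  exact (aemeasurable_partialD h.isOpen hg.meas hd r hθ).sub
    ((hg.meas θ hθ).mul (h.aemeasurable_nllDeriv [r] (by simp) hθ))

theorem integrable_family (h : LocalModel ν q U M b C) {g : 𝒳 → Param p → ℝ}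
    (hg : BoundedFamily ν U M g) {θ : Param p} (hθ : θ ∈ U) :
    Integrable (fun x => g x θ * q x θ) ν := by
  refine h.integrable_mul_of_le (hg.meas θ hθ) ?_ hθ
  filter_upwards [hg.bound, h.nonneg] with x hx hM
  have := hx [] (by simp) θ hθ
  refine le_trans this ?_
  nlinarith

theorem integrable_twisted (h : LocalModel ν q U M b C) {g : 𝒳 → Param p → ℝ}
    (hg : BoundedFamily ν U M g) (r : Fin p) {θ : Param p} (hθ : θ ∈ U) :
    Integrable (fun x => (partialD r (g x) θ - g x θ * nllDeriv q [r] x θ) * q x θ) ν := by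
  refine h.integrable_mul_of_le (h.aemeasurable_twisted hg r hθ) ?_ hθ
  filter_upwards [hg.bound, h.nonneg, h.density] with x hx hM hd
  have h0 : |g x θ| ≤ 1 + M x := hx [] (by simp) θ hθ
  have h1 : |partialD r (g x) θ| ≤ 1 + M x := hx [r] (by simp) θ hθ
  have h2 : |nllDeriv q [r] x θ| ≤ M x := hd.bound [r] (by simp) (by simp) θ hθ
  have h3 : |g x θ * nllDeriv q [r] x θ| ≤ (1 + M x) * M x := by
    rw [abs_mul]
    exact mul_le_mul h0 h2 (abs_nonneg _) (by linarith)
  refine (abs_sub _ _).trans ?_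
  linarith

/-- Taylor expansion of `θ ↦ ∫ g(x, θ) q(x, θ) dν`. -/
theorem abs_integral_sub_le (h : LocalModel ν q U M b C) {g : 𝒳 → Param p → ℝ}
    (hg : BoundedFamily ν U M g) {θ θ₁ : Param p} (hθ : θ ∈ U) (hθ₁ : θ₁ ∈ U) :
    |∫ x, g x θ * q x θ ∂ν - ∫ x, g x θ₁ * q x θ₁ ∂ν - ∑ r, (θ r - θ₁ r) *
      ∫ x, (partialD r (g x) θ₁ - g x θ₁ * nllDeriv q [r] x θ₁) * q x θ₁ ∂ν| ≤
      p ^ 2 * (10 * C) * ‖θ - θ₁‖ ^ 2 := by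
  have i0 := h.integrable_family hg hθ
  have i1 := h.integrable_family hg hθ₁
  have i2 : ∀ r, Integrable (fun x => (θ r - θ₁ r) *
      ((partialD r (g x) θ₁ - g x θ₁ * nllDeriv q [r] x θ₁) * q x θ₁)) ν := fun r =>
    (h.integrable_twisted hg r hθ₁).const_mul _
  have e : ∫ x, g x θ * q x θ ∂ν - ∫ x, g x θ₁ * q x θ₁ ∂ν - ∑ r, (θ r - θ₁ r) *
      ∫ x, (partialD r (g x) θ₁ - g x θ₁ * nllDeriv q [r] x θ₁) * q x θ₁ ∂ν =
      ∫ x, (g x θ * q x θ - g x θ₁ * q x θ₁ - ∑ r, (θ r - θ₁ r) *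
        ((partialD r (g x) θ₁ - g x θ₁ * nllDeriv q [r] x θ₁) * q x θ₁)) ∂ν := by
    have i3 : Integrable (fun x => g x θ * q x θ - g x θ₁ * q x θ₁) ν := i0.sub i1
    rw [integral_sub i3 (integrable_finsetSum _ fun r _ => i2 r), integral_sub i0 i1,
      integral_finsetSum _ fun r _ => i2 r]
    simp_rw [integral_const_mul]
  rw [e]
  refine abs_integral_le_integral_abs.trans ?_
  have hmono : ∫ x, |g x θ * q x θ - g x θ₁ * q x θ₁ - ∑ r, (θ r - θ₁ r) *
        ((partialD r (g x) θ₁ - g x θ₁ * nllDeriv q [r] x θ₁) * q x θ₁)| ∂ν ≤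
      ∫ x, (p ^ 2 * 10 * ‖θ - θ₁‖ ^ 2) * ((1 + M x ^ 4) * b x) ∂ν := by
    refine integral_mono_ae
      ((i0.sub i1).sub (integrable_finsetSum _ fun r _ => i2 r)).abs
      (h.integrable.const_mul _) ?_
    filter_upwards [hg.bound, hg.smooth, h.nonneg, h.density] with x hx hs hM hd
    have := hd.abs_mul_sub_le h.isOpen h.convex hs hM (fun θ hθ => hx [] (by simp) θ hθ)
      (fun θ hθ r => hx [r] (by simp) θ hθ) (fun θ hθ r s => hx [r, s] (by simp) θ hθ) hθ hθ₁
    refine this.trans (le_of_eq ?_)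
    ring
  refine hmono.trans ?_
  rw [integral_const_mul]
  have hp : (0 : ℝ) ≤ p ^ 2 * 10 * ‖θ - θ₁‖ ^ 2 := by positivity
  nlinarith [mul_le_mul_of_nonneg_left h.integral_le hp]

/-- When the integral does not depend on the parameter, its Taylor expansion in the direction `r`
with step `t` leaves `t * |I| ≤ K * t ^ 2`; divide by `t` and let `t` tend to `0`. This plays the
role of differentiation under the integral sign. -/
theorem integral_twisted_eq_zero (h : LocalModel ν q U M b C) {g : 𝒳 → Param p → ℝ}
    (hg : BoundedFamily ν U M g) {c : ℝ} (hc : ∀ θ ∈ U, ∫ x, g x θ * q x θ ∂ν = c) (r : Fin p)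
    {θ : Param p} (hθ : θ ∈ U) :
    ∫ x, (partialD r (g x) θ - g x θ * nllDeriv q [r] x θ) * q x θ ∂ν = 0 := by
  set I := ∫ x, (partialD r (g x) θ - g x θ * nllDeriv q [r] x θ) * q x θ ∂ν with hI
  set e : Param p := EuclideanSpace.single r 1 with he
  set K : ℝ := p ^ 2 * (10 * C) with hK
  have hle : ∀ᶠ t : ℝ in 𝓝[>] 0, |I| ≤ K * t := by
    have hcont : Tendsto (fun t : ℝ => θ + t • e) (𝓝[>] 0) (𝓝 θ) := by
      have : Continuous fun t : ℝ => θ + t • e := by fun_prop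
      have h0 := this.tendsto 0
      rw [zero_smul, add_zero] at h0
      exact h0.mono_left nhdsWithin_le_nhds
    filter_upwards [hcont.eventually (h.isOpen.mem_nhds hθ), self_mem_nhdsWithin] with t ht ht0
    have ht0' : 0 < t := ht0
    have := h.abs_integral_sub_le hg ht hθ
    rw [hc _ ht, hc _ hθ, Finset.sum_eq_single r] at this
    · have hn : ‖θ + t • e - θ‖ = t := by
        rw [add_sub_cancel_left, norm_smul, he]
        simp [abs_of_pos ht0']
      rw [hn] at this
      have hr : (θ + t • e) r - θ r = t := by simp [he]
      rw [hr, sub_self, zero_sub, abs_neg, abs_mul, abs_of_pos ht0'] at this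
      have h2 : t * |I| ≤ t * (K * t) := by nlinarith
      exact le_of_mul_le_mul_left h2 ht0'
    · intro s _ hs
      simp [he, hs]
    · simp
  have hlim : Tendsto (fun t : ℝ => K * t) (𝓝[>] 0) (𝓝 0) := by
    have : Continuous fun t : ℝ => K * t := by fun_prop
    have h0 := this.tendsto 0
    rw [mul_zero] at h0
    exact h0.mono_left nhdsWithin_le_nhds
  have := ge_of_tendsto hlim hle
  exact abs_eq_zero.1 (le_antisymm this (abs_nonneg _))

/-- The score has mean zero. -/
theorem integral_score (h : LocalModel ν q U M b C) (r : Fin p) {θ : Param p} (hθ : θ ∈ U) :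
    ∫ x, nllDeriv q [r] x θ * q x θ ∂ν = 0 := by
  have := h.integral_twisted_eq_zero h.boundedFamily_one (c := 1)
    (fun θ hθ => by simpa using h.integral_eq_one θ hθ) r hθ
  simpa [partialD, integral_neg] using this

/-- The information identity. -/
theorem integral_hessian (h : LocalModel ν q U M b C) (r s : Fin p) {θ : Param p} (hθ : θ ∈ U) :
    ∫ x, nllDeriv q [r, s] x θ * q x θ ∂ν =
      ∫ x, nllDeriv q [s] x θ * nllDeriv q [r] x θ * q x θ ∂ν := by
  have hg := h.boundedFamily_nllDeriv [s] (by simp) (by simp)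
  have h0 := h.integral_twisted_eq_zero hg (c := 0) (fun θ hθ => h.integral_score s hθ) r hθ
  have h1 := h.integrable_twisted hg r hθ
  have i2 := h.integrable_family (h.boundedFamily_nllDeriv [r, s] (by simp) (by simp)) hθ
  have e : ∀ x, nllDeriv q [s] x θ * nllDeriv q [r] x θ * q x θ = nllDeriv q [r, s] x θ * q x θ -
      (partialD r (nllDeriv q [s] x) θ - nllDeriv q [s] x θ * nllDeriv q [r] x θ) * q x θ := by
    intro x
    have : nllDeriv q [r, s] x θ = partialD r (nllDeriv q [s] x) θ := rfl
    rw [this]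
    ring
  simp_rw [e]
  rw [integral_sub i2 h1, h0, sub_zero]

end LocalModel

theorem integral_obsLaw {ν : ℕ → Measure 𝒳} {f : ℕ → 𝒳 → Param p → ℝ} {i : ℕ} {θ : Param p}
    (hm : Measurable fun x => f i x θ) (hf : ∀ᵐ x ∂(ν i), 0 < f i x θ) (y : 𝒳 → ℝ) :
    ∫ x, y x ∂(obsLaw ν f i θ) = ∫ x, y x * f i x θ ∂(ν i) := by
  rw [obsLaw, integral_withDensity_eq_integral_toReal_smul hm.ennreal_ofReal
    (Eventually.of_forall fun x => ENNReal.ofReal_lt_top)]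
  refine integral_congr_ae ?_
  filter_upwards [hf] with x hx
  rw [ENNReal.toReal_ofReal hx.le, smul_eq_mul, mul_comm]

/-- A regular model is uniformly regular on a ball around the true parameter. -/
theorem RegularModel.exists_localModel {ν : ℕ → Measure 𝒳} {f : ℕ → 𝒳 → Param p → ℝ}
    {Θ : Set (Param p)} {θ₀ : Param p} (h : RegularModel ν f Θ θ₀) :
    ∃ (ρ C : ℝ) (M b : ℕ → 𝒳 → ℝ), 0 < ρ ∧ Metric.ball θ₀ ρ ⊆ Θ ∧
      (∀ i, LocalModel (ν i) (f i) (Metric.ball θ₀ ρ) (M i) (b i) C) ∧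
      (∀ i, ∀ θ ∈ Θ, Measurable fun x => f i x θ) ∧
      (∀ i, ∀ᵐ x ∂(ν i), ∀ θ ∈ Θ, 0 < f i x θ) ∧
      (∀ i, ∀ᵐ x ∂(ν i), ∀ θ ∈ Θ, ∀ θ' ∈ Θ,
        |negLogLikOne f i x θ - negLogLikOne f i x θ'| ≤ M i x * ‖θ - θ'‖) := by
  obtain ⟨W, hW, hΘW, hmeas, hsm⟩ := h.smooth
  obtain ⟨δ, C, M, b, hδ, hM, hlip, hdom, hint⟩ := h.dominated
  obtain ⟨ε, hε, hεΘ⟩ := Metric.isOpen_iff.1 isOpen_interior θ₀ h.mem_interior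
  -- The radius is at most `δ` for the domination, and small enough for the ball to lie in `Θ`:
  -- there the densities integrate to one, and a maximizer in the ball is a critical point.
  have hballΘ : Metric.ball θ₀ (min δ ε) ⊆ Θ :=
    (Metric.ball_subset_ball (min_le_right _ _)).trans (hεΘ.trans interior_subset)
  have hballδ : Metric.ball θ₀ (min δ ε) ⊆ Metric.ball θ₀ δ :=
    Metric.ball_subset_ball (min_le_left _ _)
  have hmΘ : ∀ i, ∀ θ ∈ Θ, Measurable fun x => f i x θ := fun i θ hθ => hmeas i θ (hΘW hθ)
  have hpos : ∀ i, ∀ᵐ x ∂(ν i), ∀ θ ∈ Θ, 0 < f i x θ := fun i => by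
    filter_upwards [hsm i] with x hx θ hθ using hx.1 θ (hΘW hθ)
  refine ⟨min δ ε, C, M, b, lt_min hδ hε, hballΘ, fun i => ?_, hmΘ, hpos, hlip⟩
  refine ⟨Metric.isOpen_ball, convex_ball _ _, fun θ hθ => hmΘ i θ (hballΘ hθ), fun θ hθ => ?_,
    hM i, ?_, ?_, (hint i).1, (hint i).2⟩
  · have hprob := h.isProbabilityMeasure i θ (hballΘ hθ)
    have := integral_obsLaw (hmΘ i θ (hballΘ hθ)) ((hpos i).mono fun x hx => hx θ (hballΘ hθ))
      fun _ => (1 : ℝ)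
    simpa using this.symm
  · filter_upwards [hdom i] with x hx
    exact (norm_nonneg _).trans ((hx θ₀ (Metric.mem_ball_self hδ)).2 1 (by simp))
  · filter_upwards [hsm i, hdom i] with x hx hd
    have hsub : Metric.ball θ₀ (min δ ε) ⊆ W := hballΘ.trans hΘW
    have hcd := hx.2.mono hsub
    have hpos' : ∀ θ ∈ Metric.ball θ₀ (min δ ε), 0 < f i x θ := fun θ hθ => hx.1 θ (hsub hθ)
    refine ⟨hpos', hcd, fun θ hθ => (hd θ (hballδ hθ)).1, ?_⟩
    intro l hl1 hl4 θ hθ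
    have hlog : ContDiffOn ℝ (4 : ℕ) (fun θ => -Real.log (f i x θ)) (Metric.ball θ₀ (min δ ε)) :=
      (hcd.log fun θ hθ => (hpos' θ hθ).ne').neg
    exact (abs_foldr_partialD_le Metric.isOpen_ball hlog l hl4 hθ).trans
      ((hd θ (hballδ hθ)).2 l.length (Finset.mem_Icc.2 ⟨hl1, hl4⟩))

/-! ### Asymptotic expansions of estimators and inverse matrices -/

section Expansion

open Asymptotics Matrix

variable {β : Type*} {𝓛 : Filter β}

theorem isBigO_matrix_mul {A B : β → Matrix (Fin p) (Fin p) ℝ} {a b : β → ℝ}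
    (hA : ∀ i j, (fun x => A x i j) =O[𝓛] a) (hB : ∀ i j, (fun x => B x i j) =O[𝓛] b)
    (i j : Fin p) : (fun x => (A x * B x) i j) =O[𝓛] fun x => a x * b x := by
  simp only [Matrix.mul_apply]
  exact IsBigO.fun_sum fun k _ => (hA i k).mul (hB k j)

theorem tendsto_matrix_inv {A : β → Matrix (Fin p) (Fin p) ℝ} {F : Matrix (Fin p) (Fin p) ℝ}
    (hA : Tendsto A 𝓛 (𝓝 F)) (hF : IsUnit F.det) :
    (∀ᶠ x in 𝓛, IsUnit (A x).det) ∧ Tendsto (fun x => (A x)⁻¹) 𝓛 (𝓝 F⁻¹) := by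
  have hdet : Tendsto (fun x => (A x).det) 𝓛 (𝓝 F.det) :=
    ((Continuous.matrix_det continuous_id).tendsto F).comp hA
  have hadj : Tendsto (fun x => (A x).adjugate) 𝓛 (𝓝 F.adjugate) :=
    ((Continuous.matrix_adjugate continuous_id).tendsto F).comp hA
  refine ⟨?_, ?_⟩
  · filter_upwards [hdet.eventually_ne hF.ne_zero] with x hx using isUnit_iff_ne_zero.2 hx
  · simp only [Matrix.inv_def, Ring.inverse_eq_inv']
    exact (hdet.inv₀ hF.ne_zero).smul hadj

theorem Tendsto.isBigO_one_entry {A : β → Matrix (Fin p) (Fin p) ℝ} {F : Matrix (Fin p) (Fin p) ℝ}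
    (hA : Tendsto A 𝓛 (𝓝 F)) (i j : Fin p) : (fun x => A x i j) =O[𝓛] fun _ => (1 : ℝ) := by
  have h : Tendsto (fun x => A x i j) 𝓛 (𝓝 (F i j)) :=
    ((continuous_apply_apply i j).tendsto F).comp hA
  exact h.isBigO_one ℝ

/-- First order expansion of the inverse of a perturbed matrix. -/
theorem isBigO_inv_sub {A M G : β → Matrix (Fin p) (Fin p) ℝ} {F : Matrix (Fin p) (Fin p) ℝ}
    {Z : β → ℝ} (hA : Tendsto A 𝓛 (𝓝 F)) (hF : IsUnit F.det) (hZ : Tendsto Z 𝓛 (𝓝 0))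
    (hsymm : ∀ᶠ x in 𝓛, (A x)ᵀ = A x)
    (hG : ∀ t u, (fun x => G x t u) =O[𝓛] Z)
    (hM : ∀ t u, (fun x => M x t u - A x t u - G x t u) =O[𝓛] fun x => Z x ^ 2) (j : Fin p) :
    (fun x => (M x)⁻¹ j j - ((A x)⁻¹ j j - ∑ t, ∑ u, (A x)⁻¹ j t * (A x)⁻¹ j u * G x t u))
      =O[𝓛] fun x => Z x ^ 2 := by
  have hZ2 : (fun x => Z x ^ 2) =O[𝓛] Z := by
    have : (fun x => Z x * Z x) =O[𝓛] fun x => 1 * Z x :=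
      (hZ.isBigO_one ℝ).mul (isBigO_refl Z 𝓛)
    simpa [sq] using this
  set E : β → Matrix (Fin p) (Fin p) ℝ := fun x => M x - A x with hE
  have hEG : ∀ t u, (fun x => (E x - G x) t u) =O[𝓛] fun x => Z x ^ 2 := hM
  have hEO : ∀ t u, (fun x => E x t u) =O[𝓛] Z := fun t u => by
    have := ((hEG t u).trans hZ2).add (hG t u)
    refine this.congr_left fun x => ?_
    simp
  have hE0 : Tendsto E 𝓛 (𝓝 0) := by
    refine tendsto_pi_nhds.2 fun t => tendsto_pi_nhds.2 fun u => ?_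
    exact (hEO t u).trans_tendsto hZ
  have hMF : Tendsto M 𝓛 (𝓝 F) := by
    have := hA.add hE0
    rw [add_zero] at this
    refine this.congr fun x => ?_
    simp [hE]
  obtain ⟨hAu, hAi⟩ := tendsto_matrix_inv hA hF
  obtain ⟨hMu, hMi⟩ := tendsto_matrix_inv hMF hF
  have hB := Tendsto.isBigO_one_entry hAi
  have hC := Tendsto.isBigO_one_entry hMi
  have h1 : ∀ t u, (fun x => ((A x)⁻¹ * E x * (A x)⁻¹ * E x * (M x)⁻¹) t u)
      =O[𝓛] fun x => Z x ^ 2 := fun t u => by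
    have := isBigO_matrix_mul (isBigO_matrix_mul (isBigO_matrix_mul
      (isBigO_matrix_mul hB hEO) hB) hEO) hC t u
    refine this.trans (IsBigO.of_bound 1 (Eventually.of_forall fun x => ?_))
    simp [sq]
  have h2 : ∀ t u, (fun x => ((A x)⁻¹ * (E x - G x) * (A x)⁻¹) t u)
      =O[𝓛] fun x => Z x ^ 2 := fun t u => by
    have := isBigO_matrix_mul (isBigO_matrix_mul hB hEG) hB t u
    refine this.trans (IsBigO.of_bound 1 (Eventually.of_forall fun x => ?_))
    simp
  -- Iterating the resolvent identity gives exactly `M⁻¹ - A⁻¹ + A⁻¹EA⁻¹ = A⁻¹EA⁻¹EM⁻¹`. The right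
  -- side is `h1`, and replacing `E` by `G` in the linear term costs `h2`.
  refine ((h1 j j).sub (h2 j j)).congr' ?_ EventuallyEq.rfl
  filter_upwards [hAu, hMu, hsymm] with x hx hx' hs
  have e1 : (M x)⁻¹ = (A x)⁻¹ - (A x)⁻¹ * E x * (M x)⁻¹ := by
    simp only [hE, mul_sub, sub_mul]
    rw [Matrix.nonsing_inv_mul _ hx, Matrix.mul_assoc, Matrix.mul_nonsing_inv _ hx']
    simp
  have e2 : (A x)⁻¹ * E x * (A x)⁻¹ * E x * (M x)⁻¹ =
      (M x)⁻¹ - (A x)⁻¹ + (A x)⁻¹ * E x * (A x)⁻¹ := by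
    have : (A x)⁻¹ * E x * (A x)⁻¹ * E x * (M x)⁻¹ =
        (A x)⁻¹ * E x * ((A x)⁻¹ * E x * (M x)⁻¹) := by simp only [Matrix.mul_assoc]
    rw [this]
    have e3 : (A x)⁻¹ * E x * (M x)⁻¹ = (A x)⁻¹ - (M x)⁻¹ := by
      conv_rhs => rw [e1]
      simp
    rw [e3, mul_sub, e3]
    abel
  have hsB : ((A x)⁻¹)ᵀ = (A x)⁻¹ := by rw [Matrix.transpose_nonsing_inv, hs]
  have e4 : ∑ t, ∑ u, (A x)⁻¹ j t * (A x)⁻¹ j u * G x t u = ((A x)⁻¹ * G x * (A x)⁻¹) j j := by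
    simp only [Matrix.mul_apply, Finset.sum_mul]
    rw [Finset.sum_comm]
    refine Finset.sum_congr rfl fun t _ => Finset.sum_congr rfl fun u _ => ?_
    have : (A x)⁻¹ t j = (A x)⁻¹ j t := by
      conv_lhs => rw [← hsB]
      rfl
    rw [this]
    ring
  rw [e2, e4]
  simp only [mul_sub, sub_mul, Matrix.sub_apply, Matrix.add_apply]
  ring

/-- Linearization of an approximate zero of the score. -/
theorem isBigO_score_solution {A J : β → Matrix (Fin p) (Fin p) ℝ} {F : Matrix (Fin p) (Fin p) ℝ}
    {g : β → Fin p → ℝ} {d : β → Param p} {Z : β → ℝ}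
    (hA : Tendsto A 𝓛 (𝓝 F)) (hF : IsUnit F.det) (hZ : Tendsto Z 𝓛 (𝓝 0))
    (hsymm : ∀ᶠ x in 𝓛, (A x)ᵀ = A x)
    (hg : ∀ w, (fun x => g x w) =O[𝓛] Z)
    (hJ : ∀ t u, (fun x => J x t u - A x t u) =O[𝓛] Z)
    (hd : Tendsto d 𝓛 (𝓝 0))
    (hscore : ∀ w, (fun x => g x w + ∑ u, d x u * J x u w) =O[𝓛] fun x => ‖d x‖ ^ 2) :
    d =O[𝓛] Z ∧ ∀ r, (fun x => d x r + ∑ w, (A x)⁻¹ r w * g x w) =O[𝓛] fun x => Z x ^ 2 := by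
  obtain ⟨hAu, hAi⟩ := tendsto_matrix_inv hA hF
  have hB := Tendsto.isBigO_one_entry hAi
  have hdr : ∀ r, (fun x => d x r) =O[𝓛] fun x => ‖d x‖ := fun r =>
    IsBigO.of_bound 1 (Eventually.of_forall fun x => by
      simpa using abs_apply_le_norm (d x) r)
  have hd0 : Tendsto (fun x => ‖d x‖) 𝓛 (𝓝 0) := by simpa using hd.norm
  -- At this stage `d` is only known to tend to `0`, so errors are kept on the mixed scale `‖d‖ *
  -- (‖d‖ + |Z|)`, which is both `o(‖d‖)` and, once `d = O(Z)` is known, `O(Z²)`.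
  have he : ∀ w, (fun x => g x w + ∑ u, d x u * A x u w) =O[𝓛]
      fun x => ‖d x‖ * (‖d x‖ + |Z x|) := fun w => by
    have h1 : (fun x => ∑ u, d x u * (J x u w - A x u w)) =O[𝓛]
        fun x => ‖d x‖ * (‖d x‖ + |Z x|) := by
      refine IsBigO.fun_sum fun u _ => (hdr u).mul ((hJ u w).trans ?_)
      refine IsBigO.of_bound 1 (Eventually.of_forall fun x => ?_)
      rw [one_mul, Real.norm_eq_abs, Real.norm_eq_abs, abs_of_nonneg (a := ‖d x‖ + |Z x|)
        (by positivity)]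
      linarith [norm_nonneg (d x)]
    have h2 : (fun x => g x w + ∑ u, d x u * J x u w) =O[𝓛]
        fun x => ‖d x‖ * (‖d x‖ + |Z x|) := by
      refine (hscore w).trans (IsBigO.of_bound 1 (Eventually.of_forall fun x => ?_))
      rw [one_mul, Real.norm_of_nonneg (by positivity), Real.norm_of_nonneg (by positivity), sq]
      gcongr
      linarith [abs_nonneg (Z x)]
    refine (h2.sub h1).congr_left fun x => ?_
    simp only [mul_sub, Finset.sum_sub_distrib]
    ring
  have hrem : ∀ r, (fun x => d x r + ∑ w, (A x)⁻¹ r w * g x w) =O[𝓛]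
      fun x => ‖d x‖ * (‖d x‖ + |Z x|) := fun r => by
    have h1 : (fun x => ∑ w, (A x)⁻¹ r w * (g x w + ∑ u, d x u * A x u w)) =O[𝓛]
        fun x => ‖d x‖ * (‖d x‖ + |Z x|) := by
      refine IsBigO.fun_sum fun w _ => ?_
      simpa using (hB r w).mul (he w)
    refine h1.congr' ?_ EventuallyEq.rfl
    filter_upwards [hAu, hsymm] with x hx hs
    simp only [mul_add, Finset.sum_add_distrib]
    rw [add_comm]
    congr 1
    have e1 : ∑ w, (A x)⁻¹ r w * ∑ u, d x u * A x u w = ((A x)⁻¹ *ᵥ (A x *ᵥ fun u => d x u)) r := by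
      simp only [Matrix.mulVec, dotProduct]
      refine Finset.sum_congr rfl fun w _ => ?_
      congr 1
      refine Finset.sum_congr rfl fun u _ => ?_
      have : A x u w = A x w u := by
        conv_lhs => rw [← hs]
        rfl
      rw [this, mul_comm]
    rw [e1, Matrix.mulVec_mulVec, Matrix.nonsing_inv_mul _ hx, Matrix.one_mulVec]
  have hsmall : Tendsto (fun x => ‖d x‖ + |Z x|) 𝓛 (𝓝 0) := by
    simpa using hd0.add hZ.abs
  set d' : β → Fin p → ℝ := fun x r => d x r with hd'
  set c : β → Fin p → ℝ := fun x r => ∑ w, (A x)⁻¹ r w * g x w with hc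
  have hdd' : (fun x => ‖d x‖) =O[𝓛] d' := by
    refine IsBigO.of_bound (Real.sqrt p) (Eventually.of_forall fun x => ?_)
    rw [norm_norm, EuclideanSpace.norm_eq]
    calc Real.sqrt (∑ i, ‖d x i‖ ^ 2) ≤ Real.sqrt (∑ _i : Fin p, ‖d' x‖ ^ 2) := by
          refine Real.sqrt_le_sqrt (Finset.sum_le_sum fun i _ => ?_)
          exact pow_le_pow_left₀ (norm_nonneg _) (norm_le_pi_norm (d' x) i) 2
      _ = Real.sqrt p * ‖d' x‖ := by
          rw [Finset.sum_const, Finset.card_univ, Fintype.card_fin, nsmul_eq_mul,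
            Real.sqrt_mul (Nat.cast_nonneg p), Real.sqrt_sq (norm_nonneg _)]
  -- Bootstrap from consistency to a rate: `d' + c = o(d')` forces `d' = O(c)`, and `c` is linear in
  -- the score, hence `O(Z)`.
  have hlo : (fun x => d' x + c x) =o[𝓛] d' := by
    refine isLittleO_pi.2 fun r => ?_
    refine IsLittleO.trans_isBigO ?_ hdd'
    refine (hrem r).trans_isLittleO ?_
    have : (fun x => ‖d x‖ * (‖d x‖ + |Z x|)) =o[𝓛] fun x => ‖d x‖ * 1 :=
      (isBigO_refl _ _).mul_isLittleO ((isLittleO_one_iff ℝ).2 hsmall)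
    simpa using this
  have hcZ : c =O[𝓛] Z := by
    refine isBigO_pi.2 fun r => IsBigO.fun_sum fun w _ => ?_
    simpa using (hB r w).mul (hg w)
  have hd'Z : d' =O[𝓛] Z := by
    refine hlo.right_isBigO_sub.trans ?_
    refine hcZ.neg_left.congr_left fun x => ?_
    simp
  have hdZ : (fun x => ‖d x‖) =O[𝓛] Z := hdd'.trans hd'Z
  refine ⟨hdZ.of_norm_left, fun r => (hrem r).trans ?_⟩
  have : (fun x => ‖d x‖ + |Z x|) =O[𝓛] Z := hdZ.add (isBigO_refl Z 𝓛).abs_left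
  simpa [sq] using hdZ.mul this

end Expansion

/-! ### Comparison of mean squared errors from asymptotic bounds -/

theorem tendsto_inv_sqrt_natCast : Tendsto (fun n : ℕ => (Real.sqrt n)⁻¹) atTop (𝓝 0) :=
  (Real.tendsto_sqrt_atTop.comp tendsto_natCast_atTop_atTop).inv_tendsto_atTop

/-- Only the gap `c * τ - K / √n` and the boundedness of `n * mE` matter. Nonnegativity of `τ`
leaves a vanishing negative part in the scaled difference, whereas a positive lower limit of `τ`
keeps the scaled difference away from zero. -/
theorem liminf_comparison {mO mE : ℕ → ℝ≥0∞} {u w τ : ℕ → ℝ} {c K : ℝ} (hc : 0 < c) (hK : 0 ≤ K)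
    (hOtop : ∀ n, mO n ≠ ⊤)
    (h : ∀ᶠ n : ℕ in atTop, ENNReal.ofReal (u n) ≤ mO n ∧ mE n ≤ ENNReal.ofReal (w n) ∧ 0 ≤ w n ∧
      0 ≤ τ n ∧ c * τ n - K * (Real.sqrt n)⁻¹ ≤ n * (u n - w n) ∧ n * w n ≤ K) :
    (0 ≤ liminf (fun n : ℕ => (n : EReal) * ((mO n : EReal) - (mE n : EReal))) atTop) ∧
    (0 < liminf (fun n : ℕ => (n : ℝ≥0∞) * mO n) atTop → 1 ≤ liminf (fun n => mO n / mE n) atTop) ∧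
    (0 < liminf (fun n : ℕ => ((τ n : ℝ) : EReal)) atTop →
      1 < liminf (fun n => mO n / mE n) atTop) := by
  set o : ℕ → ℝ := fun n => (mO n).toReal with ho
  set e : ℕ → ℝ := fun n => (mE n).toReal with he
  have hO : ∀ n, mO n = ENNReal.ofReal (o n) := fun n => (ENNReal.ofReal_toReal (hOtop n)).symm
  have ho0 : ∀ n, 0 ≤ o n := fun n => ENNReal.toReal_nonneg
  have he0 : ∀ n, 0 ≤ e n := fun n => ENNReal.toReal_nonneg
  have hreal : ∀ᶠ n : ℕ in atTop, mE n = ENNReal.ofReal (e n) ∧ 0 ≤ τ n ∧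
      c * τ n - K * (Real.sqrt n)⁻¹ ≤ n * (o n - e n) ∧ n * e n ≤ K := by
    filter_upwards [h] with n hn
    obtain ⟨h1, h2, h3, h4, h5, h6⟩ := hn
    have hEt : mE n ≠ ⊤ := ne_top_of_le_ne_top ENNReal.ofReal_ne_top h2
    have huo : u n ≤ o n := (ENNReal.ofReal_le_iff_le_toReal (hOtop n)).1 h1
    have hew : e n ≤ w n := ENNReal.toReal_le_of_le_ofReal h3 h2
    have hn0 : (0 : ℝ) ≤ n := Nat.cast_nonneg n
    refine ⟨(ENNReal.ofReal_toReal hEt).symm, h4, h5.trans ?_, ?_⟩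
    · gcongr
    · exact (mul_le_mul_of_nonneg_left hew hn0).trans h6
  have hpos : ∀ᶠ n : ℕ in atTop, 0 < n := eventually_gt_atTop 0
  refine ⟨?_, ?_, ?_⟩
  · have hlim : Tendsto (fun n : ℕ => ((-(K * (Real.sqrt n)⁻¹) : ℝ) : EReal)) atTop
        (𝓝 ((0 : ℝ) : EReal)) := by
      refine (continuous_coe_real_ereal.tendsto 0).comp ?_
      simpa using (tendsto_inv_sqrt_natCast.const_mul K).neg
    have h0 : ((0 : ℝ) : EReal) = 0 := rfl
    rw [← h0, ← hlim.liminf_eq]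
    refine liminf_le_liminf ?_
    filter_upwards [hreal] with n hn
    obtain ⟨h1, h2, h3, -⟩ := hn
    rw [hO n, h1, EReal.coe_ennreal_ofReal, EReal.coe_ennreal_ofReal, max_eq_left (ho0 n),
      max_eq_left (he0 n)]
    have : (n : EReal) * ((o n : EReal) - (e n : EReal)) = ((n * (o n - e n) : ℝ) : EReal) := by
      push_cast
      rfl
    rw [this, EReal.coe_le_coe_iff]
    have : 0 ≤ c * τ n := mul_nonneg hc.le h2
    linarith
  · intro hlim
    obtain ⟨c', hc'0, hc'⟩ := exists_between hlim
    have hc't : c' ≠ ⊤ := ne_top_of_lt hc'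
    set c₀ := c'.toReal with hc₀
    have hc₀pos : 0 < c₀ := ENNReal.toReal_pos hc'0.ne' hc't
    have hev := eventually_lt_of_lt_liminf hc'
    -- Once `n * mO ≥ c₀`, the possible loss `K / √n` is at most the fraction `K / (c₀ * √n)` of `n
    -- * mO`, which gives this lower bound for the ratio.
    have hr : Tendsto (fun n : ℕ => ENNReal.ofReal ((1 + K / c₀ * (Real.sqrt n)⁻¹)⁻¹)) atTop
        (𝓝 1) := by
      have h1 : Tendsto (fun n : ℕ => (1 + K / c₀ * (Real.sqrt n)⁻¹)⁻¹) atTop (𝓝 1) := by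
        have h2 := ((tendsto_inv_sqrt_natCast.const_mul (K / c₀)).const_add 1).inv₀ (by simp)
        simpa using h2
      have := ENNReal.tendsto_ofReal h1
      simpa using this
    rw [← hr.liminf_eq]
    refine liminf_le_liminf ?_
    filter_upwards [hreal, hev, hpos] with n hn hn' hn0
    obtain ⟨h1, h2, h3, -⟩ := hn
    have hn0' : (0 : ℝ) < n := Nat.cast_pos.2 hn0
    have hno : c₀ ≤ n * o n := by
      have h4 : (n : ℝ≥0∞) * mO n = ENNReal.ofReal (n * o n) := by
        rw [ENNReal.ofReal_mul (Nat.cast_nonneg n), ← hO n, ENNReal.ofReal_natCast]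
      rw [h4] at hn'
      exact ENNReal.toReal_le_of_le_ofReal (by have := ho0 n; positivity) hn'.le
    have hopos : 0 < o n := by
      by_contra hcon
      have : o n = 0 := le_antisymm (not_lt.1 hcon) (ho0 n)
      rw [this, mul_zero] at hno
      linarith
    have hmO : mO n ≠ 0 := by
      rw [hO n]
      exact (ENNReal.ofReal_pos.2 hopos).ne'
    rw [ENNReal.le_div_iff_mul_le (Or.inr hmO) (Or.inr (hOtop n)), hO n, h1,
      ← ENNReal.ofReal_mul (by positivity)]
    refine ENNReal.ofReal_le_ofReal ?_
    have hs : 0 ≤ (Real.sqrt n)⁻¹ := by positivity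
    rw [inv_mul_le_iff₀ (by positivity)]
    have h5 : n * e n ≤ n * o n + K * (Real.sqrt n)⁻¹ := by
      have : 0 ≤ c * τ n := mul_nonneg hc.le h2
      linarith
    have h6 : K * (Real.sqrt n)⁻¹ ≤ n * (o n * (K / c₀ * (Real.sqrt n)⁻¹)) := by
      calc K * (Real.sqrt n)⁻¹ = c₀ * (K / c₀ * (Real.sqrt n)⁻¹) := by field_simp
        _ ≤ (n * o n) * (K / c₀ * (Real.sqrt n)⁻¹) := by gcongr
        _ = _ := by ring
    have h7 : n * e n ≤ n * ((1 + K / c₀ * (Real.sqrt n)⁻¹) * o n) := by linarith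
    exact le_of_mul_le_mul_left h7 hn0'
  · intro hlim
    obtain ⟨c', hc'0, hc'⟩ := EReal.lt_iff_exists_real_btwn.1 hlim
    have hc'pos : 0 < c' := by exact_mod_cast hc'0
    have hev := eventually_lt_of_lt_liminf hc'
    have hsmall : ∀ᶠ n : ℕ in atTop, K * (Real.sqrt n)⁻¹ ≤ c * c' / 2 := by
      have := tendsto_inv_sqrt_natCast.const_mul K
      rw [mul_zero] at this
      exact (this.eventually (gt_mem_nhds (by positivity : 0 < c * c' / 2))).mono fun n hn => hn.le
    set c₂ := c * c' / 2 with hc₂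
    have hc₂pos : 0 < c₂ := by positivity
    -- The scaled gap is eventually at least `c₂` and `n * mE ≤ K`, so the relative gain is at least
    -- `c₂ / (K + 1)`; the added `1` avoids division by zero.
    have hlt : (1 : ℝ≥0∞) < ENNReal.ofReal (1 + c₂ / (K + 1)) := by
      rw [← ENNReal.ofReal_one, ENNReal.ofReal_lt_ofReal_iff (by positivity)]
      have : 0 < c₂ / (K + 1) := by positivity
      linarith
    refine hlt.trans_le (le_liminf_of_le (by isBoundedDefault) ?_)
    filter_upwards [hreal, hev, hsmall, hpos] with n hn hn' hns hn0
    obtain ⟨h1, h2, h3, h4⟩ := hn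
    have hn0' : (0 : ℝ) < n := Nat.cast_pos.2 hn0
    have hτ : c' < τ n := by exact_mod_cast hn'
    have h5 : c₂ ≤ n * (o n - e n) := by
      have : c * c' ≤ c * τ n := by gcongr
      have : c * c' = 2 * c₂ := by rw [hc₂]; ring
      linarith
    have hopos : 0 < o n := by
      by_contra hcon
      have h6 : o n = 0 := le_antisymm (not_lt.1 hcon) (ho0 n)
      have := mul_nonneg hn0'.le (he0 n)
      rw [h6] at h5
      linarith
    have hmO : mO n ≠ 0 := by
      rw [hO n]
      exact (ENNReal.ofReal_pos.2 hopos).ne'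
    rw [ENNReal.le_div_iff_mul_le (Or.inr hmO) (Or.inr (hOtop n)), hO n, h1,
      ← ENNReal.ofReal_mul (by positivity)]
    refine ENNReal.ofReal_le_ofReal ?_
    have h6 : c₂ / (K + 1) * (n * e n) ≤ c₂ := by
      calc c₂ / (K + 1) * (n * e n) ≤ c₂ / (K + 1) * (K + 1) := by gcongr; linarith
        _ = c₂ := by field_simp
    have h7 : n * ((1 + c₂ / (K + 1)) * e n) ≤ n * o n := by linarith
    exact le_of_mul_le_mul_left h7 hn0'

/-! ### Independent observations from a regular model -/

/-- Independent observations `X i` from densities `f i · θ₀` which are uniformly regular on the ball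
of radius `ρ` around `θ₀`. -/
structure SampleModel (P : Measure Ω) (ν : ℕ → Measure 𝒳) (f : ℕ → 𝒳 → Param p → ℝ)
    (Θ : Set (Param p)) (θ₀ : Param p) (X : ℕ → Ω → 𝒳) (ρ C : ℝ) (M b : ℕ → 𝒳 → ℝ) : Prop where
  measX : ∀ i, Measurable (X i)
  indep : iIndepFun X P
  law : ∀ i, P.map (X i) = obsLaw ν f i θ₀
  pos : 0 < ρ
  ball_subset : Metric.ball θ₀ ρ ⊆ Θ
  model : ∀ i, LocalModel (ν i) (f i) (Metric.ball θ₀ ρ) (M i) (b i) C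
  measΘ : ∀ i, ∀ θ ∈ Θ, Measurable fun x => f i x θ
  posΘ : ∀ i, ∀ᵐ x ∂(ν i), ∀ θ ∈ Θ, 0 < f i x θ
  lipschitz : ∀ i, ∀ᵐ x ∂(ν i), ∀ θ ∈ Θ, ∀ θ' ∈ Θ,
    |negLogLikOne f i x θ - negLogLikOne f i x θ'| ≤ M i x * ‖θ - θ'‖

namespace SampleModel

variable {P : Measure Ω} {ν : ℕ → Measure 𝒳}
  {f : ℕ → 𝒳 → Param p → ℝ} {Θ : Set (Param p)} {θ₀ : Param p} {X : ℕ → Ω → 𝒳} {ρ C : ℝ}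
  {M b : ℕ → 𝒳 → ℝ}

theorem mem_ball (h : SampleModel P ν f Θ θ₀ X ρ C M b) : θ₀ ∈ Metric.ball θ₀ ρ :=
  Metric.mem_ball_self h.pos

theorem map_absolutelyContinuous (h : SampleModel P ν f Θ θ₀ X ρ C M b) (i : ℕ) :
    P.map (X i) ≪ ν i := by
  rw [h.law i]
  exact withDensity_absolutelyContinuous _ _

theorem integral_obsLaw_of_mem (h : SampleModel P ν f Θ θ₀ X ρ C M b) (i : ℕ) {θ : Param p}
    (hθ : θ ∈ Metric.ball θ₀ ρ) (y : 𝒳 → ℝ) :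
    ∫ x, y x ∂(obsLaw ν f i θ) = ∫ x, y x * f i x θ ∂(ν i) :=
  integral_obsLaw ((h.model i).meas θ hθ) ((h.model i).density.mono fun _ hx => hx.pos θ hθ) y

variable [IsProbabilityMeasure P]

theorem ae_comp (h : SampleModel P ν f Θ θ₀ X ρ C M b) {i : ℕ} {Q : 𝒳 → Prop}
    (hQ : ∀ᵐ x ∂(ν i), Q x) : ∀ᵐ ω ∂P, Q (X i ω) :=
  ae_of_ae_map (h.measX i).aemeasurable ((h.map_absolutelyContinuous i).ae_le hQ)

theorem aemeasurable_map (h : SampleModel P ν f Θ θ₀ X ρ C M b) {i : ℕ} {y : 𝒳 → ℝ}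
    (hy : AEMeasurable y (ν i)) : AEMeasurable y (P.map (X i)) :=
  hy.mono_ac (h.map_absolutelyContinuous i)

theorem aemeasurable_comp (h : SampleModel P ν f Θ θ₀ X ρ C M b) {i : ℕ} {y : 𝒳 → ℝ}
    (hy : AEMeasurable y (ν i)) : AEMeasurable (fun ω => y (X i ω)) P :=
  (h.aemeasurable_map hy).comp_measurable (h.measX i)

theorem integral_comp_eq_obsLaw (h : SampleModel P ν f Θ θ₀ X ρ C M b) {i : ℕ} {y : 𝒳 → ℝ}
    (hy : AEMeasurable y (ν i)) : ∫ ω, y (X i ω) ∂P = ∫ x, y x ∂(obsLaw ν f i θ₀) := by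
  rw [← h.law i, integral_map (h.measX i).aemeasurable (h.aemeasurable_map hy).aestronglyMeasurable]

theorem integral_comp (h : SampleModel P ν f Θ θ₀ X ρ C M b) {i : ℕ} {y : 𝒳 → ℝ}
    (hy : AEMeasurable y (ν i)) : ∫ ω, y (X i ω) ∂P = ∫ x, y x * f i x θ₀ ∂(ν i) := by
  rw [h.integral_comp_eq_obsLaw hy, h.integral_obsLaw_of_mem i h.mem_ball]

theorem iIndepFun_comp (h : SampleModel P ν f Θ θ₀ X ρ C M b) {y : ℕ → 𝒳 → ℝ}
    (hy : ∀ i, AEMeasurable (y i) (ν i)) : iIndepFun (fun i ω => y i (X i ω)) P :=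
  h.indep.comp₀ y (fun i => (h.measX i).aemeasurable) fun i => h.aemeasurable_map (hy i)

theorem indepFun_comp (h : SampleModel P ν f Θ θ₀ X ρ C M b) {y y' : ℕ → 𝒳 → ℝ}
    (hy : ∀ i, AEMeasurable (y i) (ν i)) (hy' : ∀ i, AEMeasurable (y' i) (ν i)) (i k : ℕ)
    (hik : i ≠ k) : IndepFun (fun ω => y i (X i ω)) (fun ω => y' k (X k ω)) P :=
  (h.indep.indepFun hik).comp₀ (h.measX i).aemeasurable (h.measX k).aemeasurable
    (h.aemeasurable_map (hy i)) (h.aemeasurable_map (hy' k))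

/-- The true density is at most `b i`, so the domination integral bounds, uniformly in `i`, the
fourth moment of anything controlled by a multiple of `M i`. -/
theorem memLp_comp (h : SampleModel P ν f Θ θ₀ X ρ C M b) {i : ℕ} {y : 𝒳 → ℝ}
    (hy : AEMeasurable y (ν i)) {c : ℝ} (hc : ∀ᵐ x ∂(ν i), |y x| ≤ c * M i x) :
    MemLp (fun ω => y (X i ω)) 4 P ∧ ∫ ω, y (X i ω) ^ 4 ∂P ≤ c ^ 4 * C := by
  have hm := (h.model i)
  have hbd : ∀ᵐ x ∂(ν i), |y x ^ 4| ≤ c ^ 4 * (1 + M i x ^ 4) := by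
    filter_upwards [hc] with x hx
    rw [abs_pow]
    have := pow_le_pow_left₀ (abs_nonneg _) hx 4
    rw [mul_pow] at this
    have h0 : 0 ≤ c ^ 4 := by positivity
    linarith
  have hi := hm.integrable_mul (hy.pow_const 4) hbd h.mem_ball
  have hi' : Integrable (fun x => y x ^ 4) (P.map (X i)) := by
    rw [h.law i, obsLaw, integrable_withDensity_iff (hm.meas θ₀ h.mem_ball).ennreal_ofReal
      (Eventually.of_forall fun x => ENNReal.ofReal_lt_top)]
    refine hi.congr ?_
    filter_upwards [hm.density] with x hx
    rw [ENNReal.toReal_ofReal (hx.pos θ₀ h.mem_ball).le]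
  have hi'' : Integrable (fun ω => y (X i ω) ^ 4) P := hi'.comp_measurable (h.measX i)
  refine ⟨(memLp_four_iff_integrable_pow (h.aemeasurable_comp hy).aestronglyMeasurable).2 hi'', ?_⟩
  rw [h.integral_comp (y := fun x => y x ^ 4) (hy.pow_const 4)]
  calc ∫ x, y x ^ 4 * f i x θ₀ ∂(ν i) ≤ ∫ x, c ^ 4 * ((1 + M i x ^ 4) * b i x) ∂(ν i) := by
        refine integral_mono_ae hi (hm.integrable.const_mul _) ?_
        filter_upwards [hbd, hm.density] with x hx hd
        have hq := hd.pos θ₀ h.mem_ball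
        have h0 : 0 ≤ y x ^ 4 := by positivity
        rw [← mul_assoc]
        exact mul_le_mul ((le_abs_self _).trans hx) (hd.le θ₀ h.mem_ball) hq.le
          ((abs_nonneg _).trans hx)
    _ ≤ c ^ 4 * C := by
        rw [integral_const_mul]
        exact mul_le_mul_of_nonneg_left hm.integral_le (by positivity)

theorem fourthMomentSmall_comp (h : SampleModel P ν f Θ θ₀ X ρ C M b) {y : ℕ → 𝒳 → ℝ}
    (hy : ∀ i, AEMeasurable (y i) (ν i)) {c : ℝ} (hc : ∀ i, ∀ᵐ x ∂(ν i), |y i x| ≤ c * M i x) :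
    FourthMomentSmall P fun n ω => |fluct P (fun i ω => y i (X i ω)) n ω| :=
  fourthMomentSmall_abs_fluct (fun i => (h.memLp_comp (hy i) (hc i)).1) (h.iIndepFun_comp hy)
    fun i => (h.memLp_comp (hy i) (hc i)).2

/-- The derivatives at `θ₀` of the negative log-likelihood of the `i`-th observation. -/
abbrev deriv₀ (f : ℕ → 𝒳 → Param p → ℝ) (θ₀ : Param p) (X : ℕ → Ω → 𝒳) (l : List (Fin p))
    (i : ℕ) (ω : Ω) : ℝ :=
  nllDeriv (f i) l (X i ω) θ₀

theorem aemeasurable_nllDeriv (h : SampleModel P ν f Θ θ₀ X ρ C M b) (l : List (Fin p))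
    (hl : l.length ≤ 4) (i : ℕ) : AEMeasurable (fun x => nllDeriv (f i) l x θ₀) (ν i) :=
  (h.model i).aemeasurable_nllDeriv l hl h.mem_ball

theorem abs_nllDeriv_le (h : SampleModel P ν f Θ θ₀ X ρ C M b) (l : List (Fin p))
    (hl1 : 1 ≤ l.length) (hl : l.length ≤ 4) (i : ℕ) :
    ∀ᵐ x ∂(ν i), |nllDeriv (f i) l x θ₀| ≤ 1 * M i x := by
  filter_upwards [(h.model i).density] with x hx
  rw [one_mul]
  exact hx.bound l hl1 hl θ₀ h.mem_ball

theorem memLp_deriv₀ (h : SampleModel P ν f Θ θ₀ X ρ C M b) (l : List (Fin p))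
    (hl1 : 1 ≤ l.length) (hl : l.length ≤ 4) (i : ℕ) : MemLp (deriv₀ f θ₀ X l i) 4 P :=
  (h.memLp_comp (h.aemeasurable_nllDeriv l hl i) (h.abs_nllDeriv_le l hl1 hl i)).1

theorem abs_integral_deriv₀_le (h : SampleModel P ν f Θ θ₀ X ρ C M b) (l : List (Fin p))
    (hl1 : 1 ≤ l.length) (hl : l.length ≤ 4) (i : ℕ) : |∫ ω, deriv₀ f θ₀ X l i ω ∂P| ≤ 1 + C := by
  have hm := h.memLp_comp (h.aemeasurable_nllDeriv l hl i) (h.abs_nllDeriv_le l hl1 hl i)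
  rw [one_pow, one_mul] at hm
  refine abs_integral_le_integral_abs.trans ?_
  simpa using integral_pow_le_of_four hm.1 hm.2 (k := 1) (by norm_num)

theorem fourthMomentSmall_deriv₀ (h : SampleModel P ν f Θ θ₀ X ρ C M b) (l : List (Fin p))
    (hl1 : 1 ≤ l.length) (hl : l.length ≤ 4) :
    FourthMomentSmall P fun n ω => |fluct P (deriv₀ f θ₀ X l) n ω| :=
  h.fourthMomentSmall_comp (h.aemeasurable_nllDeriv l hl) (h.abs_nllDeriv_le l hl1 hl)

theorem memLp_bound (h : SampleModel P ν f Θ θ₀ X ρ C M b) (i : ℕ) :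
    MemLp (fun ω => M i (X i ω)) 4 P ∧ ∫ ω, M i (X i ω) ^ 4 ∂P ≤ C := by
  have := h.memLp_comp (i := i) (y := M i) (c := 1) (h.model i).measM.aemeasurable
    ((h.model i).nonneg.mono fun x hx => by rw [abs_of_nonneg hx, one_mul])
  simpa using this

theorem C_nonneg (h : SampleModel P ν f Θ θ₀ X ρ C M b) : 0 ≤ C :=
  (integral_nonneg fun ω => by positivity).trans (h.memLp_bound 0).2

theorem fourthMomentSmall_bound (h : SampleModel P ν f Θ θ₀ X ρ C M b) :
    FourthMomentSmall P fun n ω => |fluct P (fun i ω => M i (X i ω)) n ω| :=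
  h.fourthMomentSmall_comp (c := 1) (fun i => (h.model i).measM.aemeasurable)
    fun i => (h.model i).nonneg.mono fun x hx => by rw [abs_of_nonneg hx, one_mul]

theorem aemeasurable_negLogLikOne_sub (h : SampleModel P ν f Θ θ₀ X ρ C M b) {t : Param p}
    (ht : t ∈ Θ) (i : ℕ) :
    AEMeasurable (fun x => negLogLikOne f i x t - negLogLikOne f i x θ₀) (ν i) :=
  ((Real.measurable_log.comp (h.measΘ i t ht)).neg.sub
    (Real.measurable_log.comp (h.measΘ i θ₀ (h.ball_subset h.mem_ball))).neg).aemeasurable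

/-- The Lipschitz condition dominates the log-likelihood ratio at a fixed parameter, even far from
`θ₀`, by `‖t - θ₀‖ * M i`. This feeds the finite net in the consistency argument. -/
theorem fourthMomentSmall_negLogLikOne_sub (h : SampleModel P ν f Θ θ₀ X ρ C M b) {t : Param p}
    (ht : t ∈ Θ) :
    FourthMomentSmall P fun n ω => |fluct P
      (fun i ω => negLogLikOne f i (X i ω) t - negLogLikOne f i (X i ω) θ₀) n ω| :=
  h.fourthMomentSmall_comp (y := fun i x => negLogLikOne f i x t - negLogLikOne f i x θ₀)
    (c := ‖t - θ₀‖) (h.aemeasurable_negLogLikOne_sub ht) fun i => by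
      filter_upwards [h.lipschitz i] with x hx
      rw [mul_comm]
      exact hx t ht θ₀ (h.ball_subset h.mem_ball)

/-! #### First and second moments of the derivatives -/

theorem integral_deriv₀_score (h : SampleModel P ν f Θ θ₀ X ρ C M b) (w : Fin p) (i : ℕ) :
    ∫ ω, deriv₀ f θ₀ X [w] i ω ∂P = 0 := by
  rw [h.integral_comp (h.aemeasurable_nllDeriv [w] (by simp) i)]
  exact (h.model i).integral_score w h.mem_ball

theorem integral_deriv₀_mul (h : SampleModel P ν f Θ θ₀ X ρ C M b) (l l' : List (Fin p))
    (hl : l.length ≤ 4) (hl' : l'.length ≤ 4) (i : ℕ) :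
    ∫ ω, deriv₀ f θ₀ X l i ω * deriv₀ f θ₀ X l' i ω ∂P =
      ∫ x, nllDeriv (f i) l x θ₀ * nllDeriv (f i) l' x θ₀ * f i x θ₀ ∂(ν i) :=
  h.integral_comp (y := fun x => nllDeriv (f i) l x θ₀ * nllDeriv (f i) l' x θ₀)
    ((h.aemeasurable_nllDeriv l hl i).mul (h.aemeasurable_nllDeriv l' hl' i))

theorem integral_deriv₀_hessian (h : SampleModel P ν f Θ θ₀ X ρ C M b) (t u : Fin p) (i : ℕ) :
    ∫ ω, deriv₀ f θ₀ X [t, u] i ω ∂P =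
      ∫ ω, deriv₀ f θ₀ X [t] i ω * deriv₀ f θ₀ X [u] i ω ∂P := by
  rw [h.integral_comp (h.aemeasurable_nllDeriv [t, u] (by simp) i),
    h.integral_deriv₀_mul [t] [u] (by simp) (by simp),
    (h.model i).integral_hessian t u h.mem_ball]
  simp_rw [mul_comm (nllDeriv (f i) [u] _ θ₀)]

theorem covariance_deriv₀_score (h : SampleModel P ν f Θ θ₀ X ρ C M b) (l : List (Fin p))
    (hl1 : 1 ≤ l.length) (hl : l.length ≤ 4) (w : Fin p) (i : ℕ) :
    cov[deriv₀ f θ₀ X l i, deriv₀ f θ₀ X [w] i; P] =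
      ∫ ω, deriv₀ f θ₀ X l i ω * deriv₀ f θ₀ X [w] i ω ∂P := by
  rw [covariance_eq_sub (h.memLp_deriv₀ l hl1 hl i).two_of_four
    (h.memLp_deriv₀ [w] (by simp) (by simp) i).two_of_four, h.integral_deriv₀_score]
  simp

theorem expectedFIM_eq (h : SampleModel P ν f Θ θ₀ X ρ C M b) (n : ℕ) (t u : Fin p) :
    expectedFIM ν f n θ₀ t u =
      (n : ℝ)⁻¹ * ∑ i ∈ Finset.range n, ∫ ω, deriv₀ f θ₀ X [t, u] i ω ∂P := by
  simp only [expectedFIM, Matrix.of_apply]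
  congr 1
  refine Finset.sum_congr rfl fun i _ => ?_
  exact (h.integral_comp_eq_obsLaw (h.aemeasurable_nllDeriv [t, u] (by simp) i)).symm

/-- Symmetry comes from the information identity, with no interchange of partial derivatives. -/
theorem expectedFIM_transpose (h : SampleModel P ν f Θ θ₀ X ρ C M b) (n : ℕ) :
    (expectedFIM ν f n θ₀).transpose = expectedFIM ν f n θ₀ := by
  ext t u
  rw [Matrix.transpose_apply, h.expectedFIM_eq, h.expectedFIM_eq]
  simp_rw [h.integral_deriv₀_hessian]
  simp_rw [mul_comm]

theorem fluct_score (h : SampleModel P ν f Θ θ₀ X ρ C M b) (w : Fin p) (n : ℕ) (ω : Ω) :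
    fluct P (deriv₀ f θ₀ X [w]) n ω =
      (n : ℝ)⁻¹ * ∑ i ∈ Finset.range n, deriv₀ f θ₀ X [w] i ω := by
  simp [fluct, h.integral_deriv₀_score]

theorem integral_fluct_mul_score (h : SampleModel P ν f Θ θ₀ X ρ C M b) (l : List (Fin p))
    (hl1 : 1 ≤ l.length) (hl : l.length ≤ 4) (w : Fin p) (n : ℕ) :
    ∫ ω, fluct P (deriv₀ f θ₀ X l) n ω * fluct P (deriv₀ f θ₀ X [w]) n ω ∂P =
      (n : ℝ)⁻¹ * ((n : ℝ)⁻¹ * ∑ i ∈ Finset.range n,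
        ∫ ω, deriv₀ f θ₀ X l i ω * deriv₀ f θ₀ X [w] i ω ∂P) := by
  rw [integral_fluct_mul_fluct (h.memLp_deriv₀ l hl1 hl) (h.memLp_deriv₀ [w] (by simp) (by simp))
    (h.indepFun_comp (h.aemeasurable_nllDeriv l hl) (h.aemeasurable_nllDeriv [w] (by simp)))]
  simp_rw [h.covariance_deriv₀_score l hl1 hl w]

/-- Independence leaves the diagonal, where the information identity turns products of scores into
second derivatives. -/
theorem integral_score_mul_score (h : SampleModel P ν f Θ θ₀ X ρ C M b) (v w : Fin p) (n : ℕ) :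
    ∫ ω, fluct P (deriv₀ f θ₀ X [v]) n ω * fluct P (deriv₀ f θ₀ X [w]) n ω ∂P =
      (n : ℝ)⁻¹ * expectedFIM ν f n θ₀ v w := by
  rw [h.integral_fluct_mul_score [v] (by simp) (by simp), h.expectedFIM_eq]
  simp_rw [h.integral_deriv₀_hessian]

end SampleModel

/-! ### Expansion of the inverse information matrices at a zero of the score -/

theorem abs_average_le {a : ℕ → ℝ} {K : ℝ} (hK : 0 ≤ K) (n : ℕ)
    (ha : ∀ i, |a i| ≤ K) : |(n : ℝ)⁻¹ * ∑ i ∈ Finset.range n, a i| ≤ K := by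
  rcases Nat.eq_zero_or_pos n with rfl | hn
  · simpa using hK
  have hn' : (0 : ℝ) < n := Nat.cast_pos.2 hn
  rw [abs_mul, abs_of_pos (inv_pos.2 hn'), inv_mul_le_iff₀ hn']
  refine (Finset.abs_sum_le_sum_abs _ _).trans ((Finset.sum_le_sum fun i _ => ha i).trans ?_)
  simp

theorem abs_average_le_average {a a' : ℕ → ℝ} (n : ℕ) (h : ∀ i, |a i| ≤ a' i) :
    |(n : ℝ)⁻¹ * ∑ i ∈ Finset.range n, a i| ≤ (n : ℝ)⁻¹ * ∑ i ∈ Finset.range n, a' i := by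
  rw [abs_mul, abs_of_nonneg (by positivity : (0 : ℝ) ≤ (n : ℝ)⁻¹)]
  exact mul_le_mul_of_nonneg_left
    ((Finset.abs_sum_le_sum_abs _ _).trans (Finset.sum_le_sum fun i _ => h i)) (by positivity)

namespace SmoothDensity

variable {U : Set (Param p)} {f : Param p → ℝ} {m b : ℝ}

theorem abs_foldr_sub_le (h : SmoothDensity U f m b) (hU : IsOpen U) (hUc : Convex ℝ U)
    (hm : 0 ≤ m) (l : List (Fin p)) (hl : l.length ≤ 2) {θ θ₁ : Param p} (hθ : θ ∈ U)
    (hθ₁ : θ₁ ∈ U) :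
    |l.foldr partialD (fun θ => -Real.log (f θ)) θ - l.foldr partialD (fun θ => -Real.log (f θ)) θ₁
      - ∑ r, (θ r - θ₁ r) * (r :: l).foldr partialD (fun θ => -Real.log (f θ)) θ₁| ≤
      p ^ 2 * m * ‖θ - θ₁‖ ^ 2 :=
  abs_sub_sub_sum_partialD_le hU hUc
    (contDiffOn_foldr_partialD hU (n := 4) h.contDiffOn_neg_log l (m := 2) (by omega)) hm
    (fun θ hθ r s => h.bound (r :: s :: l) (by simp) (by simp; omega) θ hθ) hθ hθ₁

end SmoothDensity

/-- Samples whose likelihood is regular in the parameter. -/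
structure GoodSample (f : ℕ → 𝒳 → Param p → ℝ) (Θ : Set (Param p)) (θ₀ : Param p) (ρ : ℝ)
    (M b : ℕ → 𝒳 → ℝ) (x : ℕ → 𝒳) : Prop where
  density : ∀ i, SmoothDensity (Metric.ball θ₀ ρ) (f i (x i)) (M i (x i)) (b i (x i))
  nonneg : ∀ i, 0 ≤ M i (x i)
  pos : ∀ i, ∀ θ ∈ Θ, 0 < f i (x i) θ
  lipschitz : ∀ i, ∀ θ ∈ Θ, ∀ θ' ∈ Θ,
    |negLogLikOne f i (x i) θ - negLogLikOne f i (x i) θ'| ≤ M i (x i) * ‖θ - θ'‖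

namespace GoodSample

variable {f : ℕ → 𝒳 → Param p → ℝ} {Θ : Set (Param p)} {θ₀ : Param p} {ρ : ℝ}
  {M b : ℕ → 𝒳 → ℝ} {x : ℕ → 𝒳}

theorem differentiableAt_nllDeriv (h : GoodSample f Θ θ₀ ρ M b x) (l : List (Fin p))
    (hl : l.length ≤ 3) (i : ℕ) {θ : Param p} (hθ : θ ∈ Metric.ball θ₀ ρ) :
    DifferentiableAt ℝ (nllDeriv (f i) l (x i)) θ := by
  have hc : ContDiffOn ℝ (1 : ℕ) (nllDeriv (f i) l (x i)) (Metric.ball θ₀ ρ) :=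
    contDiffOn_foldr_partialD Metric.isOpen_ball (n := 4) (h.density i).contDiffOn_neg_log l
      (by omega)
  exact hc.differentiableAt_of_isOpen Metric.isOpen_ball (by norm_num) hθ

theorem partialD_negLogLik (h : GoodSample f Θ θ₀ ρ M b x) (n : ℕ) (w : Fin p) {θ : Param p}
    (hθ : θ ∈ Metric.ball θ₀ ρ) :
    partialD w (negLogLik f n x) θ = ∑ i ∈ Finset.range n, nllDeriv (f i) [w] (x i) θ :=
  partialD_finsetSum (g := fun i => nllDeriv (f i) [] (x i))
    (fun i _ => h.differentiableAt_nllDeriv [] (by simp) i hθ) w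

theorem partialD_partialD_negLogLik (h : GoodSample f Θ θ₀ ρ M b x) (n : ℕ) (t u : Fin p)
    {θ : Param p} (hθ : θ ∈ Metric.ball θ₀ ρ) :
    partialD t (partialD u (negLogLik f n x)) θ =
      ∑ i ∈ Finset.range n, nllDeriv (f i) [t, u] (x i) θ := by
  rw [partialD_congr_of_eqOn Metric.isOpen_ball (fun y hy => h.partialD_negLogLik n u hy) t hθ]
  exact partialD_finsetSum (g := fun i => nllDeriv (f i) [u] (x i))
    (fun i _ => h.differentiableAt_nllDeriv [u] (by simp) i hθ) t

/-- Taylor expansion of averages of derivatives of the negative log-likelihood. -/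
theorem abs_average_sub_le (h : GoodSample f Θ θ₀ ρ M b x) (hρ : 0 < ρ) (n : ℕ)
    (l : List (Fin p)) (hl : l.length ≤ 2) {θ : Param p} (hθ : θ ∈ Metric.ball θ₀ ρ) :
    |(n : ℝ)⁻¹ * ∑ i ∈ Finset.range n, nllDeriv (f i) l (x i) θ
      - (n : ℝ)⁻¹ * ∑ i ∈ Finset.range n, nllDeriv (f i) l (x i) θ₀
      - ∑ r, (θ - θ₀) r * ((n : ℝ)⁻¹ * ∑ i ∈ Finset.range n, nllDeriv (f i) (r :: l) (x i) θ₀)| ≤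
      p ^ 2 * ((n : ℝ)⁻¹ * ∑ i ∈ Finset.range n, M i (x i)) * ‖θ - θ₀‖ ^ 2 := by
  have hbase := abs_average_le_average (a' := fun i => p ^ 2 * M i (x i) * ‖θ - θ₀‖ ^ 2) n fun i =>
    (h.density i).abs_foldr_sub_le Metric.isOpen_ball (convex_ball _ _) (h.nonneg i) l hl hθ
      (Metric.mem_ball_self hρ)
  have e1 : p ^ 2 * ((n : ℝ)⁻¹ * ∑ i ∈ Finset.range n, M i (x i)) * ‖θ - θ₀‖ ^ 2 =
      (n : ℝ)⁻¹ * ∑ i ∈ Finset.range n, p ^ 2 * M i (x i) * ‖θ - θ₀‖ ^ 2 := by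
    rw [← Finset.sum_mul, ← Finset.mul_sum]
    ring
  rw [e1]
  refine le_trans (le_of_eq ?_) hbase
  congr 1
  rw [Finset.sum_sub_distrib, Finset.sum_sub_distrib, Finset.sum_comm, mul_sub, mul_sub,
    Finset.mul_sum (s := Finset.univ)]
  congr 1
  refine Finset.sum_congr rfl fun r _ => ?_
  rw [← Finset.mul_sum]
  simp only [PiLp.sub_apply]
  change _ = (n : ℝ)⁻¹ * ((θ r - θ₀ r) * ∑ i ∈ Finset.range n, nllDeriv (f i) (r :: l) (x i) θ₀)
  ring

end GoodSample

namespace SampleModel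

variable {P : Measure Ω} [IsProbabilityMeasure P] {ν : ℕ → Measure 𝒳}
  {f : ℕ → 𝒳 → Param p → ℝ} {Θ : Set (Param p)} {θ₀ : Param p} {X : ℕ → Ω → 𝒳} {ρ C : ℝ}
  {M b : ℕ → 𝒳 → ℝ}

theorem ae_goodSample (h : SampleModel P ν f Θ θ₀ X ρ C M b) :
    ∀ᵐ ω ∂P, GoodSample f Θ θ₀ ρ M b fun i => X i ω := by
  have h1 := ae_all_iff.2 fun i => h.ae_comp (h.model i).density
  have h2 := ae_all_iff.2 fun i => h.ae_comp (h.model i).nonneg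
  have h3 := ae_all_iff.2 fun i => h.ae_comp (h.posΘ i)
  have h4 := ae_all_iff.2 fun i => h.ae_comp (h.lipschitz i)
  filter_upwards [h1, h2, h3, h4] with ω a1 a2 a3 a4 using ⟨a1, a2, a3, a4⟩

/-- It makes the random constant in the Taylor remainders deterministic: the means contribute at
most `1 + C`, the fluctuation at most `1`. -/
theorem average_bound_le (h : SampleModel P ν f Θ θ₀ X ρ C M b) {n : ℕ} {ω : Ω}
    (hω : |fluct P (fun i ω => M i (X i ω)) n ω| ≤ 1) :
    (n : ℝ)⁻¹ * ∑ i ∈ Finset.range n, M i (X i ω) ≤ 2 + C := by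
  have h1 := (le_abs_self _).trans hω
  rw [fluct_eq] at h1
  have h2 : (n : ℝ)⁻¹ * ∑ i ∈ Finset.range n, ∫ ω, M i (X i ω) ∂P ≤ 1 + C := by
    refine (le_abs_self _).trans (abs_average_le (by linarith [h.C_nonneg]) n fun i => ?_)
    have hm := h.memLp_bound i
    refine abs_integral_le_integral_abs.trans ?_
    simpa using integral_pow_le_of_four hm.1 hm.2 (k := 1) (by norm_num)
  linarith

/-- Total fluctuation of the first three derivatives of the log-likelihood and of their bound. -/
def totalFluct (P : Measure Ω) (f : ℕ → 𝒳 → Param p → ℝ) (θ₀ : Param p) (X : ℕ → Ω → 𝒳)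
    (M : ℕ → 𝒳 → ℝ) (n : ℕ) (ω : Ω) : ℝ :=
  (∑ w, |fluct P (deriv₀ f θ₀ X [w]) n ω|) + (∑ t, ∑ u, |fluct P (deriv₀ f θ₀ X [t, u]) n ω|)
    + (∑ w, ∑ t, ∑ u, |fluct P (deriv₀ f θ₀ X [w, t, u]) n ω|)
    + |fluct P (fun i ω => M i (X i ω)) n ω|

theorem fourthMomentSmall_totalFluct (h : SampleModel P ν f Θ θ₀ X ρ C M b) :
    FourthMomentSmall P (totalFluct P f θ₀ X M) :=
  (((FourthMomentSmall.sum _ fun w _ => h.fourthMomentSmall_deriv₀ [w] (by simp) (by simp)).add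
    (FourthMomentSmall.sum _ fun t _ => FourthMomentSmall.sum _ fun u _ =>
      h.fourthMomentSmall_deriv₀ [t, u] (by simp) (by simp))).add
    (FourthMomentSmall.sum _ fun w _ => FourthMomentSmall.sum _ fun t _ =>
      FourthMomentSmall.sum _ fun u _ =>
        h.fourthMomentSmall_deriv₀ [w, t, u] (by simp) (by simp))).add h.fourthMomentSmall_bound

theorem le_totalFluct (P : Measure Ω) (f : ℕ → 𝒳 → Param p → ℝ) (θ₀ : Param p) (X : ℕ → Ω → 𝒳)
    (M : ℕ → 𝒳 → ℝ) (n : ℕ) (ω : Ω) :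
    (∀ w, |fluct P (deriv₀ f θ₀ X [w]) n ω| ≤ totalFluct P f θ₀ X M n ω) ∧
    (∀ t u, |fluct P (deriv₀ f θ₀ X [t, u]) n ω| ≤ totalFluct P f θ₀ X M n ω) ∧
    (∀ w t u, |fluct P (deriv₀ f θ₀ X [w, t, u]) n ω| ≤ totalFluct P f θ₀ X M n ω) ∧
    |fluct P (fun i ω => M i (X i ω)) n ω| ≤ totalFluct P f θ₀ X M n ω := by
  have s1 : 0 ≤ ∑ w, |fluct P (deriv₀ f θ₀ X [w]) n ω| := Finset.sum_nonneg fun _ _ => abs_nonneg _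
  have s2 : 0 ≤ ∑ t, ∑ u, |fluct P (deriv₀ f θ₀ X [t, u]) n ω| :=
    Finset.sum_nonneg fun _ _ => Finset.sum_nonneg fun _ _ => abs_nonneg _
  have s3 : 0 ≤ ∑ w, ∑ t, ∑ u, |fluct P (deriv₀ f θ₀ X [w, t, u]) n ω| :=
    Finset.sum_nonneg fun _ _ => Finset.sum_nonneg fun _ _ =>
      Finset.sum_nonneg fun _ _ => abs_nonneg _
  have s4 : 0 ≤ |fluct P (fun i ω => M i (X i ω)) n ω| := abs_nonneg _
  unfold totalFluct
  refine ⟨fun w => ?_, fun t u => ?_, fun w t u => ?_, by linarith⟩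
  · have := Finset.single_le_sum (f := fun w => |fluct P (deriv₀ f θ₀ X [w]) n ω|)
      (fun _ _ => abs_nonneg _) (Finset.mem_univ w)
    linarith
  · have a1 := Finset.single_le_sum (f := fun t => ∑ u, |fluct P (deriv₀ f θ₀ X [t, u]) n ω|)
      (fun _ _ => Finset.sum_nonneg fun _ _ => abs_nonneg _) (Finset.mem_univ t)
    have a2 := Finset.single_le_sum (f := fun u => |fluct P (deriv₀ f θ₀ X [t, u]) n ω|)
      (fun _ _ => abs_nonneg _) (Finset.mem_univ u)
    linarith
  · have a1 := Finset.single_le_sum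
      (f := fun w => ∑ t, ∑ u, |fluct P (deriv₀ f θ₀ X [w, t, u]) n ω|)
      (fun _ _ => Finset.sum_nonneg fun _ _ => Finset.sum_nonneg fun _ _ => abs_nonneg _)
      (Finset.mem_univ w)
    have a2 := Finset.single_le_sum (f := fun t => ∑ u, |fluct P (deriv₀ f θ₀ X [w, t, u]) n ω|)
      (fun _ _ => Finset.sum_nonneg fun _ _ => abs_nonneg _) (Finset.mem_univ t)
    have a3 := Finset.single_le_sum (f := fun u => |fluct P (deriv₀ f θ₀ X [w, t, u]) n ω|)
      (fun _ _ => abs_nonneg _) (Finset.mem_univ u)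
    linarith

/-- Average mean of the third derivatives. -/
def meanThird (P : Measure Ω) (f : ℕ → 𝒳 → Param p → ℝ) (θ₀ : Param p) (X : ℕ → Ω → 𝒳) (n : ℕ)
    (w t u : Fin p) : ℝ :=
  (n : ℝ)⁻¹ * ∑ i ∈ Finset.range n, ∫ ω, deriv₀ f θ₀ X [w, t, u] i ω ∂P

/-- Average covariance of second and first derivatives. -/
def crossCov (P : Measure Ω) (f : ℕ → 𝒳 → Param p → ℝ) (θ₀ : Param p) (X : ℕ → Ω → 𝒳) (n : ℕ)
    (t u w : Fin p) : ℝ :=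
  (n : ℝ)⁻¹ * ∑ i ∈ Finset.range n, ∫ ω, deriv₀ f θ₀ X [t, u] i ω * deriv₀ f θ₀ X [w] i ω ∂P

theorem abs_meanThird_le (h : SampleModel P ν f Θ θ₀ X ρ C M b) (n : ℕ) (w t u : Fin p) :
    |meanThird P f θ₀ X n w t u| ≤ 1 + C :=
  abs_average_le (by linarith [h.C_nonneg]) n
    fun i => h.abs_integral_deriv₀_le [w, t, u] (by simp) (by simp) i

theorem integrable_deriv₀_mul (h : SampleModel P ν f Θ θ₀ X ρ C M b) (t u w : Fin p) (i : ℕ) :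
    Integrable (fun ω => deriv₀ f θ₀ X [t, u] i ω * deriv₀ f θ₀ X [w] i ω) P :=
  MemLp.integrable_mul (h.memLp_deriv₀ [t, u] (by simp) (by simp) i).two_of_four
    (h.memLp_deriv₀ [w] (by simp) (by simp) i).two_of_four

theorem abs_crossCov_le (h : SampleModel P ν f Θ θ₀ X ρ C M b) (n : ℕ) (t u w : Fin p) :
    |crossCov P f θ₀ X n t u w| ≤ 1 + C := by
  refine abs_average_le (by linarith [h.C_nonneg]) n fun i => ?_
  refine abs_integral_le_integral_abs.trans ?_
  have hm := h.memLp_bound i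
  calc ∫ ω, |deriv₀ f θ₀ X [t, u] i ω * deriv₀ f θ₀ X [w] i ω| ∂P
      ≤ ∫ ω, |M i (X i ω)| ^ 2 ∂P := by
        refine integral_mono_ae (h.integrable_deriv₀_mul t u w i).abs
          (hm.1.integrable_abs_pow_of_four (by norm_num)) ?_
        filter_upwards [h.ae_goodSample] with ω hω
        have h1 : |deriv₀ f θ₀ X [t, u] i ω| ≤ M i (X i ω) :=
          (hω.density i).bound [t, u] (by simp) (by simp) θ₀ h.mem_ball
        have h2 : |deriv₀ f θ₀ X [w] i ω| ≤ M i (X i ω) :=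
          (hω.density i).bound [w] (by simp) (by simp) θ₀ h.mem_ball
        rw [abs_mul, sq, abs_of_nonneg (hω.nonneg i)]
        exact mul_le_mul h1 h2 (abs_nonneg _) (hω.nonneg i)
    _ ≤ 1 + C := integral_pow_le_of_four hm.1 hm.2 (by norm_num)

/-- Taylor expansion of the expected information. -/
theorem abs_expectedFIM_sub_le (h : SampleModel P ν f Θ θ₀ X ρ C M b) (n : ℕ) (t u : Fin p)
    {θ : Param p} (hθ : θ ∈ Metric.ball θ₀ ρ) :
    |expectedFIM ν f n θ t u - expectedFIM ν f n θ₀ t u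
      - ∑ r, (θ - θ₀) r * (meanThird P f θ₀ X n r t u - crossCov P f θ₀ X n t u r)| ≤
      p ^ 2 * (10 * C) * ‖θ - θ₀‖ ^ 2 := by
  have hF : ∀ θ ∈ Metric.ball θ₀ ρ, expectedFIM ν f n θ t u = (n : ℝ)⁻¹ * ∑ i ∈ Finset.range n,
      ∫ x, nllDeriv (f i) [t, u] x θ * f i x θ ∂(ν i) := fun θ hθ => by
    simp only [expectedFIM, Matrix.of_apply]
    congr 1
    exact Finset.sum_congr rfl fun i _ => h.integral_obsLaw_of_mem i hθ _
  -- The slope of the expected information has a second part besides the mean third derivative: the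
  -- sampling law moves with the parameter, and differentiating the density brings in minus the
  -- score.
  have hD : ∀ r i, ∫ x, (partialD r (nllDeriv (f i) [t, u] x) θ₀ -
      nllDeriv (f i) [t, u] x θ₀ * nllDeriv (f i) [r] x θ₀) * f i x θ₀ ∂(ν i) =
      ∫ ω, deriv₀ f θ₀ X [r, t, u] i ω ∂P -
        ∫ ω, deriv₀ f θ₀ X [t, u] i ω * deriv₀ f θ₀ X [r] i ω ∂P := fun r i => by
    rw [← integral_sub (h.memLp_deriv₀ [r, t, u] (by simp) (by simp) i).integrable_of_four
      (h.integrable_deriv₀_mul t u r i)]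
    exact (h.integral_comp (y := fun x => nllDeriv (f i) [r, t, u] x θ₀ -
      nllDeriv (f i) [t, u] x θ₀ * nllDeriv (f i) [r] x θ₀)
      ((h.aemeasurable_nllDeriv [r, t, u] (by simp) i).sub
        ((h.aemeasurable_nllDeriv [t, u] (by simp) i).mul
          (h.aemeasurable_nllDeriv [r] (by simp) i)))).symm
  have hbase := abs_average_le (K := p ^ 2 * (10 * C) * ‖θ - θ₀‖ ^ 2)
    (by have := h.C_nonneg; positivity) n fun i => (h.model i).abs_integral_sub_le
    ((h.model i).boundedFamily_nllDeriv [t, u] (by simp) (by simp)) hθ h.mem_ball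
  refine le_trans (le_of_eq ?_) hbase
  congr 1
  simp_rw [hD]
  rw [hF θ hθ, hF θ₀ h.mem_ball, Finset.sum_sub_distrib, Finset.sum_sub_distrib, Finset.sum_comm,
    mul_sub, mul_sub, Finset.mul_sum (s := Finset.univ)]
  congr 1
  refine Finset.sum_congr rfl fun r _ => ?_
  rw [← Finset.mul_sum, Finset.sum_sub_distrib, meanThird, crossCov]
  simp only [PiLp.sub_apply]
  ring

/-- The leading term of `θ₀ - θhat`. -/
def leadScore (P : Measure Ω) (ν : ℕ → Measure 𝒳) (f : ℕ → 𝒳 → Param p → ℝ) (θ₀ : Param p)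
    (X : ℕ → Ω → 𝒳) (r : Fin p) (n : ℕ) (ω : Ω) : ℝ :=
  ∑ w, (expectedFIM ν f n θ₀)⁻¹ r w * fluct P (deriv₀ f θ₀ X [w]) n ω

/-- The leading term of the fluctuation of the inverse observed information. -/
def leadObserved (P : Measure Ω) (ν : ℕ → Measure 𝒳) (f : ℕ → 𝒳 → Param p → ℝ) (θ₀ : Param p)
    (X : ℕ → Ω → 𝒳) (j : Fin p) (n : ℕ) (ω : Ω) : ℝ :=
  ∑ t, ∑ u, (expectedFIM ν f n θ₀)⁻¹ j t * (expectedFIM ν f n θ₀)⁻¹ j u *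
    (fluct P (deriv₀ f θ₀ X [t, u]) n ω
      - ∑ w, meanThird P f θ₀ X n w t u * leadScore P ν f θ₀ X w n ω)

/-- The leading term of the fluctuation of the inverse expected information. -/
def leadExpected (P : Measure Ω) (ν : ℕ → Measure 𝒳) (f : ℕ → 𝒳 → Param p → ℝ) (θ₀ : Param p)
    (X : ℕ → Ω → 𝒳) (j : Fin p) (n : ℕ) (ω : Ω) : ℝ :=
  ∑ t, ∑ u, (expectedFIM ν f n θ₀)⁻¹ j t * (expectedFIM ν f n θ₀)⁻¹ j u *
    (-∑ w, (meanThird P f θ₀ X n w t u - crossCov P f θ₀ X n t u w) * leadScore P ν f θ₀ X w n ω)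

end SampleModel

section Filters

/-- Working along a filter on the whole space of triples makes the constants of the asymptotic
calculus uniform in the sample and the parameter; this extracts the explicit thresholds. -/
theorem exists_forall_of_eventually_inf {β E : Type*} [PseudoMetricSpace E] {a : β → ℕ} {z : β → ℝ}
    {t : β → E} {θ₀ : E} {S : Set β} {Q : β → Prop}
    (h : ∀ᶠ x in ((comap a atTop ⊓ comap z (𝓝 0)) ⊓ comap t (𝓝 θ₀)) ⊓ 𝓟 S, Q x) :
    ∃ (N : ℕ) (η ε : ℝ), 0 < η ∧ 0 < ε ∧
      ∀ x ∈ S, N ≤ a x → |z x| < η → dist (t x) θ₀ < ε → Q x := by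
  have hb := ((((atTop_basis (α := ℕ)).comap a).inf
    ((Metric.nhds_basis_ball (x := (0 : ℝ))).comap z)).inf
    ((Metric.nhds_basis_ball (x := θ₀)).comap t)).inf_principal S
  obtain ⟨⟨⟨N, η⟩, ε⟩, ⟨⟨-, hη⟩, hε⟩, hsub⟩ := hb.eventually_iff.1 h
  refine ⟨N, η, ε, hη, hε, fun x hx hN hz ht => hsub ⟨⟨⟨hN, ?_⟩, ht⟩, hx⟩⟩
  simpa using hz

end Filters

namespace SampleModel

open Asymptotics

variable {P : Measure Ω} [IsProbabilityMeasure P] {ν : ℕ → Measure 𝒳}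
  {f : ℕ → 𝒳 → Param p → ℝ} {Θ : Set (Param p)} {θ₀ : Param p} {X : ℕ → Ω → 𝒳} {ρ C : ℝ}
  {M b : ℕ → 𝒳 → ℝ}

/-- Uniform second order expansion, at zeros of the score near `θ₀`, of the zero and of the inverse
information matrices. -/
theorem exists_expansion (h : SampleModel P ν f Θ θ₀ X ρ C M b) {F : Matrix (Fin p) (Fin p) ℝ}
    (hF : F.PosDef) (hlim : Tendsto (fun n => expectedFIM ν f n θ₀) atTop (𝓝 F)) (j : Fin p) :
    ∃ (N : ℕ) (η ε K : ℝ), 0 < η ∧ 0 < ε ∧ 0 ≤ K ∧ ∀ n, N ≤ n → ∀ ω,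
      GoodSample f Θ θ₀ ρ M b (fun i => X i ω) → totalFluct P f θ₀ X M n ω < η →
      ∀ θ, dist θ θ₀ < ε → (∀ w, partialD w (negLogLik f n fun i => X i ω) θ = 0) →
      |θ j - θ₀ j + leadScore P ν f θ₀ X j n ω| ≤ K * totalFluct P f θ₀ X M n ω ^ 2 ∧
      |(observedFIM f n (fun i => X i ω) θ)⁻¹ j j -
        ((expectedFIM ν f n θ₀)⁻¹ j j - leadObserved P ν f θ₀ X j n ω)| ≤
        K * totalFluct P f θ₀ X M n ω ^ 2 ∧
      |(expectedFIM ν f n θ)⁻¹ j j -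
        ((expectedFIM ν f n θ₀)⁻¹ j j - leadExpected P ν f θ₀ X j n ω)| ≤
        K * totalFluct P f θ₀ X M n ω ^ 2 := by
  -- The filter `𝓛` below lets `n → ∞`, `Z → 0` and `θ → θ₀` jointly, over good samples and zeros of
  -- the score. No probability enters the expansion.
  set S : Set (ℕ × Ω × Param p) := {x | GoodSample f Θ θ₀ ρ M b (fun i => X i x.2.1) ∧
    ∀ w, partialD w (negLogLik f x.1 fun i => X i x.2.1) x.2.2 = 0} with hS
  set Z : ℕ × Ω × Param p → ℝ := fun x => totalFluct P f θ₀ X M x.1 x.2.1 with hZdef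
  set 𝓛 : Filter (ℕ × Ω × Param p) := ((comap (fun x => x.1) atTop ⊓ comap Z (𝓝 0)) ⊓
    comap (fun x => x.2.2) (𝓝 θ₀)) ⊓ 𝓟 S with h𝓛
  have hZnn : ∀ x, 0 ≤ Z x := fun x => h.fourthMomentSmall_totalFluct.nonneg x.1 x.2.1
  have hn : Tendsto (fun x : ℕ × Ω × Param p => x.1) 𝓛 atTop :=
    tendsto_comap.mono_left (inf_le_left.trans (inf_le_left.trans inf_le_left))
  have hZ : Tendsto Z 𝓛 (𝓝 0) :=
    tendsto_comap.mono_left (inf_le_left.trans (inf_le_left.trans inf_le_right))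
  have hθ : Tendsto (fun x : ℕ × Ω × Param p => x.2.2) 𝓛 (𝓝 θ₀) :=
    tendsto_comap.mono_left (inf_le_left.trans inf_le_right)
  have hmemS : ∀ᶠ x in 𝓛, x ∈ S := mem_inf_of_right (mem_principal_self S)
  have hball : ∀ᶠ x : ℕ × Ω × Param p in 𝓛, x.2.2 ∈ Metric.ball θ₀ ρ :=
    hθ.eventually (Metric.ball_mem_nhds θ₀ h.pos)
  have hZ1 : ∀ᶠ x in 𝓛, Z x < 1 := hZ.eventually (gt_mem_nhds one_pos)
  set d : ℕ × Ω × Param p → Param p := fun x => x.2.2 - θ₀ with hd_def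
  have hd : Tendsto d 𝓛 (𝓝 0) := by simpa using hθ.sub_const θ₀
  set A : ℕ × Ω × Param p → Matrix (Fin p) (Fin p) ℝ := fun x => expectedFIM ν f x.1 θ₀ with hA_def
  have hA : Tendsto A 𝓛 (𝓝 F) := hlim.comp hn
  have hFu : IsUnit F.det := isUnit_iff_ne_zero.2 hF.det_pos.ne'
  have hsymm : ∀ᶠ x in 𝓛, (A x).transpose = A x :=
    Eventually.of_forall fun x => h.expectedFIM_transpose x.1
  set g : ℕ × Ω × Param p → Fin p → ℝ := fun x w => fluct P (deriv₀ f θ₀ X [w]) x.1 x.2.1 with hg_def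
  set J : ℕ × Ω × Param p → Matrix (Fin p) (Fin p) ℝ := fun x => Matrix.of fun t u =>
    (x.1 : ℝ)⁻¹ * ∑ i ∈ Finset.range x.1, deriv₀ f θ₀ X [t, u] i x.2.1 with hJ_def
  set T : Fin p → Fin p → Fin p → ℕ × Ω × Param p → ℝ := fun w t u x =>
    (x.1 : ℝ)⁻¹ * ∑ i ∈ Finset.range x.1, deriv₀ f θ₀ X [w, t, u] i x.2.1 with hT_def
  have hle := fun x : ℕ × Ω × Param p => le_totalFluct P f θ₀ X M x.1 x.2.1
  have hg : ∀ w, (fun x => g x w) =O[𝓛] Z := fun w =>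
    IsBigO.of_bound 1 (Eventually.of_forall fun x => by
      rw [one_mul, Real.norm_eq_abs, Real.norm_of_nonneg (hZnn x)]
      exact (hle x).1 w)
  have hJA : ∀ t u x, J x t u - A x t u = fluct P (deriv₀ f θ₀ X [t, u]) x.1 x.2.1 :=
    fun t u x => by
      change _ - expectedFIM ν f x.1 θ₀ t u = _
      rw [fluct_eq, h.expectedFIM_eq]
      rfl
  have hJ2 : ∀ t u, (fun x => fluct P (deriv₀ f θ₀ X [t, u]) x.1 x.2.1) =O[𝓛] Z := fun t u =>
    IsBigO.of_bound 1 (Eventually.of_forall fun x => by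
      rw [one_mul, Real.norm_eq_abs, Real.norm_of_nonneg (hZnn x)]
      exact (hle x).2.1 t u)
  have hJ : ∀ t u, (fun x => J x t u - A x t u) =O[𝓛] Z := fun t u => by
    simp_rw [hJA]
    exact hJ2 t u
  have hT : ∀ w t u, (fun x => T w t u x - meanThird P f θ₀ X x.1 w t u) =O[𝓛] Z := fun w t u =>
    IsBigO.of_bound 1 (Eventually.of_forall fun x => by
      rw [one_mul, Real.norm_eq_abs, Real.norm_of_nonneg (hZnn x), meanThird, ← fluct_eq]
      exact (hle x).2.2.1 w t u)
  have hC := h.C_nonneg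
  have hK3 : ∀ w t u, (fun x : ℕ × Ω × Param p => meanThird P f θ₀ X x.1 w t u) =O[𝓛]
      fun _ => (1 : ℝ) := fun w t u =>
    IsBigO.of_bound (1 + C) (Eventually.of_forall fun x => by
      simpa using h.abs_meanThird_le x.1 w t u)
  have hD3 : ∀ w t u, (fun x : ℕ × Ω × Param p => meanThird P f θ₀ X x.1 w t u -
      crossCov P f θ₀ X x.1 t u w) =O[𝓛] fun _ => (1 : ℝ) := fun w t u =>
    (hK3 w t u).sub (IsBigO.of_bound (1 + C) (Eventually.of_forall fun x => by
      simpa using h.abs_crossCov_le x.1 t u w))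
  have hM : ∀ᶠ x : ℕ × Ω × Param p in 𝓛,
      (x.1 : ℝ)⁻¹ * ∑ i ∈ Finset.range x.1, M i (X i x.2.1) ≤ 2 + C := by
    filter_upwards [hZ1] with x hx
    exact h.average_bound_le ((hle x).2.2.2.trans hx.le)
  have htaylor : ∀ l : List (Fin p), l.length ≤ 2 →
      (fun x : ℕ × Ω × Param p =>
        (x.1 : ℝ)⁻¹ * ∑ i ∈ Finset.range x.1, nllDeriv (f i) l (X i x.2.1) x.2.2
        - (x.1 : ℝ)⁻¹ * ∑ i ∈ Finset.range x.1, nllDeriv (f i) l (X i x.2.1) θ₀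
        - ∑ r, d x r * ((x.1 : ℝ)⁻¹ * ∑ i ∈ Finset.range x.1,
            nllDeriv (f i) (r :: l) (X i x.2.1) θ₀)) =O[𝓛] fun x => ‖d x‖ ^ 2 := fun l hl => by
    refine IsBigO.of_bound (p ^ 2 * (2 + C)) ?_
    filter_upwards [hmemS, hball, hM] with x hx hxb hxM
    rw [Real.norm_eq_abs, Real.norm_of_nonneg (by positivity)]
    refine (hx.1.abs_average_sub_le h.pos x.1 l hl hxb).trans ?_
    gcongr
  have hscore : ∀ w, (fun x => g x w + ∑ u, d x u * J x u w) =O[𝓛] fun x => ‖d x‖ ^ 2 := by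
    intro w
    -- At a zero of the score, the leading term of its Taylor expansion around `θ₀` disappears.
    refine (htaylor [w] (by simp)).neg_left.congr' ?_ EventuallyEq.rfl
    filter_upwards [hmemS, hball] with x hx hxb
    rw [← hx.1.partialD_negLogLik x.1 w hxb, hx.2 w]
    simp only [hg_def, hJ_def, h.fluct_score, Matrix.of_apply]
    ring
  obtain ⟨hdZ, hlead'⟩ := isBigO_score_solution hA hFu hZ hsymm hg hJ hd hscore
  have hlead : ∀ r, (fun x => d x r + leadScore P ν f θ₀ X r x.1 x.2.1) =O[𝓛] fun x => Z x ^ 2 :=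
    hlead'
  have hd2 : (fun x => ‖d x‖ ^ 2) =O[𝓛] fun x => Z x ^ 2 := hdZ.norm_left.pow 2
  have hdr : ∀ r, (fun x => d x r) =O[𝓛] Z := fun r =>
    (IsBigO.of_bound 1 (Eventually.of_forall fun x => by
      simpa using abs_apply_le_norm (d x) r)).trans hdZ.norm_left
  have hls : ∀ r, (fun x : ℕ × Ω × Param p => leadScore P ν f θ₀ X r x.1 x.2.1) =O[𝓛] Z := by
    intro r
    refine IsBigO.fun_sum fun w _ => ?_
    simpa using (Tendsto.isBigO_one_entry (tendsto_matrix_inv hA hFu).2 r w).mul (hg w)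
  have hobs : ∀ t u, (fun x : ℕ × Ω × Param p =>
      observedFIM f x.1 (fun i => X i x.2.1) x.2.2 t u - A x t u -
      (fluct P (deriv₀ f θ₀ X [t, u]) x.1 x.2.1 - ∑ w, meanThird P f θ₀ X x.1 w t u *
        leadScore P ν f θ₀ X w x.1 x.2.1)) =O[𝓛] fun x => Z x ^ 2 := by
    intro t u
    -- Three errors of order `Z²`: the Taylor remainder, the replacement of third derivatives by
    -- their means, which is multiplied by `d = O(Z)`, and the replacement of `d` by `-leadScore`.
    have e1 := (htaylor [t, u] (by simp)).trans hd2
    have e2 : (fun x => ∑ w, d x w * (T w t u x - meanThird P f θ₀ X x.1 w t u)) =O[𝓛]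
        fun x => Z x ^ 2 := by
      refine IsBigO.fun_sum fun w _ => ?_
      simpa [sq] using (hdr w).mul (hT w t u)
    have e3 : (fun x => ∑ w, meanThird P f θ₀ X x.1 w t u *
        (d x w + leadScore P ν f θ₀ X w x.1 x.2.1)) =O[𝓛] fun x => Z x ^ 2 := by
      refine IsBigO.fun_sum fun w _ => ?_
      simpa using (hK3 w t u).mul (hlead w)
    refine ((e1.add e2).add e3).congr' ?_ EventuallyEq.rfl
    filter_upwards [hmemS, hball] with x hx hxb
    have e4 : observedFIM f x.1 (fun i => X i x.2.1) x.2.2 t u =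
        (x.1 : ℝ)⁻¹ * ∑ i ∈ Finset.range x.1, nllDeriv (f i) [t, u] (X i x.2.1) x.2.2 := by
      simp only [observedFIM, Matrix.of_apply]
      rw [hx.1.partialD_partialD_negLogLik x.1 t u hxb]
    rw [e4, ← hJA]
    simp only [hJ_def, hT_def, Matrix.of_apply, mul_add, mul_sub, Finset.sum_add_distrib, Finset.sum_sub_distrib]
    have e5 : ∑ w, d x w * meanThird P f θ₀ X x.1 w t u =
        ∑ w, meanThird P f θ₀ X x.1 w t u * d x w :=
      Finset.sum_congr rfl fun w _ => mul_comm _ _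
    rw [e5]
    ring
  have hexp : ∀ t u, (fun x : ℕ × Ω × Param p =>
      expectedFIM ν f x.1 x.2.2 t u - A x t u -
      (-∑ w, (meanThird P f θ₀ X x.1 w t u - crossCov P f θ₀ X x.1 t u w) *
        leadScore P ν f θ₀ X w x.1 x.2.1)) =O[𝓛] fun x => Z x ^ 2 := by
    intro t u
    have e1 : (fun x : ℕ × Ω × Param p => expectedFIM ν f x.1 x.2.2 t u - A x t u -
        ∑ r, d x r * (meanThird P f θ₀ X x.1 r t u - crossCov P f θ₀ X x.1 t u r)) =O[𝓛]
        fun x => ‖d x‖ ^ 2 := by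
      refine IsBigO.of_bound (p ^ 2 * (10 * C)) ?_
      filter_upwards [hball] with x hxb
      rw [Real.norm_eq_abs, Real.norm_of_nonneg (by positivity)]
      exact h.abs_expectedFIM_sub_le x.1 t u hxb
    have e3 : (fun x => ∑ w, (meanThird P f θ₀ X x.1 w t u - crossCov P f θ₀ X x.1 t u w) *
        (d x w + leadScore P ν f θ₀ X w x.1 x.2.1)) =O[𝓛] fun x => Z x ^ 2 := by
      refine IsBigO.fun_sum fun w _ => ?_
      simpa using (hD3 w t u).mul (hlead w)
    refine ((e1.trans hd2).add e3).congr_left fun x => ?_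
    simp only [mul_add, Finset.sum_add_distrib]
    have e5 : ∑ w, d x w * (meanThird P f θ₀ X x.1 w t u - crossCov P f θ₀ X x.1 t u w) =
        ∑ w, (meanThird P f θ₀ X x.1 w t u - crossCov P f θ₀ X x.1 t u w) * d x w :=
      Finset.sum_congr rfl fun w _ => mul_comm _ _
    rw [e5]
    ring
  have hI1 := isBigO_inv_sub (M := fun x => observedFIM f x.1 (fun i => X i x.2.1) x.2.2)
    (G := fun x t u => fluct P (deriv₀ f θ₀ X [t, u]) x.1 x.2.1 - ∑ w,
      meanThird P f θ₀ X x.1 w t u * leadScore P ν f θ₀ X w x.1 x.2.1) hA hFu hZ hsymm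
    (fun t u => (hJ2 t u).sub (IsBigO.fun_sum fun w _ => by
      simpa using (hK3 w t u).mul (hls w))) hobs j
  have hI2 := isBigO_inv_sub (M := fun x => expectedFIM ν f x.1 x.2.2)
    (G := fun x t u => -∑ w, (meanThird P f θ₀ X x.1 w t u - crossCov P f θ₀ X x.1 t u w) *
      leadScore P ν f θ₀ X w x.1 x.2.1) hA hFu hZ hsymm
    (fun t u => (IsBigO.fun_sum fun w _ => by
      simpa using (hD3 w t u).mul (hls w)).neg_left) hexp j
  obtain ⟨K1, hK1⟩ := (hlead j).bound
  obtain ⟨K2, hK2⟩ := hI1.bound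
  obtain ⟨K4, hK4⟩ := hI2.bound
  obtain ⟨N, η, ε, hη, hε, hmain⟩ := exists_forall_of_eventually_inf ((hK1.and hK2).and hK4)
  refine ⟨N, η, ε, max (max K1 K2) (max K4 0), hη, hε,
    (le_max_right _ _).trans (le_max_right _ _), ?_⟩
  intro n hnN ω hω hZη θ hdist hzero
  have hz0 := hZnn (n, ω, θ)
  obtain ⟨⟨b1, b2⟩, b3⟩ := hmain (n, ω, θ) ⟨hω, hzero⟩ hnN (by rwa [abs_of_nonneg hz0]) hdist
  have hsq : 0 ≤ totalFluct P f θ₀ X M n ω ^ 2 := sq_nonneg _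
  simp only [Real.norm_eq_abs, hZdef, abs_of_nonneg hsq] at b1 b2 b3
  refine ⟨b1.trans ?_, b2.trans ?_, b3.trans ?_⟩
  · exact mul_le_mul_of_nonneg_right ((le_max_left _ _).trans (le_max_left _ _)) hsq
  · exact mul_le_mul_of_nonneg_right ((le_max_right _ _).trans (le_max_left _ _)) hsq
  · exact mul_le_mul_of_nonneg_right ((le_max_left _ _).trans (le_max_right _ _)) hsq

end SampleModel

/-! ### Consistency of the maximum likelihood estimator with polynomial rate -/

namespace SampleModel

open Asymptotics

variable {P : Measure Ω} [IsProbabilityMeasure P] {ν : ℕ → Measure 𝒳}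
  {f : ℕ → 𝒳 → Param p → ℝ} {Θ : Set (Param p)} {θ₀ : Param p} {X : ℕ → Ω → 𝒳} {ρ C : ℝ}
  {M b : ℕ → 𝒳 → ℝ}

/-- If the fluctuations at finitely many parameters are small then the likelihood at `θ₀` exceeds
the likelihood away from `θ₀`. -/
theorem exists_separation (h : SampleModel P ν f Θ θ₀ X ρ C M b) (hreg : RegularModel ν f Θ θ₀)
    {ε : ℝ} (hε : 0 < ε) :
    ∃ (s : Finset (Param p)) (N : ℕ) (η : ℝ), 0 < η ∧ (∀ t ∈ s, t ∈ Θ) ∧ ∀ n, N ≤ n → ∀ ω,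
      GoodSample f Θ θ₀ ρ M b (fun i => X i ω) → |fluct P (fun i ω => M i (X i ω)) n ω| < η →
      (∀ t ∈ s, |fluct P (fun i ω => negLogLikOne f i (X i ω) t - negLogLikOne f i (X i ω) θ₀) n ω|
        < η) →
      ∀ θ ∈ Θ, ε ≤ ‖θ - θ₀‖ →
        negLogLik f n (fun i => X i ω) θ₀ < negLogLik f n (fun i => X i ω) θ := by
  obtain ⟨η₀, hη₀, hid⟩ := hreg.identifiable ε hε
  have hC := h.C_nonneg
  -- Moving to the nearest net point costs at most `(2 + C) * r = η₀ / 4`, and the fluctuation at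
  -- that point another `η₀ / 4`, out of a divergence of at least `η₀`.
  set r := η₀ / (4 * (2 + C)) with hr
  have hrpos : 0 < r := by positivity
  have hcomp : IsCompact (Θ \ Metric.ball θ₀ ε) := hreg.isCompact.diff Metric.isOpen_ball
  obtain ⟨t, htsub, htfin, hcover⟩ := hcomp.finite_cover_balls hrpos
  obtain ⟨N, hN⟩ := eventually_atTop.1 (hid.and (eventually_gt_atTop 0))
  have hts : ∀ y ∈ htfin.toFinset, y ∈ Θ ∧ ε ≤ ‖y - θ₀‖ := by
    intro y hy
    have hy' := htsub (htfin.mem_toFinset.1 hy)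
    refine ⟨hy'.1, ?_⟩
    have := hy'.2
    rwa [Metric.mem_ball, not_lt, dist_eq_norm] at this
  refine ⟨htfin.toFinset, N, min 1 (η₀ / 4), by positivity, fun y hy => (hts y hy).1, ?_⟩
  intro n hn ω hω hM hnet θ hθ hθε
  obtain ⟨hidn, hn0⟩ := hN n hn
  have hn0' : (0 : ℝ) < n := Nat.cast_pos.2 hn0
  have hmem : θ ∈ Θ \ Metric.ball θ₀ ε := ⟨hθ, by rwa [Metric.mem_ball, not_lt, dist_eq_norm]⟩
  obtain ⟨y, hyt, hy⟩ := Set.mem_iUnion₂.1 (hcover hmem)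
  have hys : y ∈ htfin.toFinset := htfin.mem_toFinset.2 hyt
  have hyr : ‖θ - y‖ < r := by rwa [Metric.mem_ball, dist_eq_norm] at hy
  have hyΘ := (hts y hys).1
  have hKL := hidn y hyΘ (hts y hys).2
  have havg := h.average_bound_le (hM.le.trans (min_le_left _ _))
  have h1 : |(n : ℝ)⁻¹ * ∑ i ∈ Finset.range n,
      (negLogLikOne f i (X i ω) θ - negLogLikOne f i (X i ω) y)| ≤ (2 + C) * r := by
    refine (abs_average_le_average (a' := fun i => M i (X i ω) * ‖θ - y‖) n
      fun i => hω.lipschitz i θ hθ y hyΘ).trans ?_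
    rw [← Finset.sum_mul, ← mul_assoc]
    have : 0 ≤ (n : ℝ)⁻¹ * ∑ i ∈ Finset.range n, M i (X i ω) :=
      mul_nonneg (by positivity) (Finset.sum_nonneg fun i _ => hω.nonneg i)
    exact mul_le_mul havg hyr.le (norm_nonneg _) (by positivity)
  have h2 := (hnet y hys).trans_le (min_le_right _ _)
  rw [fluct_eq] at h2
  have h3 : ∀ i, ∫ ω', (negLogLikOne f i (X i ω') y - negLogLikOne f i (X i ω') θ₀) ∂P =
      ∫ x, (negLogLikOne f i x y - negLogLikOne f i x θ₀) ∂(obsLaw ν f i θ₀) := fun i =>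
    h.integral_comp_eq_obsLaw (h.aemeasurable_negLogLikOne_sub hyΘ i)
  simp_rw [h3] at h2
  have h4 : (2 + C) * r = η₀ / 4 := by rw [hr]; field_simp
  rw [h4] at h1
  have e : (n : ℝ)⁻¹ * (negLogLik f n (fun i => X i ω) θ - negLogLik f n (fun i => X i ω) θ₀) =
      (n : ℝ)⁻¹ * ∑ i ∈ Finset.range n,
        (negLogLikOne f i (X i ω) θ - negLogLikOne f i (X i ω) y) +
      (n : ℝ)⁻¹ * ∑ i ∈ Finset.range n,
        (negLogLikOne f i (X i ω) y - negLogLikOne f i (X i ω) θ₀) := by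
    rw [← mul_add, ← Finset.sum_add_distrib]
    simp [negLogLik, Finset.sum_sub_distrib]
  have hpos : 0 < (n : ℝ)⁻¹ *
      (negLogLik f n (fun i => X i ω) θ - negLogLik f n (fun i => X i ω) θ₀) := by
    rw [e]
    have := (abs_le.1 h1).1
    have := (abs_lt.1 h2).1
    linarith
  have := pos_of_mul_pos_right hpos (by positivity)
  linarith

theorem _root_.GoodSample.isMinOn_negLogLik {x : ℕ → 𝒳} (hx : GoodSample f Θ θ₀ ρ M b x) {n : ℕ}
    {θ : Param p} (hθ : θ ∈ Θ)
    (hmax : IsMaxOn (fun θ => ∏ i ∈ Finset.range n, f i (x i) θ) Θ θ) :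
    IsMinOn (negLogLik f n x) Θ θ := by
  intro θ' hθ'
  have e : ∀ θ ∈ Θ, negLogLik f n x θ = -Real.log (∏ i ∈ Finset.range n, f i (x i) θ) := by
    intro θ hθ
    rw [Real.log_prod fun i _ => (hx.pos i θ hθ).ne']
    simp [negLogLik, negLogLikOne]
  simp only [Set.mem_ofPred_eq]
  rw [e θ hθ, e θ' hθ', neg_le_neg_iff]
  exact Real.log_le_log (Finset.prod_pos fun i _ => hx.pos i θ' hθ') (hmax hθ')

/-- The leading terms are linear in the fluctuations, with coefficients bounded for large `n`. No
smallness of the fluctuations is assumed, so the bounds remain available where the expansion fails.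
-/
theorem exists_lead_bounds (h : SampleModel P ν f Θ θ₀ X ρ C M b) {F : Matrix (Fin p) (Fin p) ℝ}
    (hF : F.PosDef) (hlim : Tendsto (fun n => expectedFIM ν f n θ₀) atTop (𝓝 F)) (j : Fin p) :
    ∃ (N : ℕ) (K : ℝ), 0 ≤ K ∧ ∀ n, N ≤ n → ∀ ω,
      |leadScore P ν f θ₀ X j n ω| ≤ K * totalFluct P f θ₀ X M n ω ∧
      |leadObserved P ν f θ₀ X j n ω| ≤ K * totalFluct P f θ₀ X M n ω ∧
      |leadExpected P ν f θ₀ X j n ω| ≤ K * totalFluct P f θ₀ X M n ω := by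
  set Z : ℕ × Ω → ℝ := fun x => totalFluct P f θ₀ X M x.1 x.2 with hZdef
  set 𝓛 : Filter (ℕ × Ω) := comap Prod.fst atTop with h𝓛
  have hZnn : ∀ x, 0 ≤ Z x := fun x => h.fourthMomentSmall_totalFluct.nonneg x.1 x.2
  have hFu : IsUnit F.det := isUnit_iff_ne_zero.2 hF.det_pos.ne'
  have hB : ∀ r w, (fun x : ℕ × Ω => (expectedFIM ν f x.1 θ₀)⁻¹ r w) =O[𝓛] fun _ => (1 : ℝ) :=
    Tendsto.isBigO_one_entry (tendsto_matrix_inv (hlim.comp tendsto_comap) hFu).2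
  have hle := fun x : ℕ × Ω => le_totalFluct P f θ₀ X M x.1 x.2
  have hC := h.C_nonneg
  have hls : ∀ r, (fun x : ℕ × Ω => leadScore P ν f θ₀ X r x.1 x.2) =O[𝓛] Z := fun r => by
    refine IsBigO.fun_sum fun w _ => ?_
    have hg : (fun x : ℕ × Ω => fluct P (deriv₀ f θ₀ X [w]) x.1 x.2) =O[𝓛] Z :=
      IsBigO.of_bound 1 (Eventually.of_forall fun x => by
        rw [one_mul, Real.norm_eq_abs, Real.norm_of_nonneg (hZnn x)]
        exact (hle x).1 w)
    simpa using (hB r w).mul hg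
  have hJ2 : ∀ t u, (fun x : ℕ × Ω => fluct P (deriv₀ f θ₀ X [t, u]) x.1 x.2) =O[𝓛] Z := fun t u =>
    IsBigO.of_bound 1 (Eventually.of_forall fun x => by
      rw [one_mul, Real.norm_eq_abs, Real.norm_of_nonneg (hZnn x)]
      exact (hle x).2.1 t u)
  have hK3 : ∀ w t u, (fun x : ℕ × Ω => meanThird P f θ₀ X x.1 w t u) =O[𝓛]
      fun _ => (1 : ℝ) := fun w t u =>
    IsBigO.of_bound (1 + C) (Eventually.of_forall fun x => by
      simpa using h.abs_meanThird_le x.1 w t u)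
  have hD3 : ∀ w t u, (fun x : ℕ × Ω => meanThird P f θ₀ X x.1 w t u -
      crossCov P f θ₀ X x.1 t u w) =O[𝓛] fun _ => (1 : ℝ) := fun w t u =>
    (hK3 w t u).sub (IsBigO.of_bound (1 + C) (Eventually.of_forall fun x => by
      simpa using h.abs_crossCov_le x.1 t u w))
  have hobs : (fun x : ℕ × Ω => leadObserved P ν f θ₀ X j x.1 x.2) =O[𝓛] Z := by
    refine IsBigO.fun_sum fun t _ => IsBigO.fun_sum fun u _ => ?_
    have h1 := (hJ2 t u).sub (IsBigO.fun_sum fun w (_ : w ∈ Finset.univ) =>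
      (hK3 w t u).mul (hls w) |>.congr_right fun x => one_mul _)
    simpa using ((hB j t).mul (hB j u)).mul h1
  have hexp : (fun x : ℕ × Ω => leadExpected P ν f θ₀ X j x.1 x.2) =O[𝓛] Z := by
    refine IsBigO.fun_sum fun t _ => IsBigO.fun_sum fun u _ => ?_
    have h1 := (IsBigO.fun_sum fun w (_ : w ∈ Finset.univ) =>
      (hD3 w t u).mul (hls w) |>.congr_right fun x => one_mul _).neg_left
    simpa using ((hB j t).mul (hB j u)).mul h1
  obtain ⟨K1, hK1⟩ := (hls j).bound
  obtain ⟨K2, hK2⟩ := hobs.bound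
  obtain ⟨K4, hK4⟩ := hexp.bound
  obtain ⟨N, -, hN⟩ := ((atTop_basis (α := ℕ)).comap _).eventually_iff.1 ((hK1.and hK2).and hK4)
  refine ⟨N, max (max K1 K2) (max K4 0), (le_max_right _ _).trans (le_max_right _ _), ?_⟩
  intro n hn ω
  have hz0 := hZnn (n, ω)
  obtain ⟨⟨b1, b2⟩, b3⟩ := hN (x := (n, ω)) hn
  simp only [Real.norm_eq_abs, abs_of_nonneg hz0] at b1 b2 b3
  refine ⟨b1.trans ?_, b2.trans ?_, b3.trans ?_⟩
  · exact mul_le_mul_of_nonneg_right ((le_max_left _ _).trans (le_max_left _ _)) hz0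
  · exact mul_le_mul_of_nonneg_right ((le_max_right _ _).trans (le_max_left _ _)) hz0
  · exact mul_le_mul_of_nonneg_right ((le_max_left _ _).trans (le_max_right _ _)) hz0

/-- Second order expansion of the maximum likelihood estimator and of the inverse information
matrices, with a remainder controlled by a variable with small fourth moments. -/
theorem exists_mle_expansion (h : SampleModel P ν f Θ θ₀ X ρ C M b) (hreg : RegularModel ν f Θ θ₀)
    {F : Matrix (Fin p) (Fin p) ℝ} (hF : F.PosDef)
    (hlim : Tendsto (fun n => expectedFIM ν f n θ₀) atTop (𝓝 F))
    {θhat : ℕ → Ω → Param p} (hmle : IsMLE P f Θ X θhat) (j : Fin p) :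
    ∃ (Z : ℕ → Ω → ℝ) (N : ℕ) (η K : ℝ), FourthMomentSmall P Z ∧ 0 < η ∧ 0 ≤ K ∧
      ∀ n, N ≤ n → ∀ᵐ ω ∂P,
        (Real.sqrt n)⁻¹ ≤ Z n ω ∧
        |leadScore P ν f θ₀ X j n ω| ≤ K * Z n ω ∧
        |leadObserved P ν f θ₀ X j n ω| ≤ K * Z n ω ∧
        |leadExpected P ν f θ₀ X j n ω| ≤ K * Z n ω ∧
        |θhat n ω j - θ₀ j + leadScore P ν f θ₀ X j n ω| ≤ K * Z n ω ^ 2 ∧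
        (Z n ω < η →
          |(observedFIM f n (fun i => X i ω) (θhat n ω))⁻¹ j j -
            ((expectedFIM ν f n θ₀)⁻¹ j j - leadObserved P ν f θ₀ X j n ω)| ≤ K * Z n ω ^ 2 ∧
          |(expectedFIM ν f n (θhat n ω))⁻¹ j j -
            ((expectedFIM ν f n θ₀)⁻¹ j j - leadExpected P ν f θ₀ X j n ω)| ≤ K * Z n ω ^ 2) := by
  obtain ⟨N₁, η₁, ε₁, K₁, hη₁, hε₁, hK₁, hexp⟩ := h.exists_expansion hF hlim j
  -- Closeness `ε₁` is what the expansion asks for, and `ρ` puts the maximizer in a ball contained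
  -- in `Θ`.
  obtain ⟨s, N₂, η₂, hη₂, hsΘ, hsep⟩ := h.exists_separation hreg (lt_min hε₁ h.pos)
  obtain ⟨N₃, K₃, hK₃, hlead⟩ := h.exists_lead_bounds hF hlim j
  obtain ⟨R, hR⟩ := hreg.isCompact.isBounded.subset_closedBall θ₀
  have hR0 : 0 ≤ R := by
    have := hR (h.ball_subset h.mem_ball)
    simpa using this
  set Z₁ := totalFluct P f θ₀ X M with hZ₁
  have hZ₁s : FourthMomentSmall P Z₁ := h.fourthMomentSmall_totalFluct
  set Zs : ℕ → Ω → ℝ := fun n ω => ∑ t ∈ s,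
    |fluct P (fun i ω => negLogLikOne f i (X i ω) t - negLogLikOne f i (X i ω) θ₀) n ω| with hZs
  have hZss : FourthMomentSmall P Zs :=
    FourthMomentSmall.sum s fun t ht => h.fourthMomentSmall_negLogLikOne_sub (hsΘ t ht)
  set Z : ℕ → Ω → ℝ := fun n ω => Z₁ n ω + Zs n ω + (Real.sqrt n)⁻¹ with hZ
  have hZsmall : FourthMomentSmall P Z := (hZ₁s.add hZss).add FourthMomentSmall.inv_sqrt
  set η := min η₁ η₂ with hη
  have hηpos : 0 < η := lt_min hη₁ hη₂
  -- The last bracket covers `Z ≥ η`: there `|θhat - θ₀| ≤ R` by compactness and `leadScore` is at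
  -- most `K₃ * Z`, and factors of `Z / η ≥ 1` raise both to order `Z²`. The inverse information
  -- matrices have no such bound, so their expansion is claimed only for `Z < η`.
  set K := K₁ + K₃ + (R / η ^ 2 + K₃ / η) with hK
  have hK' : 0 ≤ R / η ^ 2 + K₃ / η := by positivity
  refine ⟨Z, max N₁ (max N₂ N₃), η, K, hZsmall, hηpos, by positivity, ?_⟩
  intro n hn
  have hn1 : N₁ ≤ n := (le_max_left _ _).trans hn
  have hn2 : N₂ ≤ n := (le_max_left _ _).trans ((le_max_right _ _).trans hn)
  have hn3 : N₃ ≤ n := (le_max_right _ _).trans ((le_max_right _ _).trans hn)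
  filter_upwards [h.ae_goodSample, (hmle n).2] with ω hω hmle
  obtain ⟨hmem, hmax⟩ := hmle
  have z1 : 0 ≤ Z₁ n ω := hZ₁s.nonneg n ω
  have z2 : 0 ≤ Zs n ω := hZss.nonneg n ω
  have z3 : 0 ≤ (Real.sqrt n)⁻¹ := by positivity
  have z4 : Z₁ n ω ≤ Z n ω := by simp only [hZ]; linarith
  have z5 : Zs n ω ≤ Z n ω := by simp only [hZ]; linarith
  have z0 : 0 ≤ Z n ω := z1.trans z4
  have hK3K : K₃ ≤ K := by rw [hK]; linarith
  have hK1K : K₁ ≤ K := by rw [hK]; linarith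
  have hlin : ∀ y : ℝ, y ≤ K₃ * Z₁ n ω → y ≤ K * Z n ω := fun y hy =>
    hy.trans (mul_le_mul hK3K z4 z1 (hK₃.trans hK3K))
  have hquad : ∀ y : ℝ, y ≤ K₁ * Z₁ n ω ^ 2 → y ≤ K * Z n ω ^ 2 := fun y hy =>
    hy.trans (mul_le_mul hK1K (pow_le_pow_left₀ z1 z4 2) (sq_nonneg _) (hK₁.trans hK1K))
  obtain ⟨l1, l2, l3⟩ := hlead n hn3 ω
  have hgood : Z n ω < η →
      |θhat n ω j - θ₀ j + leadScore P ν f θ₀ X j n ω| ≤ K * Z n ω ^ 2 ∧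
      |(observedFIM f n (fun i => X i ω) (θhat n ω))⁻¹ j j -
        ((expectedFIM ν f n θ₀)⁻¹ j j - leadObserved P ν f θ₀ X j n ω)| ≤ K * Z n ω ^ 2 ∧
      |(expectedFIM ν f n (θhat n ω))⁻¹ j j -
        ((expectedFIM ν f n θ₀)⁻¹ j j - leadExpected P ν f θ₀ X j n ω)| ≤ K * Z n ω ^ 2 := by
    intro hlt
    have hmin := hω.isMinOn_negLogLik hmem hmax
    have hdist : dist (θhat n ω) θ₀ < min ε₁ ρ := by
      by_contra hcon
      rw [not_lt, dist_eq_norm] at hcon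
      have hlt' := hsep n hn2 ω hω
        (((le_totalFluct P f θ₀ X M n ω).2.2.2.trans z4).trans_lt (hlt.trans_le (min_le_right _ _)))
        (fun t ht => (((Finset.single_le_sum (f := fun t => |fluct P (fun i ω =>
          negLogLikOne f i (X i ω) t - negLogLikOne f i (X i ω) θ₀) n ω|)
          (fun _ _ => abs_nonneg _) ht).trans z5).trans_lt (hlt.trans_le (min_le_right _ _))))
        (θhat n ω) hmem hcon
      exact absurd (hmin (h.ball_subset h.mem_ball)) (not_le.2 hlt')
    -- With a neighbourhood inside `Θ`, the minimizer is a local one and the score vanishes there.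
    have hnhds : Θ ∈ 𝓝 (θhat n ω) :=
      mem_of_superset (Metric.isOpen_ball.mem_nhds (hdist.trans_le (min_le_right _ _)))
        h.ball_subset
    have hzero : ∀ w, partialD w (negLogLik f n fun i => X i ω) (θhat n ω) = 0 := fun w => by
      rw [partialD, (hmin.isLocalMin hnhds).fderiv_eq_zero]
      rfl
    obtain ⟨q1, q2, q3⟩ := hexp n hn1 ω hω (z4.trans_lt (hlt.trans_le (min_le_left _ _)))
      (θhat n ω) (hdist.trans_le (min_le_left _ _)) hzero
    exact ⟨hquad _ q1, hquad _ q2, hquad _ q3⟩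
  refine ⟨?_, hlin _ l1, hlin _ l2, hlin _ l3, ?_, fun hlt => (hgood hlt).2⟩
  · simp only [hZ]
    linarith
  · rcases lt_or_ge (Z n ω) η with hlt | hge
    · exact (hgood hlt).1
    · have hd : |θhat n ω j - θ₀ j| ≤ R := by
        have h1 := abs_apply_le_norm (θhat n ω - θ₀) j
        have h2 := hR hmem
        rw [Metric.mem_closedBall, dist_eq_norm] at h2
        exact h1.trans h2
      have q1 : 1 ≤ Z n ω / η := (one_le_div hηpos).2 hge
      have q2 : 1 ≤ (Z n ω / η) ^ 2 := one_le_pow₀ q1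
      have q3 : R ≤ R / η ^ 2 * Z n ω ^ 2 := by
        calc R = R * 1 := (mul_one R).symm
          _ ≤ R * (Z n ω / η) ^ 2 := by gcongr
          _ = R / η ^ 2 * Z n ω ^ 2 := by field_simp
      have q4 : K₃ * Z₁ n ω ≤ K₃ / η * Z n ω ^ 2 := by
        calc K₃ * Z₁ n ω ≤ K₃ * Z n ω * 1 := by rw [mul_one]; gcongr
          _ ≤ K₃ * Z n ω * (Z n ω / η) := by gcongr
          _ = K₃ / η * Z n ω ^ 2 := by field_simp
      refine (abs_add_le _ _).trans ?_
      have q5 : 0 ≤ (K₁ + K₃) * Z n ω ^ 2 := by positivity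
      rw [hK, add_mul, add_mul (R / η ^ 2)]
      linarith

end SampleModel

/-! ### Second moments of the leading terms -/

namespace SampleModel

variable {P : Measure Ω} [IsProbabilityMeasure P] {ν : ℕ → Measure 𝒳}
  {f : ℕ → 𝒳 → Param p → ℝ} {Θ : Set (Param p)} {θ₀ : Param p} {X : ℕ → Ω → 𝒳} {ρ C : ℝ}
  {M b : ℕ → 𝒳 → ℝ}

theorem memLp_fluct_deriv₀ (h : SampleModel P ν f Θ θ₀ X ρ C M b) (l : List (Fin p))
    (hl1 : 1 ≤ l.length) (hl : l.length ≤ 4) (n : ℕ) :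
    MemLp (fluct P (deriv₀ f θ₀ X l) n) 4 P :=
  memLp_fluct (h.memLp_deriv₀ l hl1 hl) n

theorem integral_fluct_deriv₀ (h : SampleModel P ν f Θ θ₀ X ρ C M b) (l : List (Fin p))
    (hl1 : 1 ≤ l.length) (hl : l.length ≤ 4) (n : ℕ) :
    ∫ ω, fluct P (deriv₀ f θ₀ X l) n ω ∂P = 0 :=
  integral_fluct (h.memLp_deriv₀ l hl1 hl) n

theorem memLp_leadScore (h : SampleModel P ν f Θ θ₀ X ρ C M b) (r : Fin p) (n : ℕ) :
    MemLp (leadScore P ν f θ₀ X r n) 4 P :=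
  memLp_finsetSum _ fun w _ => (h.memLp_fluct_deriv₀ [w] (by simp) (by simp) n).const_mul _

theorem integral_leadScore (h : SampleModel P ν f Θ θ₀ X ρ C M b) (r : Fin p) (n : ℕ) :
    ∫ ω, leadScore P ν f θ₀ X r n ω ∂P = 0 := by
  unfold leadScore
  rw [integral_finsetSum _ fun w _ =>
    (h.memLp_fluct_deriv₀ [w] (by simp) (by simp) n).integrable_of_four.const_mul _]
  refine Finset.sum_eq_zero fun w _ => ?_
  rw [integral_const_mul, h.integral_fluct_deriv₀ [w] (by simp) (by simp), mul_zero]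

theorem memLp_leadExpected (h : SampleModel P ν f Θ θ₀ X ρ C M b) (j : Fin p) (n : ℕ) :
    MemLp (leadExpected P ν f θ₀ X j n) 4 P :=
  memLp_finsetSum _ fun _ _ => memLp_finsetSum _ fun _ _ =>
    ((memLp_finsetSum _ fun w _ => (h.memLp_leadScore w n).const_mul _).neg).const_mul _

theorem memLp_leadObserved (h : SampleModel P ν f Θ θ₀ X ρ C M b) (j : Fin p) (n : ℕ) :
    MemLp (leadObserved P ν f θ₀ X j n) 4 P :=
  memLp_finsetSum _ fun t _ => memLp_finsetSum _ fun u _ =>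
    ((h.memLp_fluct_deriv₀ [t, u] (by simp) (by simp) n).sub
      (memLp_finsetSum _ fun w _ => (h.memLp_leadScore w n).const_mul _)).const_mul _

/-- Written as a combination of the components of `leadScore`, the term is visibly centred and
orthogonal to whatever is uncorrelated with the score. -/
theorem leadExpected_eq (j : Fin p) (n : ℕ) (ω : Ω) :
    leadExpected P ν f θ₀ X j n ω = ∑ w, (-∑ t, ∑ u, (expectedFIM ν f n θ₀)⁻¹ j t *
      (expectedFIM ν f n θ₀)⁻¹ j u * (meanThird P f θ₀ X n w t u - crossCov P f θ₀ X n t u w)) *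
      leadScore P ν f θ₀ X w n ω := by
  simp only [leadExpected, neg_mul, mul_neg, Finset.sum_neg_distrib, neg_inj, Finset.sum_mul,
    Finset.mul_sum]
  symm
  rw [Finset.sum_comm]
  refine Finset.sum_congr rfl fun t _ => ?_
  rw [Finset.sum_comm]
  exact Finset.sum_congr rfl fun u _ => Finset.sum_congr rfl fun w _ => by ring

theorem integral_leadExpected (h : SampleModel P ν f Θ θ₀ X ρ C M b) (j : Fin p) (n : ℕ) :
    ∫ ω, leadExpected P ν f θ₀ X j n ω ∂P = 0 := by
  simp_rw [leadExpected_eq]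
  rw [integral_finsetSum _ fun w _ => (h.memLp_leadScore w n).integrable_of_four.const_mul _]
  refine Finset.sum_eq_zero fun w _ => ?_
  rw [integral_const_mul, h.integral_leadScore, mul_zero]

theorem integrable_mul_of_four {Y Y' : Ω → ℝ} (hY : MemLp Y 4 P) (hY' : MemLp Y' 4 P) :
    Integrable (fun ω => Y ω * Y' ω) P :=
  MemLp.integrable_mul hY.two_of_four hY'.two_of_four

/-- The leading score term is dual to the score. -/
theorem integral_mul_leadScore (h : SampleModel P ν f Θ θ₀ X ρ C M b) {n : ℕ}
    (hn : IsUnit (expectedFIM ν f n θ₀).det) (v r : Fin p) :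
    ∫ ω, fluct P (deriv₀ f θ₀ X [v]) n ω * leadScore P ν f θ₀ X r n ω ∂P =
      (n : ℝ)⁻¹ * if r = v then 1 else 0 := by
  have hi : ∀ w, Integrable (fun ω => (expectedFIM ν f n θ₀)⁻¹ r w *
      (fluct P (deriv₀ f θ₀ X [v]) n ω * fluct P (deriv₀ f θ₀ X [w]) n ω)) P := fun w =>
    (integrable_mul_of_four (h.memLp_fluct_deriv₀ [v] (by simp) (by simp) n)
      (h.memLp_fluct_deriv₀ [w] (by simp) (by simp) n)).const_mul _
  have e : ∀ ω, fluct P (deriv₀ f θ₀ X [v]) n ω * leadScore P ν f θ₀ X r n ω =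
      ∑ w, (expectedFIM ν f n θ₀)⁻¹ r w *
      (fluct P (deriv₀ f θ₀ X [v]) n ω * fluct P (deriv₀ f θ₀ X [w]) n ω) := fun ω => by
    rw [leadScore, Finset.mul_sum]
    exact Finset.sum_congr rfl fun w _ => by ring
  simp_rw [e]
  rw [integral_finsetSum _ fun w _ => hi w]
  simp_rw [integral_const_mul, h.integral_score_mul_score]
  have e2 : ∑ w, (expectedFIM ν f n θ₀)⁻¹ r w * ((n : ℝ)⁻¹ * expectedFIM ν f n θ₀ v w) =
      (n : ℝ)⁻¹ * ((expectedFIM ν f n θ₀)⁻¹ * expectedFIM ν f n θ₀) r v := by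
    rw [Matrix.mul_apply, Finset.mul_sum]
    refine Finset.sum_congr rfl fun w _ => ?_
    have : expectedFIM ν f n θ₀ v w = expectedFIM ν f n θ₀ w v := by
      conv_lhs => rw [← h.expectedFIM_transpose]
      rfl
    rw [this]
    ring
  rw [e2, Matrix.nonsing_inv_mul _ hn, Matrix.one_apply]

theorem integral_leadScore_sq (h : SampleModel P ν f Θ θ₀ X ρ C M b) {n : ℕ}
    (hn : IsUnit (expectedFIM ν f n θ₀).det) (j : Fin p) :
    ∫ ω, leadScore P ν f θ₀ X j n ω ^ 2 ∂P = (n : ℝ)⁻¹ * (expectedFIM ν f n θ₀)⁻¹ j j := by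
  have e : ∀ ω, leadScore P ν f θ₀ X j n ω ^ 2 = ∑ v, (expectedFIM ν f n θ₀)⁻¹ j v *
      (fluct P (deriv₀ f θ₀ X [v]) n ω * leadScore P ν f θ₀ X j n ω) := fun ω => by
    -- The free factor `y` ensures that only one of the two copies of `leadScore` is expanded; the
    -- other is then paired with the score by duality.
    have e' : ∀ y : ℝ, leadScore P ν f θ₀ X j n ω * y = ∑ v, (expectedFIM ν f n θ₀)⁻¹ j v *
        (fluct P (deriv₀ f θ₀ X [v]) n ω * y) := fun y => by
      rw [leadScore, Finset.sum_mul]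
      exact Finset.sum_congr rfl fun w _ => by ring
    rw [sq, e']
  simp_rw [e]
  rw [integral_finsetSum _ fun v _ => (integrable_mul_of_four
    (h.memLp_fluct_deriv₀ [v] (by simp) (by simp) n) (h.memLp_leadScore j n)).const_mul _]
  simp_rw [integral_const_mul, h.integral_mul_leadScore hn]
  simp [mul_comm]

theorem _root_.ProbabilityTheory.covariance_congr_ae {Y₁ Y₂ Y₁' Y₂' : Ω → ℝ} (h₁ : Y₁ =ᵐ[P] Y₁')
    (h₂ : Y₂ =ᵐ[P] Y₂') : cov[Y₁, Y₂; P] = cov[Y₁', Y₂'; P] := by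
  rw [covariance, covariance, integral_congr_ae h₁, integral_congr_ae h₂]
  refine integral_congr_ae ?_
  filter_upwards [h₁, h₂] with ω e₁ e₂
  rw [e₁, e₂]

/-- Independence and the vanishing mean of the score reduce the covariance in the nondegeneracy
condition to averaged mean products. -/
theorem nullCov_eq (h : SampleModel P ν f Θ θ₀ X ρ C M b) (n : ℕ) (t u v : Fin p) :
    nullCov P f X θ₀ n t u v = crossCov P f θ₀ X n t u v := by
  rw [nullCov, crossCov]
  congr 1
  have e1 : (fun ω => partialD t (partialD u (negLogLik f n fun i => X i ω)) θ₀) =ᵐ[P]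
      fun ω => ∑ i ∈ Finset.range n, deriv₀ f θ₀ X [t, u] i ω := by
    filter_upwards [h.ae_goodSample] with ω hω
    exact hω.partialD_partialD_negLogLik n t u h.mem_ball
  have e2 : (fun ω => partialD v (negLogLik f n fun i => X i ω) θ₀) =ᵐ[P]
      fun ω => ∑ i ∈ Finset.range n, deriv₀ f θ₀ X [v] i ω := by
    filter_upwards [h.ae_goodSample] with ω hω
    exact hω.partialD_negLogLik n v h.mem_ball
  rw [covariance_congr_ae e1 e2, covariance_sum_of_indep
    (fun i => (h.memLp_deriv₀ [t, u] (by simp) (by simp) i).two_of_four)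
    (fun i => (h.memLp_deriv₀ [v] (by simp) (by simp) i).two_of_four)
    (h.indepFun_comp (h.aemeasurable_nllDeriv [t, u] (by simp))
      (h.aemeasurable_nllDeriv [v] (by simp)))]
  simp_rw [h.covariance_deriv₀_score [t, u] (by simp) (by simp)]

/-- The part of the observed information which is uncorrelated with the score. -/
def leadResidual (P : Measure Ω) (ν : ℕ → Measure 𝒳) (f : ℕ → 𝒳 → Param p → ℝ) (θ₀ : Param p)
    (X : ℕ → Ω → 𝒳) (j : Fin p) (n : ℕ) (ω : Ω) : ℝ :=
  ∑ t, ∑ u, (expectedFIM ν f n θ₀)⁻¹ j t * (expectedFIM ν f n θ₀)⁻¹ j u *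
    (fluct P (deriv₀ f θ₀ X [t, u]) n ω
      - ∑ w, crossCov P f θ₀ X n t u w * leadScore P ν f θ₀ X w n ω)

/-- The third derivatives enter both expansions in the same way; the only discrepancy is the Hessian
fluctuation against its regression on the score, with coefficients `crossCov`. -/
theorem leadObserved_eq (j : Fin p) (n : ℕ) (ω : Ω) :
    leadObserved P ν f θ₀ X j n ω =
      leadResidual P ν f θ₀ X j n ω + leadExpected P ν f θ₀ X j n ω := by
  simp only [leadObserved, leadResidual, leadExpected, ← Finset.sum_add_distrib]
  refine Finset.sum_congr rfl fun t _ => Finset.sum_congr rfl fun u _ => ?_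
  rw [← mul_add]
  congr 1
  simp only [sub_mul, Finset.sum_sub_distrib]
  ring

theorem memLp_leadResidual (h : SampleModel P ν f Θ θ₀ X ρ C M b) (j : Fin p) (n : ℕ) :
    MemLp (leadResidual P ν f θ₀ X j n) 4 P :=
  memLp_finsetSum _ fun t _ => memLp_finsetSum _ fun u _ =>
    ((h.memLp_fluct_deriv₀ [t, u] (by simp) (by simp) n).sub
      (memLp_finsetSum _ fun w _ => (h.memLp_leadScore w n).const_mul _)).const_mul _

/-- This is the normal equation of that regression: `leadScore` is the dual basis to the score, so
the coefficients `crossCov` subtract precisely the covariance. -/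
theorem integral_leadResidual_mul_score (h : SampleModel P ν f Θ θ₀ X ρ C M b) {n : ℕ}
    (hn : IsUnit (expectedFIM ν f n θ₀).det) (j v : Fin p) :
    ∫ ω, leadResidual P ν f θ₀ X j n ω * fluct P (deriv₀ f θ₀ X [v]) n ω ∂P = 0 := by
  have hv := h.memLp_fluct_deriv₀ [v] (by simp) (by simp) n
  have i1 : ∀ t u, Integrable (fun ω => fluct P (deriv₀ f θ₀ X [t, u]) n ω *
      fluct P (deriv₀ f θ₀ X [v]) n ω) P := fun t u =>
    integrable_mul_of_four (h.memLp_fluct_deriv₀ [t, u] (by simp) (by simp) n) hv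
  have i2 : ∀ t u w, Integrable (fun ω => crossCov P f θ₀ X n t u w *
      (fluct P (deriv₀ f θ₀ X [v]) n ω * leadScore P ν f θ₀ X w n ω)) P := fun t u w =>
    (integrable_mul_of_four hv (h.memLp_leadScore w n)).const_mul _
  have i3 : ∀ t u, Integrable (fun ω => (expectedFIM ν f n θ₀)⁻¹ j t *
      (expectedFIM ν f n θ₀)⁻¹ j u * (fluct P (deriv₀ f θ₀ X [t, u]) n ω *
      fluct P (deriv₀ f θ₀ X [v]) n ω - ∑ w, crossCov P f θ₀ X n t u w *
      (fluct P (deriv₀ f θ₀ X [v]) n ω * leadScore P ν f θ₀ X w n ω))) P := fun t u =>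
    ((i1 t u).sub (integrable_finsetSum _ fun w _ => i2 t u w)).const_mul _
  have e : ∀ ω, leadResidual P ν f θ₀ X j n ω * fluct P (deriv₀ f θ₀ X [v]) n ω =
      ∑ t, ∑ u, (expectedFIM ν f n θ₀)⁻¹ j t * (expectedFIM ν f n θ₀)⁻¹ j u *
      (fluct P (deriv₀ f θ₀ X [t, u]) n ω * fluct P (deriv₀ f θ₀ X [v]) n ω -
        ∑ w, crossCov P f θ₀ X n t u w *
          (fluct P (deriv₀ f θ₀ X [v]) n ω * leadScore P ν f θ₀ X w n ω)) := fun ω => by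
    rw [leadResidual, Finset.sum_mul]
    refine Finset.sum_congr rfl fun t _ => ?_
    rw [Finset.sum_mul]
    refine Finset.sum_congr rfl fun u _ => ?_
    rw [mul_assoc, sub_mul, Finset.sum_mul]
    congr 2
    exact Finset.sum_congr rfl fun w _ => by ring
  simp_rw [e]
  rw [integral_finsetSum _ fun t _ => integrable_finsetSum _ fun u _ => i3 t u]
  refine Finset.sum_eq_zero fun t _ => ?_
  rw [integral_finsetSum _ fun u _ => i3 t u]
  refine Finset.sum_eq_zero fun u _ => ?_
  rw [integral_const_mul, integral_sub (i1 t u) (integrable_finsetSum _ fun w _ => i2 t u w),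
    integral_finsetSum _ fun w _ => i2 t u w]
  simp_rw [integral_const_mul, h.integral_mul_leadScore hn]
  rw [h.integral_fluct_mul_score [t, u] (by simp) (by simp)]
  have : ∑ w, crossCov P f θ₀ X n t u w * ((n : ℝ)⁻¹ * if w = v then 1 else 0) =
      (n : ℝ)⁻¹ * crossCov P f θ₀ X n t u v := by
    simp [mul_comm]
  rw [this, crossCov, sub_self, mul_zero]

theorem integral_leadResidual_mul_leadExpected (h : SampleModel P ν f Θ θ₀ X ρ C M b) {n : ℕ}
    (hn : IsUnit (expectedFIM ν f n θ₀).det) (j : Fin p) :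
    ∫ ω, leadResidual P ν f θ₀ X j n ω * leadExpected P ν f θ₀ X j n ω ∂P = 0 := by
  have hres := h.memLp_leadResidual j n
  have hscore : ∀ r, ∫ ω, leadResidual P ν f θ₀ X j n ω * leadScore P ν f θ₀ X r n ω ∂P = 0 := by
    intro r
    have e : ∀ ω, leadResidual P ν f θ₀ X j n ω * leadScore P ν f θ₀ X r n ω =
        ∑ w, (expectedFIM ν f n θ₀)⁻¹ r w *
          (leadResidual P ν f θ₀ X j n ω * fluct P (deriv₀ f θ₀ X [w]) n ω) := fun ω => by
      rw [leadScore, Finset.mul_sum]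
      exact Finset.sum_congr rfl fun w _ => by ring
    simp_rw [e]
    rw [integral_finsetSum _ fun w _ => (integrable_mul_of_four hres
      (h.memLp_fluct_deriv₀ [w] (by simp) (by simp) n)).const_mul _]
    refine Finset.sum_eq_zero fun w _ => ?_
    rw [integral_const_mul, h.integral_leadResidual_mul_score hn, mul_zero]
  have e : ∀ ω, leadResidual P ν f θ₀ X j n ω * leadExpected P ν f θ₀ X j n ω =
      ∑ w, (-∑ t, ∑ u, (expectedFIM ν f n θ₀)⁻¹ j t * (expectedFIM ν f n θ₀)⁻¹ j u *
        (meanThird P f θ₀ X n w t u - crossCov P f θ₀ X n t u w)) *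
        (leadResidual P ν f θ₀ X j n ω * leadScore P ν f θ₀ X w n ω) := fun ω => by
    rw [leadExpected_eq, Finset.mul_sum]
    exact Finset.sum_congr rfl fun w _ => by ring
  simp_rw [e]
  rw [integral_finsetSum _ fun w _ => (integrable_mul_of_four hres
    (h.memLp_leadScore w n)).const_mul _]
  refine Finset.sum_eq_zero fun w _ => ?_
  rw [integral_const_mul, hscore, mul_zero]

theorem memLp_curvatureTerm (h : SampleModel P ν f Θ θ₀ X ρ C M b) (j : Fin p) (n i : ℕ) :
    MemLp (curvatureTerm P ν f X θ₀ j n i) 4 P :=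
  memLp_finsetSum _ fun t _ => memLp_finsetSum _ fun u _ =>
    (((h.memLp_deriv₀ [t, u] (by simp) (by simp) i).sub (memLp_const _)).sub
      (memLp_finsetSum _ fun _ _ => memLp_finsetSum _ fun w _ =>
        (h.memLp_deriv₀ [w] (by simp) (by simp) i).const_mul _)).const_mul _

theorem indepFun_curvatureTerm (h : SampleModel P ν f Θ θ₀ X ρ C M b) (j : Fin p) (n i k : ℕ)
    (hik : i ≠ k) :
    IndepFun (curvatureTerm P ν f X θ₀ j n i) (curvatureTerm P ν f X θ₀ j n k) P := by
  have hm : ∀ i, AEMeasurable (fun x => ∑ t, ∑ u, (expectedFIM ν f n θ₀)⁻¹ j t *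
      (expectedFIM ν f n θ₀)⁻¹ j u * (nllDeriv (f i) [t, u] x θ₀
      - (∫ ω', partialD t (partialD u (negLogLikOne f i (X i ω'))) θ₀ ∂P)
      - ∑ v, ∑ w, nullCov P f X θ₀ n t u v * (expectedFIM ν f n θ₀)⁻¹ v w *
          nllDeriv (f i) [w] x θ₀)) (ν i) := fun i =>
    Finset.aemeasurable_fun_sum _ fun t _ => Finset.aemeasurable_fun_sum _ fun u _ =>
      (((h.aemeasurable_nllDeriv [t, u] (by simp) i).sub_const _).sub
        (Finset.aemeasurable_fun_sum _ fun v _ => Finset.aemeasurable_fun_sum _ fun w _ =>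
          (h.aemeasurable_nllDeriv [w] (by simp) i).const_mul _)).const_mul _
  exact h.indepFun_comp hm hm i k hik

/-- The curvature terms are already centred, their Hessian part by construction and their score part
by the score identity, so `leadResidual` is their plain average and its variance is computed by
independence. -/
theorem fluct_curvatureTerm (h : SampleModel P ν f Θ θ₀ X ρ C M b) (j : Fin p) (n : ℕ) (ω : Ω) :
    fluct P (curvatureTerm P ν f X θ₀ j n) n ω = leadResidual P ν f θ₀ X j n ω := by
  have hcurv : ∀ i ω, curvatureTerm P ν f X θ₀ j n i ω =
      ∑ t, ∑ u, (expectedFIM ν f n θ₀)⁻¹ j t * (expectedFIM ν f n θ₀)⁻¹ j u *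
      ((deriv₀ f θ₀ X [t, u] i ω - ∫ ω', deriv₀ f θ₀ X [t, u] i ω' ∂P)
      - ∑ v, ∑ w, crossCov P f θ₀ X n t u v * (expectedFIM ν f n θ₀)⁻¹ v w *
          deriv₀ f θ₀ X [w] i ω) := fun i ω => by
    simp_rw [← h.nullCov_eq]
    rfl
  have j1 : ∀ i t u, Integrable (fun ω => deriv₀ f θ₀ X [t, u] i ω -
      ∫ ω', deriv₀ f θ₀ X [t, u] i ω' ∂P) P := fun i t u =>
    (h.memLp_deriv₀ [t, u] (by simp) (by simp) i).integrable_of_four.sub (integrable_const _)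
  have j2 : ∀ i t u v w, Integrable (fun ω => crossCov P f θ₀ X n t u v *
      (expectedFIM ν f n θ₀)⁻¹ v w * deriv₀ f θ₀ X [w] i ω) P := fun i t u v w =>
    (h.memLp_deriv₀ [w] (by simp) (by simp) i).integrable_of_four.const_mul _
  have j3 : ∀ i t u, Integrable (fun ω => ∑ v, ∑ w, crossCov P f θ₀ X n t u v *
      (expectedFIM ν f n θ₀)⁻¹ v w * deriv₀ f θ₀ X [w] i ω) P := fun i t u =>
    integrable_finsetSum _ fun v _ => integrable_finsetSum _ fun w _ => j2 i t u v w
  have j4 : ∀ i t u, Integrable (fun ω => (expectedFIM ν f n θ₀)⁻¹ j t *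
      (expectedFIM ν f n θ₀)⁻¹ j u *
      ((deriv₀ f θ₀ X [t, u] i ω - ∫ ω', deriv₀ f θ₀ X [t, u] i ω' ∂P)
      - ∑ v, ∑ w, crossCov P f θ₀ X n t u v * (expectedFIM ν f n θ₀)⁻¹ v w *
          deriv₀ f θ₀ X [w] i ω)) P := fun i t u => ((j1 i t u).sub (j3 i t u)).const_mul _
  have hmean : ∀ i, ∫ ω, curvatureTerm P ν f X θ₀ j n i ω ∂P = 0 := fun i => by
    simp_rw [hcurv]
    rw [integral_finsetSum _ fun t _ => integrable_finsetSum _ fun u _ => j4 i t u]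
    refine Finset.sum_eq_zero fun t _ => ?_
    rw [integral_finsetSum _ fun u _ => j4 i t u]
    refine Finset.sum_eq_zero fun u _ => ?_
    rw [integral_const_mul, integral_sub (j1 i t u) (j3 i t u),
      integral_sub (h.memLp_deriv₀ [t, u] (by simp) (by simp) i).integrable_of_four
        (integrable_const _),
      integral_finsetSum _ fun v _ => integrable_finsetSum _ fun w _ => j2 i t u v w]
    have : ∀ v, ∫ ω, ∑ w, crossCov P f θ₀ X n t u v *
        (expectedFIM ν f n θ₀)⁻¹ v w * deriv₀ f θ₀ X [w] i ω ∂P = 0 := fun v => by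
      rw [integral_finsetSum _ fun w _ => j2 i t u v w]
      refine Finset.sum_eq_zero fun w _ => ?_
      rw [integral_const_mul, h.integral_deriv₀_score, mul_zero]
    simp [this]
  rw [fluct]
  simp_rw [hmean, sub_zero, hcurv]
  rw [leadResidual, Finset.sum_comm, Finset.mul_sum]
  refine Finset.sum_congr rfl fun t _ => ?_
  rw [Finset.sum_comm, Finset.mul_sum]
  refine Finset.sum_congr rfl fun u _ => ?_
  rw [← Finset.mul_sum, Finset.sum_sub_distrib, mul_left_comm, mul_sub]
  congr 2
  rw [Finset.sum_comm, Finset.mul_sum]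
  refine Finset.sum_congr rfl fun v _ => ?_
  rw [Finset.sum_comm, Finset.mul_sum, leadScore, Finset.mul_sum]
  refine Finset.sum_congr rfl fun w _ => ?_
  rw [← Finset.mul_sum, h.fluct_score]
  ring

theorem integral_leadResidual_sq (h : SampleModel P ν f Θ θ₀ X ρ C M b) (j : Fin p) (n : ℕ) :
    ∫ ω, leadResidual P ν f θ₀ X j n ω ^ 2 ∂P = (n : ℝ)⁻¹ * ((n : ℝ)⁻¹ *
      ∑ i ∈ Finset.range n, Var[curvatureTerm P ν f X θ₀ j n i; P]) := by
  have e := integral_fluct_mul_fluct (P := P) (h.memLp_curvatureTerm j n)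
    (h.memLp_curvatureTerm j n) (h.indepFun_curvatureTerm j n) n
  simp_rw [h.fluct_curvatureTerm] at e
  simp_rw [sq, e]
  congr 2
  exact Finset.sum_congr rfl fun i _ =>
    covariance_self (h.memLp_curvatureTerm j n i).1.aemeasurable

theorem integral_leadObserved (h : SampleModel P ν f Θ θ₀ X ρ C M b) (j : Fin p) (n : ℕ) :
    ∫ ω, leadObserved P ν f θ₀ X j n ω ∂P = 0 := by
  simp_rw [leadObserved_eq, ← h.fluct_curvatureTerm]
  rw [integral_add (memLp_fluct (h.memLp_curvatureTerm j n) n).integrable_of_four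
    (h.memLp_leadExpected j n).integrable_of_four, h.integral_leadExpected,
    integral_fluct (h.memLp_curvatureTerm j n), add_zero]

/-- Pythagoras for the orthogonal decomposition: the excess is the variance of the residual. -/
theorem integral_leadObserved_sq (h : SampleModel P ν f Θ θ₀ X ρ C M b) {n : ℕ}
    (hn : IsUnit (expectedFIM ν f n θ₀).det) (j : Fin p) :
    ∫ ω, leadObserved P ν f θ₀ X j n ω ^ 2 ∂P = ∫ ω, leadExpected P ν f θ₀ X j n ω ^ 2 ∂P +
      (n : ℝ)⁻¹ * ((n : ℝ)⁻¹ *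
        ∑ i ∈ Finset.range n, Var[curvatureTerm P ν f X θ₀ j n i; P]) := by
  have hR := h.memLp_leadResidual j n
  have hE := h.memLp_leadExpected j n
  have e : ∀ ω, leadObserved P ν f θ₀ X j n ω ^ 2 = leadExpected P ν f θ₀ X j n ω ^ 2 +
      leadResidual P ν f θ₀ X j n ω ^ 2 +
      2 * (leadResidual P ν f θ₀ X j n ω * leadExpected P ν f θ₀ X j n ω) := fun ω => by
    rw [leadObserved_eq]
    ring
  have i1 := hE.integrable_pow_of_four (k := 2) (by norm_num)
  have i2 := hR.integrable_pow_of_four (k := 2) (by norm_num)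
  have i3 := integrable_mul_of_four hR hE
  simp_rw [e]
  rw [integral_add (i1.fun_add i2) (i3.const_mul 2), integral_add i1 i2, integral_const_mul,
    h.integral_leadResidual_mul_leadExpected hn, h.integral_leadResidual_sq]
  ring

/-- The normalized variance of an estimator with a given second order expansion. -/
theorem abs_normCov_sub_le (h : SampleModel P ν f Θ θ₀ X ρ C M b) {θhat : ℕ → Ω → Param p} {n : ℕ}
    (hn : IsUnit (expectedFIM ν f n θ₀).det) (hn0 : 0 < n) (hθ : Measurable (θhat n)) {j : Fin p}
    {Z : Ω → ℝ} {K K' : ℝ} (hK : 0 ≤ K) (hK' : 0 ≤ K') (hZ : MemLp Z 4 P)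
    (hlead : ∀ᵐ ω ∂P, |leadScore P ν f θ₀ X j n ω| ≤ K * Z ω)
    (hrem : ∀ᵐ ω ∂P, |θhat n ω j - θ₀ j + leadScore P ν f θ₀ X j n ω| ≤ K * Z ω ^ 2)
    (h3 : ∫ ω, Z ω ^ 3 ∂P ≤ K' / n * (Real.sqrt n)⁻¹) (h4 : ∫ ω, Z ω ^ 4 ∂P ≤ K' / (n : ℝ) ^ 2) :
    |normCov P θhat n j j - (expectedFIM ν f n θ₀)⁻¹ j j| ≤ 3 * K ^ 2 * K' * (Real.sqrt n)⁻¹ := by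
  have hn' : (0 : ℝ) < n := Nat.cast_pos.2 hn0
  set ξ := leadScore P ν f θ₀ X j n with hξ
  have hξ4 : MemLp ξ 4 P := h.memLp_leadScore j n
  set R : Ω → ℝ := fun ω => θhat n ω j - θ₀ j + ξ ω with hR
  have hθm : Measurable fun ω => θhat n ω j := by fun_prop
  have hRm : AEStronglyMeasurable R P :=
    (hθm.sub_const _).aestronglyMeasurable.add hξ4.1
  have hZ4 := hZ.integrable_pow_of_four le_rfl
  have hZ3 := hZ.integrable_pow_of_four (k := 3) (by norm_num)
  have hRsq : ∀ᵐ ω ∂P, R ω ^ 2 ≤ K ^ 2 * Z ω ^ 4 := by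
    filter_upwards [hrem] with ω hω
    calc R ω ^ 2 = |R ω| ^ 2 := (sq_abs _).symm
      _ ≤ (K * Z ω ^ 2) ^ 2 := pow_le_pow_left₀ (abs_nonneg _) hω 2
      _ = K ^ 2 * Z ω ^ 4 := by ring
  have hRsqi : Integrable (fun ω => R ω ^ 2) P := by
    refine (hZ4.const_mul (K ^ 2)).mono' (hRm.pow 2) ?_
    filter_upwards [hRsq] with ω hω
    rwa [Real.norm_of_nonneg (sq_nonneg _)]
  have hR2 : MemLp R 2 P := (memLp_two_iff_integrable_sq hRm).2 hRsqi
  -- With `θhat = θ₀ - ξ + R`, the variance of `ξ` gives the inverse information exactly, while `Var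
  -- R = O(n⁻²)` and `cov(R, ξ) = O(n^(-3/2))` leave `O(n^(-1/2))` after scaling by `n`.
  have hvar : cov[fun ω => θhat n ω j, fun ω => θhat n ω j; P] =
      Var[R; P] - 2 * cov[R, ξ; P] + Var[ξ; P] := by
    rw [covariance_self hθm.aemeasurable]
    have e : (fun ω => θhat n ω j) = fun ω => (R - ξ) ω + θ₀ j := by
      funext ω
      simp [hR]
    rw [e, variance_add_const (hRm.sub hξ4.1), variance_sub hR2 hξ4.two_of_four]
  have hvarξ : Var[ξ; P] = (n : ℝ)⁻¹ * (expectedFIM ν f n θ₀)⁻¹ j j := by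
    rw [variance_of_integral_eq_zero hξ4.1.aemeasurable (h.integral_leadScore j n)]
    exact h.integral_leadScore_sq hn j
  have hvarR : |Var[R; P]| ≤ K ^ 2 * (K' / (n : ℝ) ^ 2) := by
    rw [abs_of_nonneg (variance_nonneg _ _)]
    refine (variance_le_expectation_sq hRm).trans ?_
    calc ∫ ω, R ω ^ 2 ∂P ≤ ∫ ω, K ^ 2 * Z ω ^ 4 ∂P :=
          integral_mono_ae hRsqi (hZ4.const_mul _) hRsq
      _ ≤ _ := by
          rw [integral_const_mul]
          gcongr
  have hcov : |cov[R, ξ; P]| ≤ K ^ 2 * (K' / n * (Real.sqrt n)⁻¹) := by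
    rw [covariance_eq_sub hR2 hξ4.two_of_four, h.integral_leadScore, mul_zero, sub_zero]
    refine abs_integral_le_integral_abs.trans ?_
    calc ∫ ω, |(R * ξ) ω| ∂P ≤ ∫ ω, K ^ 2 * Z ω ^ 3 ∂P := by
          refine integral_mono_ae (hR2.integrable_mul hξ4.two_of_four).abs (hZ3.const_mul _) ?_
          filter_upwards [hlead, hrem] with ω h1 h2
          simp only [Pi.mul_apply, abs_mul]
          calc |R ω| * |ξ ω| ≤ (K * Z ω ^ 2) * (K * Z ω) :=
                mul_le_mul h2 h1 (abs_nonneg _) (by positivity)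
            _ = K ^ 2 * Z ω ^ 3 := by ring
      _ ≤ _ := by
          rw [integral_const_mul]
          gcongr
  have hs : 0 < Real.sqrt n := Real.sqrt_pos.2 hn'
  have hinv : (n : ℝ)⁻¹ ≤ (Real.sqrt n)⁻¹ := by
    refine inv_anti₀ hs ?_
    have h1 : (1 : ℝ) ≤ Real.sqrt n := Real.one_le_sqrt.2 (by exact_mod_cast hn0)
    nlinarith [Real.mul_self_sqrt hn'.le]
  have e : normCov P θhat n j j - (expectedFIM ν f n θ₀)⁻¹ j j =
      n * Var[R; P] - 2 * (n * cov[R, ξ; P]) := by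
    simp only [normCov, Matrix.of_apply]
    rw [hvar, hvarξ]
    field_simp
    ring
  rw [e]
  refine (abs_sub _ _).trans ?_
  rw [abs_mul, abs_mul, abs_mul, Nat.abs_cast, abs_two]
  calc n * |Var[R; P]| + 2 * (n * |cov[R, ξ; P]|)
      ≤ n * (K ^ 2 * (K' / (n : ℝ) ^ 2)) + 2 * (n * (K ^ 2 * (K' / n * (Real.sqrt n)⁻¹))) := by
        gcongr
    _ = K ^ 2 * K' * (n : ℝ)⁻¹ + 2 * (K ^ 2 * K') * (Real.sqrt n)⁻¹ := by
        field_simp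
    _ ≤ K ^ 2 * K' * (Real.sqrt n)⁻¹ + 2 * (K ^ 2 * K') * (Real.sqrt n)⁻¹ := by gcongr
    _ = 3 * K ^ 2 * K' * (Real.sqrt n)⁻¹ := by ring

end SampleModel

/-! ### Comparison of the mean squared errors -/

/-- Replacing the argument of a bounded, locally quadratic function by its leading term costs a
cubic error, also where the expansion of the argument is not available. -/
theorem exists_abs_sub_mul_sq_le {c L K η : ℝ} (hc : 0 ≤ c) (hL : 0 ≤ L) (hK : 0 ≤ K)
    (hη : 0 < η) :
    ∃ K' : ℝ, 0 ≤ K' ∧ ∀ G y B Z : ℝ, 0 ≤ Z → 0 ≤ G → G ≤ 4 →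
      |G - c * y ^ 2| ≤ L * |y| ^ 3 → |B| ≤ K * Z → (Z < η → |y - B| ≤ K * Z ^ 2) →
      |G - c * B ^ 2| ≤ K' * Z ^ 3 := by
  set η' := min η 1 with hη'
  have hη'0 : 0 < η' := lt_min hη one_pos
  -- The first two terms serve small `Z`, from `|y| ≤ 2KZ` and from factoring `y² - B²`. The last
  -- two serve `Z ≥ η'`, where `y` is unrestricted and only `G ≤ 4` and the bound on `B` are used.
  refine ⟨8 * L * K ^ 3 + 3 * c * K ^ 2 + (4 / η' ^ 3 + c * K ^ 2 / η'), by positivity, ?_⟩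
  intro G y B Z hZ hG hG4 hGy hB hyB
  have hZ3 : 0 ≤ Z ^ 3 := by positivity
  have hKZ : 0 ≤ K * Z := by positivity
  have n1 : 0 ≤ (8 * L * K ^ 3 + 3 * c * K ^ 2) * Z ^ 3 := by positivity
  have n2 : 0 ≤ (4 / η' ^ 3 + c * K ^ 2 / η') * Z ^ 3 := by positivity
  rw [add_mul]
  rcases lt_or_ge Z η' with hlt | hge
  · have h1 := hyB (hlt.trans_le (min_le_left _ _))
    have hZ1 : Z ≤ 1 := (hlt.trans_le (min_le_right _ _)).le
    have hKZ2 : K * Z ^ 2 ≤ K * Z := by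
      refine mul_le_mul_of_nonneg_left ?_ hK
      nlinarith
    have hy : |y| ≤ 2 * (K * Z) := by
      have := abs_add_le (y - B) B
      rw [sub_add_cancel] at this
      linarith
    have hy3 : |y| ^ 3 ≤ (2 * (K * Z)) ^ 3 := pow_le_pow_left₀ (abs_nonneg _) hy 3
    have hsum : |y + B| ≤ 3 * (K * Z) := (abs_add_le _ _).trans (by linarith)
    have hsq : |y ^ 2 - B ^ 2| ≤ K * Z ^ 2 * (3 * (K * Z)) := by
      rw [show y ^ 2 - B ^ 2 = (y - B) * (y + B) by ring, abs_mul]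
      exact mul_le_mul h1 hsum (abs_nonneg _) (by positivity)
    have htri : |G - c * B ^ 2| ≤ |G - c * y ^ 2| + c * |y ^ 2 - B ^ 2| := by
      rw [← abs_of_nonneg hc, ← abs_mul, abs_of_nonneg hc]
      refine le_trans (le_of_eq ?_) (abs_add_le _ _)
      congr 1
      ring
    have e1 : L * |y| ^ 3 ≤ L * (2 * (K * Z)) ^ 3 := mul_le_mul_of_nonneg_left hy3 hL
    have e2 := mul_le_mul_of_nonneg_left hsq hc
    have e3 : L * (2 * (K * Z)) ^ 3 + c * (K * Z ^ 2 * (3 * (K * Z))) =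
        (8 * L * K ^ 3 + 3 * c * K ^ 2) * Z ^ 3 := by ring
    linarith
  · have hB2 : B ^ 2 ≤ (K * Z) ^ 2 := by
      rw [← sq_abs]
      exact pow_le_pow_left₀ (abs_nonneg _) hB 2
    have hr : 1 ≤ Z / η' := (one_le_div hη'0).2 hge
    have h4 : 4 ≤ 4 * (Z / η') ^ 3 := by
      have := one_le_pow₀ hr (n := 3)
      linarith
    have h5 : c * B ^ 2 ≤ c * (K * Z) ^ 2 * (Z / η') :=
      (mul_le_mul_of_nonneg_left hB2 hc).trans (le_mul_of_one_le_right (by positivity) hr)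
    have h6 : 0 ≤ c * B ^ 2 := by positivity
    have e : 4 * (Z / η') ^ 3 + c * (K * Z) ^ 2 * (Z / η') =
        (4 / η' ^ 3 + c * K ^ 2 / η') * Z ^ 3 := by
      field_simp
    rw [abs_le]
    constructor <;> linarith

section

variable {P : Measure Ω}

theorem ofReal_integral_le_lintegral_ofReal {φ : Ω → ℝ} (hφ : Integrable φ P) :
    ENNReal.ofReal (∫ ω, φ ω ∂P) ≤ ∫⁻ ω, ENNReal.ofReal (φ ω) ∂P := by
  have hpos : Integrable (fun ω => max (φ ω) 0) P := hφ.pos_part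
  calc ENNReal.ofReal (∫ ω, φ ω ∂P) ≤ ENNReal.ofReal (∫ ω, max (φ ω) 0 ∂P) :=
        ENNReal.ofReal_le_ofReal (integral_mono hφ hpos fun ω => le_max_left _ _)
    _ = ∫⁻ ω, ENNReal.ofReal (max (φ ω) 0) ∂P :=
        ofReal_integral_eq_lintegral_ofReal hpos (Eventually.of_forall fun ω => le_max_right _ _)
    _ = ∫⁻ ω, ENNReal.ofReal (φ ω) ∂P := lintegral_congr fun ω => by simp

/-- Sandwich for a lower integral, without measurability of the integrand. -/
theorem lintegral_ofReal_bounds {G Y E : Ω → ℝ} (hG : ∀ᵐ ω ∂P, 0 ≤ G ω) (hY : Integrable Y P)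
    (hE : Integrable E P) (h : ∀ᵐ ω ∂P, |G ω - Y ω| ≤ E ω) :
    ENNReal.ofReal (∫ ω, Y ω ∂P - ∫ ω, E ω ∂P) ≤ ∫⁻ ω, ENNReal.ofReal (G ω) ∂P ∧
      ∫⁻ ω, ENNReal.ofReal (G ω) ∂P ≤ ENNReal.ofReal (∫ ω, Y ω ∂P + ∫ ω, E ω ∂P) := by
  constructor
  · rw [← integral_sub hY hE]
    refine (ofReal_integral_le_lintegral_ofReal (hY.sub hE)).trans (lintegral_mono_ae ?_)
    filter_upwards [h] with ω hω
    refine ENNReal.ofReal_le_ofReal ?_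
    have := (abs_le.1 hω).1
    simp only [Pi.sub_apply]
    linarith
  · have hle : ∀ᵐ ω ∂P, G ω ≤ Y ω + E ω := h.mono fun ω hω => by linarith [(abs_le.1 hω).2]
    rw [← integral_add hY hE, ofReal_integral_eq_lintegral_ofReal (hY.fun_add hE)]
    · exact lintegral_mono_ae (hle.mono fun ω hω => ENNReal.ofReal_le_ofReal hω)
    · filter_upwards [hG, hle] with ω h1 h2
      exact h1.trans h2

/-- The cross term vanishes by centring, so the offset `d` contributes the same square for the
observed and the expected information. -/
theorem integral_sub_div_sq [IsProbabilityMeasure P] {Y : Ω → ℝ} (hY : MemLp Y 4 P)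
    (hY0 : ∫ ω, Y ω ∂P = 0) (d v : ℝ) :
    ∫ ω, ((d - Y ω) / v) ^ 2 ∂P = (d ^ 2 + ∫ ω, Y ω ^ 2 ∂P) / v ^ 2 := by
  have i1 : Integrable (fun ω => d ^ 2 - 2 * d * Y ω) P :=
    (integrable_const _).sub (hY.integrable_of_four.const_mul _)
  have i2 := hY.integrable_pow_of_four (k := 2) (by norm_num)
  have e : ∀ ω, ((d - Y ω) / v) ^ 2 = (v ^ 2)⁻¹ * ((d ^ 2 - 2 * d * Y ω) + Y ω ^ 2) := fun ω => by
    rw [div_pow, div_eq_inv_mul]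
    ring
  simp_rw [e]
  rw [integral_const_mul, integral_add i1 i2, integral_sub (integrable_const _)
    (hY.integrable_of_four.const_mul _), integral_const_mul, hY0]
  simp [div_eq_inv_mul]

end

namespace SampleModel

variable {P : Measure Ω} [IsProbabilityMeasure P] {ν : ℕ → Measure 𝒳}
  {f : ℕ → 𝒳 → Param p → ℝ} {Θ : Set (Param p)} {θ₀ : Param p} {X : ℕ → Ω → 𝒳} {ρ C : ℝ}
  {M b : ℕ → 𝒳 → ℝ}

theorem tendsto_inv_expectedFIM {F : Matrix (Fin p) (Fin p) ℝ} (hF : F.PosDef)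
    (hlim : Tendsto (fun n => expectedFIM ν f n θ₀) atTop (𝓝 F)) (j : Fin p) :
    0 < F⁻¹ j j ∧ (∀ᶠ n in atTop, IsUnit (expectedFIM ν f n θ₀).det) ∧
      Tendsto (fun n => (expectedFIM ν f n θ₀)⁻¹ j j) atTop (𝓝 (F⁻¹ j j)) := by
  have h := tendsto_matrix_inv hlim hF.det_pos.ne'.isUnit
  exact ⟨hF.inv.diag_pos, h.1, ((continuous_apply_apply j j).tendsto _).comp h.2⟩

theorem exists_mse_bounds (h : SampleModel P ν f Θ θ₀ X ρ C M b) (hreg : RegularModel ν f Θ θ₀)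
    {F : Matrix (Fin p) (Fin p) ℝ} (hF : F.PosDef)
    (hlim : Tendsto (fun n => expectedFIM ν f n θ₀) atTop (𝓝 F))
    {θhat : ℕ → Ω → Param p} (hmle : IsMLE P f Θ X θhat) (j : Fin p) {α : ℝ} (hα : 0 < α)
    (hα' : α < 1) :
    ∃ (u w : ℕ → ℝ) (c K : ℝ), 0 < c ∧ 0 ≤ K ∧ ∀ᶠ n : ℕ in atTop,
      ENNReal.ofReal (u n) ≤ mseObserved P f X θhat α j n ∧
      mseExpected P ν f θhat α j n ≤ ENNReal.ofReal (w n) ∧ 0 ≤ w n ∧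
      c * ((n : ℝ)⁻¹ * ∑ i ∈ Finset.range n, Var[curvatureTerm P ν f X θ₀ j n i; P])
        - K * (Real.sqrt n)⁻¹ ≤ n * (u n - w n) ∧ n * w n ≤ K := by
  obtain ⟨Z, N, η, K, hZ, hη, hK, hexp⟩ := h.exists_mle_expansion hreg hF hlim hmle j
  obtain ⟨KZ, hKZ, hmom⟩ := hZ.exists_moment_bounds
  obtain ⟨c, L, hc, hL, hconf⟩ := exists_abs_sq_sub_confLevel_sub_le hα hα'
  obtain ⟨hl, hdet, hinv⟩ := tendsto_inv_expectedFIM hF hlim j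
  set l := F⁻¹ j j with hldef
  set a : ℕ → ℝ := fun n => (expectedFIM ν f n θ₀)⁻¹ j j with ha
  set v : ℕ → ℝ := fun n => normCov P θhat n j j with hv
  set Kv := 3 * K ^ 2 * KZ with hKv
  have hKv0 : 0 ≤ Kv := by positivity
  have hva : ∀ᶠ n : ℕ in atTop, |v n - a n| ≤ Kv * (Real.sqrt n)⁻¹ := by
    filter_upwards [hdet, eventually_ge_atTop N, eventually_gt_atTop 0] with n h1 h2 h3
    exact h.abs_normCov_sub_le h1 h3 (hmle n).1 hK hKZ (hZ.memLp n)
      ((hexp n h2).mono fun ω hω => hω.2.1) ((hexp n h2).mono fun ω hω => hω.2.2.2.2.1)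
      (hmom n h3).2.1 (hmom n h3).2.2
  have hvlim : Tendsto v atTop (𝓝 l) := by
    have h0 : Tendsto (fun n => v n - a n) atTop (𝓝 0) := by
      refine squeeze_zero_norm' (a := fun n : ℕ => Kv * (Real.sqrt n)⁻¹) hva ?_
      simpa using tendsto_inv_sqrt_natCast.const_mul Kv
    simpa using h0.add hinv
  set Kb := (Kv + K) / (l / 2) with hKb
  have hKb0 : 0 ≤ Kb := by positivity
  obtain ⟨K', hK', hquad⟩ := exists_abs_sub_mul_sq_le hc.le hL hKb0 hη
  set BH : ℕ → Ω → ℝ := fun n ω => (a n - v n - leadObserved P ν f θ₀ X j n ω) / v n with hBH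
  set BF : ℕ → Ω → ℝ := fun n ω => (a n - v n - leadExpected P ν f θ₀ X j n ω) / v n with hBF
  have mBH : ∀ n, MemLp (BH n) 4 P := fun n =>
    (((memLp_const (a n - v n)).sub (h.memLp_leadObserved j n)).const_mul (v n)⁻¹).ae_eq
      (Eventually.of_forall fun ω => (div_eq_inv_mul _ _).symm)
  have mBF : ∀ n, MemLp (BF n) 4 P := fun n =>
    (((memLp_const (a n - v n)).sub (h.memLp_leadExpected j n)).const_mul (v n)⁻¹).ae_eq
      (Eventually.of_forall fun ω => (div_eq_inv_mul _ _).symm)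
  have iZ3 : ∀ n, Integrable (fun ω => K' * Z n ω ^ 3) P := fun n =>
    ((hZ.memLp n).integrable_pow_of_four (by norm_num)).const_mul _
  have iBH : ∀ n, Integrable (fun ω => c * BH n ω ^ 2) P := fun n =>
    ((mBH n).integrable_pow_of_four (by norm_num)).const_mul _
  have iBF : ∀ n, Integrable (fun ω => c * BF n ω ^ 2) P := fun n =>
    ((mBF n).integrable_pow_of_four (by norm_num)).const_mul _
  -- The coefficient of the gain would be `c / l ^ 2` in the limit; since eventually `v n < 2 * l`,
  -- the fixed value `c / (2 * l) ^ 2` is safe.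
  refine ⟨fun n => ∫ ω, c * BH n ω ^ 2 ∂P - ∫ ω, K' * Z n ω ^ 3 ∂P,
    fun n => ∫ ω, c * BF n ω ^ 2 ∂P + ∫ ω, K' * Z n ω ^ 3 ∂P, c / (2 * l) ^ 2,
    c * Kb ^ 2 * KZ + 2 * K' * KZ, by positivity, by positivity, ?_⟩
  filter_upwards [hdet, eventually_ge_atTop N, eventually_gt_atTop 0, hva,
    hvlim.eventually (lt_mem_nhds (half_lt_self hl)),
    hvlim.eventually (gt_mem_nhds (by linarith : l < 2 * l))] with n hn hN hn0 hvan hv0 hv1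
  have hvpos : 0 < v n := (half_pos hl).trans hv0
  have hn' : (0 : ℝ) < n := Nat.cast_pos.2 hn0
  -- One pointwise estimate serves both informations. The inequality `n^(-1/2) ≤ Z` absorbs the
  -- offset `a n - v n` into the bound by a multiple of `Z`.
  have hpoint : ∀ (x y : ℝ) (ω : Ω), (Real.sqrt n)⁻¹ ≤ Z n ω → |y| ≤ K * Z n ω →
      (Z n ω < η → |x - (a n - y)| ≤ K * Z n ω ^ 2) →
      |(a n - v n - y) / v n| ≤ Kb * Z n ω ∧
      |((1 - α) - confLevel α (v n) x) ^ 2 - c * ((a n - v n - y) / v n) ^ 2| ≤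
        K' * Z n ω ^ 3 := by
    intro x y ω hs hy hxy
    have hB : |(a n - v n - y) / v n| ≤ Kb * Z n ω := by
      have h1 : |a n - v n - y| ≤ (Kv + K) * Z n ω := by
        have := abs_sub (a n - v n) y
        rw [abs_sub_comm (a n)] at this
        have h2 := mul_le_mul_of_nonneg_left hs hKv0
        linarith
      rw [abs_div, abs_of_pos hvpos, hKb, div_mul_eq_mul_div]
      exact div_le_div₀ ((abs_nonneg _).trans h1) h1 (half_pos hl) hv0.le
    refine ⟨hB, hquad _ (x / v n - 1) _ _ (hZ.nonneg n ω) (sq_nonneg _) ?_ (hconf _ _) hB ?_⟩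
    · have := pow_le_pow_left₀ (abs_nonneg _)
        (abs_sub_confLevel_le_two (v := v n) (x := x) hα hα') 2
      rw [sq_abs] at this
      linarith
    · intro hlt
      have h1 := hxy hlt
      have e : x / v n - 1 - (a n - v n - y) / v n = (x - (a n - y)) / v n := by
        field_simp
        ring
      rw [e, abs_div, abs_of_pos hvpos, hKb, div_mul_eq_mul_div]
      refine div_le_div₀ (by positivity) (h1.trans ?_) (half_pos hl) hv0.le
      exact mul_le_mul_of_nonneg_right (le_add_of_nonneg_left hKv0) (sq_nonneg _)
  have hH : ∀ᵐ ω ∂P, |((1 - α) - confLevel α (v n)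
      ((observedFIM f n (fun i => X i ω) (θhat n ω))⁻¹ j j)) ^ 2 - c * BH n ω ^ 2| ≤
      K' * Z n ω ^ 3 := by
    filter_upwards [hexp n hN] with ω hω
    exact (hpoint _ _ ω hω.1 hω.2.2.1 fun hlt => (hω.2.2.2.2.2 hlt).1).2
  have hE : ∀ᵐ ω ∂P, |BF n ω| ≤ Kb * Z n ω ∧ |((1 - α) - confLevel α (v n)
      ((expectedFIM ν f n (θhat n ω))⁻¹ j j)) ^ 2 - c * BF n ω ^ 2| ≤ K' * Z n ω ^ 3 := by
    filter_upwards [hexp n hN] with ω hω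
    exact hpoint _ _ ω hω.1 hω.2.2.2.1 fun hlt => (hω.2.2.2.2.2 hlt).2
  have hZ3n : ∫ ω, K' * Z n ω ^ 3 ∂P ≤ K' * (KZ / n * (Real.sqrt n)⁻¹) := by
    rw [integral_const_mul]
    exact mul_le_mul_of_nonneg_left (hmom n hn0).2.1 hK'
  have hZ30 : 0 ≤ ∫ ω, K' * Z n ω ^ 3 ∂P :=
    integral_nonneg fun ω => mul_nonneg hK' (pow_nonneg (hZ.nonneg n ω) 3)
  have hBF0 : 0 ≤ ∫ ω, c * BF n ω ^ 2 ∂P :=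
    integral_nonneg fun ω => mul_nonneg hc.le (sq_nonneg _)
  have hZ3n' : n * ∫ ω, K' * Z n ω ^ 3 ∂P ≤ K' * KZ * (Real.sqrt n)⁻¹ := by
    refine (mul_le_mul_of_nonneg_left hZ3n hn'.le).trans (le_of_eq ?_)
    field_simp
  refine ⟨(lintegral_ofReal_bounds (Eventually.of_forall fun _ => sq_nonneg _) (iBH n) (iZ3 n)
    hH).1, (lintegral_ofReal_bounds (Eventually.of_forall fun _ => sq_nonneg _) (iBF n) (iZ3 n)
    (hE.mono fun ω hω => hω.2)).2, add_nonneg hBF0 hZ30, ?_, ?_⟩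
  · set τ := (n : ℝ)⁻¹ * ∑ i ∈ Finset.range n, Var[curvatureTerm P ν f X θ₀ j n i; P] with hτ
    have hτ0 : 0 ≤ τ :=
      mul_nonneg (inv_nonneg.2 hn'.le) (Finset.sum_nonneg fun i _ => variance_nonneg _ _)
    -- The squared offsets and the second moments of `leadExpected` cancel, leaving only the
    -- residual variance.
    have hdiff : n * (∫ ω, c * BH n ω ^ 2 ∂P - ∫ ω, c * BF n ω ^ 2 ∂P) = c / v n ^ 2 * τ := by
      rw [integral_const_mul, integral_const_mul,
        integral_sub_div_sq (h.memLp_leadObserved j n) (h.integral_leadObserved j n),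
        integral_sub_div_sq (h.memLp_leadExpected j n) (h.integral_leadExpected j n),
        h.integral_leadObserved_sq hn j, ← hτ]
      field_simp
      ring
    have hcoef : c / (2 * l) ^ 2 * τ ≤ c / v n ^ 2 * τ := by
      have := pow_le_pow_left₀ hvpos.le hv1.le 2
      gcongr
    have hs : 0 ≤ c * Kb ^ 2 * KZ * (Real.sqrt n)⁻¹ := by positivity
    have e : n * (∫ ω, c * BH n ω ^ 2 ∂P - ∫ ω, K' * Z n ω ^ 3 ∂P -
        (∫ ω, c * BF n ω ^ 2 ∂P + ∫ ω, K' * Z n ω ^ 3 ∂P)) =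
        n * (∫ ω, c * BH n ω ^ 2 ∂P - ∫ ω, c * BF n ω ^ 2 ∂P) -
          2 * (n * ∫ ω, K' * Z n ω ^ 3 ∂P) := by ring
    rw [e, hdiff]
    linarith
  · have hsq : ∫ ω, c * BF n ω ^ 2 ∂P ≤ c * Kb ^ 2 * (KZ / n) := by
      calc ∫ ω, c * BF n ω ^ 2 ∂P ≤ ∫ ω, c * Kb ^ 2 * Z n ω ^ 2 ∂P := by
            refine integral_mono_ae (iBF n)
              (((hZ.memLp n).integrable_pow_of_four (by norm_num)).const_mul _) ?_
            filter_upwards [hE] with ω hω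
            have := pow_le_pow_left₀ (abs_nonneg _) hω.1 2
            rw [sq_abs, mul_pow] at this
            rw [mul_assoc]
            exact mul_le_mul_of_nonneg_left this hc.le
        _ ≤ c * Kb ^ 2 * (KZ / n) := by
            rw [integral_const_mul]
            exact mul_le_mul_of_nonneg_left (hmom n hn0).1 (by positivity)
    have h1 : n * ∫ ω, c * BF n ω ^ 2 ∂P ≤ c * Kb ^ 2 * KZ := by
      refine (mul_le_mul_of_nonneg_left hsq hn'.le).trans (le_of_eq ?_)
      field_simp
    have hsqrt : (Real.sqrt n)⁻¹ ≤ 1 :=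
      inv_le_one_of_one_le₀ (Real.one_le_sqrt.2 (by exact_mod_cast hn0))
    have h2 : K' * KZ * (Real.sqrt n)⁻¹ ≤ K' * KZ :=
      mul_le_of_le_one_right (by positivity) hsqrt
    have h3 : 0 ≤ K' * KZ := by positivity
    rw [mul_add]
    linarith

end SampleModel

theorem mseObserved_ne_top {P : Measure Ω} [IsProbabilityMeasure P] (f : ℕ → 𝒳 → Param p → ℝ)
    (X : ℕ → Ω → 𝒳) (θhat : ℕ → Ω → Param p) {α : ℝ} (hα : 0 < α) (hα' : α < 1) (j : Fin p)
    (n : ℕ) : mseObserved P f X θhat α j n ≠ ⊤ := by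
  refine ne_top_of_le_ne_top (b := ∫⁻ _, ENNReal.ofReal 4 ∂P) (by simp) ?_
  refine lintegral_mono fun ω => ENNReal.ofReal_le_ofReal ?_
  have := pow_le_pow_left₀ (abs_nonneg _) (abs_sub_confLevel_le_two (v := normCov P θhat n j j)
    (x := (observedFIM f n (fun i => X i ω) (θhat n ω))⁻¹ j j) hα hα') 2
  rw [sq_abs] at this
  linarith

end

/-! ### Assembly of the comparison. -/

theorem theorem1 {p : ℕ} {𝒳 Ω : Type*} [MeasurableSpace 𝒳] [MeasurableSpace Ω]
    (P : Measure Ω) [IsProbabilityMeasure P]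
    (ν : ℕ → Measure 𝒳) (f : ℕ → 𝒳 → Param p → ℝ) (Θ : Set (Param p)) (θ₀ : Param p)
    (hreg : RegularModel ν f Θ θ₀)
    (X : ℕ → Ω → 𝒳) (hX : ∀ i, Measurable (X i)) (hindep : iIndepFun X P)
    (hlaw : ∀ i, P.map (X i) = obsLaw ν f i θ₀)
    (θhat : ℕ → Ω → Param p) (hmle : IsMLE P f Θ X θhat)
    (j : Fin p) (α : ℝ) (hα : 0 < α) (hα' : α < 1) :
    (0 ≤ liminf (fun n : ℕ => (n : EReal) *
        ((mseObserved P f X θhat α j n : EReal) - (mseExpected P ν f θhat α j n : EReal))) atTop) ∧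
    (0 < liminf (fun n : ℕ => (n : ℝ≥0∞) * mseObserved P f X θhat α j n) atTop →
      1 ≤ liminf (fun n => mseObserved P f X θhat α j n / mseExpected P ν f θhat α j n) atTop) ∧
    (NondegenerateCurvature P ν f X θ₀ j →
      1 < liminf (fun n => mseObserved P f X θhat α j n / mseExpected P ν f θhat α j n) atTop) := by
  obtain ⟨ρ, C, M, b, hρ, hball, hmodel, hmeas, hpos, hlip⟩ := hreg.exists_localModel
  have h : SampleModel P ν f Θ θ₀ X ρ C M b :=
    ⟨hX, hindep, hlaw, hρ, hball, hmodel, hmeas, hpos, hlip⟩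
  obtain ⟨F, hF, hlim⟩ := hreg.fim_limit
  obtain ⟨u, w, c, K, hc, hK, hb⟩ := h.exists_mse_bounds hreg hF hlim hmle j hα hα'
  refine liminf_comparison hc hK (mseObserved_ne_top f X θhat hα hα' j)
    (hb.mono fun n hn => ⟨hn.1, hn.2.1, hn.2.2.1, ?_, hn.2.2.2⟩)
  exact mul_nonneg (by positivity) (Finset.sum_nonneg fun i _ => variance_nonneg _ _)
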